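/- Let $\mathbb F_q$ be the finite field with $q$ elements, let $K$ be the function field of a geometrically connected smooth projective curve $X$ over $\mathbb F_q$, and let $\infty$ be a place of $K$ of degree one. Let $A\subset K$ be the ring of elements that are regular outside $\infty$. Let $K_\infty$ be the completion of $K$ at $\infty$, let $\overline K_\infty$ be an algebraic closure of $K_\infty$, and let $\mathbb C_\infty$ be the completion of $\overline K_\infty$. Fix a uniformizer $\pi$ of $K_\infty$, so that $K_\infty=\mathbb F_q((\pi))$. For $x\in K_\infty^\times$ let $\mathrm{sgn}(x)\in\mathbb F_q^\times$ be the leading coefficient of $x$ as a Laurent series in $\pi$, and let $\deg x=-v_\infty(x)$. Let $A_{+,d}$ be the set of $a\in A\setminus\{0\}$ with $\deg a=d$ and $\mathrm{sgn}(a)=1$. For positive integers $s_1,\dots,s_r$ let $$\zeta_A(s_1,\dots,s_r)=\lim_{d\to\infty}\ \sum_{d>d_1>\dots>d_r\ge 0}\ \prod_{j=1}^r\ \sum_{a\in A_{+,d_j}}\frac1{a^{s_j}}\in K_\infty ,\qquad \zeta_A(\emptyset)=1 .$$ For an $\mathbb F_q$-algebra $R$, let $R[[\tau]]$ be the ring of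 Frobenius power series $\sum_i r_i\tau^i$ with $\tau r=r^q\tau$, and $R[\tau]$ its subring of polynomials. Let $\phi:A\to\overline K_\infty[\tau]$ be the standard sign-normalized Drinfeld module of rank one. That is, $\phi$ is an $\mathbb F_q$-algebra homomorphism with $\phi_a=a+\dots+\mathrm{sgn}(a)\tau^{\deg a}$ for all $a\in A\setminus\{0\}$. Its exponential $\exp_\phi=\sum_{k\ge0}\epsilon_k\tau^k$ is the unique series in $\overline K_\infty[[\tau]]$ with $\epsilon_0=1$ and $\exp_\phi a=\phi_a\exp_\phi$ for all $a\in A$. Viewed as the entire function $z\mapsto\sum_k\epsilon_kz^{q^k}$ on $\mathbb C_\infty$, it has as its kernel a free $A$-module of rank one. Let $\widetilde\pi_\phi\in\mathbb C_\infty^\times$ be any generator of this kernel, so $\ker\exp_\phi=A\widetilde\pi_\phi$. The product $\exp_A(z)=z\prod_{a\in A\setminus\{0\}}(1-z/a)$ converges for all $z\in\mathbb C_\infty$ and defines an entire function of the form $z\mapsto\sum_ke_kz^{q^k}$ with $e_k\in K_\infty$. It is identified with the operator $\exp_A=\sum_ke_k\tau^k\in K_\infty[[\tau]]$. Then the limits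 defining $\zeta_A(q-1,q(q-1),\dots,q^{k-1}(q-1))$ exist for all $k\ge0$ (with the empty tuple for $k=0$), and $$\exp_A=\widetilde\pi_\phi^{-1}\exp_\phi\widetilde\pi_\phi=\sum_{k\ge0}(-1)^k\,\zeta_A\big(q-1,q(q-1),\dots,q^{k-1}(q-1)\big)\,\tau^k .$$ The first equality is an identity in $\mathbb C_\infty[[\tau]]$, and the outer two series are equal in $K_\infty[[\tau]]$. Equivalently, for all $k\ge0$, $$\zeta_A\big(q-1,q(q-1),\dots,q^{k-1}(q-1)\big)=(-1)^k\,\epsilon_k\,\widetilde\pi_\phi^{\,q^k-1}.$$ Hence these multiple zeta values are Eulerian: for all $k\ge0$, the quotient of $\zeta_A(q-1,\dots,q^{k-1}(q-1))$ by $\widetilde\pi_\phi^{\,w}$ is algebraic over $K$, where $w=q^k-1$ is the weight, that is, the sum of the entries of the tuple. -/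

import Mathlib

open Filter Topology

set_option linter.unusedSectionVars false

noncomputable section

namespace FunctionFieldMZV

/-! ### Frobenius power series -/

/-- The ring `R[[τ]]` of Frobenius power series `∑ fₙ τⁿ` over an algebra `R` over the finite
field `F` with `q` elements, with `τ c = c ^ q τ` for `c` in `R`. -/
structure FrobSeries (F R : Type*) where
  /-- The coefficient of `τ ^ n`. -/
  coeff : ℕ → R

namespace FrobSeries

variable {F R S : Type*}

@[ext] theorem ext {f g : FrobSeries F R} (h : ∀ n, f.coeff n = g.coeff n) : f = g := by
  cases f; cases g; congr; exact funext h

section Ring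

variable [Field F] [Fintype F] [CommRing R] [Algebra F R]

theorem frobenius_pow_apply (i : ℕ) (x : R) :
    (FiniteField.frobeniusAlgHom F R ^ i) x = x ^ Fintype.card F ^ i := by
  rw [AlgHom.coe_pow, FiniteField.coe_frobeniusAlgHom, pow_iterate]

theorem add_pow_card (i : ℕ) (x y : R) :
    (x + y) ^ Fintype.card F ^ i = x ^ Fintype.card F ^ i + y ^ Fintype.card F ^ i := by
  simp only [← frobenius_pow_apply, map_add]

theorem sum_pow_card {ι : Type*} (s : Finset ι) (g : ι → R) (i : ℕ) :
    (∑ j ∈ s, g j) ^ Fintype.card F ^ i = ∑ j ∈ s, g j ^ Fintype.card F ^ i := by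
  simp only [← frobenius_pow_apply, map_sum]

theorem algebraMap_pow_card (c : F) (i : ℕ) :
    algebraMap F R c ^ Fintype.card F ^ i = algebraMap F R c := by
  rw [← frobenius_pow_apply, AlgHom.commutes]

theorem zero_pow_card (i : ℕ) : (0 : R) ^ Fintype.card F ^ i = 0 :=
  zero_pow (pow_ne_zero _ Fintype.card_ne_zero)

instance : Zero (FrobSeries F R) := ⟨⟨fun _ => 0⟩⟩
instance : Add (FrobSeries F R) := ⟨fun f g => ⟨fun n => f.coeff n + g.coeff n⟩⟩
instance : Neg (FrobSeries F R) := ⟨fun f => ⟨fun n => -f.coeff n⟩⟩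

/-- The constant series `r`. -/
def C (r : R) : FrobSeries F R := ⟨fun n => if n = 0 then r else 0⟩

instance : One (FrobSeries F R) := ⟨C 1⟩

/-- `(∑ fᵢ τⁱ) (∑ gⱼ τʲ) = ∑ fᵢ gⱼ ^ (q ^ i) τ ^ (i + j)`. -/
instance : Mul (FrobSeries F R) := ⟨fun f g => ⟨fun n =>
  ∑ p ∈ Finset.HasAntidiagonal.antidiagonal n, f.coeff p.1 * g.coeff p.2 ^ Fintype.card F ^ p.1⟩⟩

@[simp] theorem coeff_zero (n : ℕ) : (0 : FrobSeries F R).coeff n = 0 := rfl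
@[simp] theorem coeff_add (f g : FrobSeries F R) (n : ℕ) :
    (f + g).coeff n = f.coeff n + g.coeff n := rfl
@[simp] theorem coeff_neg (f : FrobSeries F R) (n : ℕ) : (-f).coeff n = -f.coeff n := rfl
theorem coeff_C (r : R) (n : ℕ) : (C r : FrobSeries F R).coeff n = if n = 0 then r else 0 := rfl
theorem one_def : (1 : FrobSeries F R) = C 1 := rfl
theorem coeff_mul (f g : FrobSeries F R) (n : ℕ) :
    (f * g).coeff n =
      ∑ p ∈ Finset.HasAntidiagonal.antidiagonal n, f.coeff p.1 * g.coeff p.2 ^ Fintype.card F ^ p.1 := rfl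

@[simp] theorem coeff_C_mul (r : R) (f : FrobSeries F R) (n : ℕ) :
    (C r * f).coeff n = r * f.coeff n := by
  rw [coeff_mul, Finset.sum_eq_single (0, n)]
  · simp [coeff_C]
  · rintro ⟨i, j⟩ hp hne
    have hi : i ≠ 0 := by
      rintro rfl
      simp only [Finset.HasAntidiagonal.mem_antidiagonal, zero_add] at hp
      exact hne (by rw [hp])
    simp [coeff_C, hi]
  · intro h; simp at h

@[simp] theorem coeff_mul_C (r : R) (f : FrobSeries F R) (n : ℕ) :
    (f * C r).coeff n = f.coeff n * r ^ Fintype.card F ^ n := by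
  rw [coeff_mul, Finset.sum_eq_single (n, 0)]
  · simp [coeff_C]
  · rintro ⟨i, j⟩ hp hne
    have hj : j ≠ 0 := by
      rintro rfl
      simp only [Finset.HasAntidiagonal.mem_antidiagonal, add_zero] at hp
      exact hne (by rw [hp])
    simp [coeff_C, hj, zero_pow_card (F := F) (R := R)]
  · intro h; simp at h

instance : AddCommGroup (FrobSeries F R) where
  add_assoc _ _ _ := ext fun _ => add_assoc _ _ _
  zero_add _ := ext fun _ => zero_add _
  add_zero _ := ext fun _ => add_zero _
  add_comm _ _ := ext fun _ => add_comm _ _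
  neg_add_cancel _ := ext fun _ => neg_add_cancel _
  nsmul := nsmulRec
  zsmul := zsmulRec

theorem mul_assoc' (f g h : FrobSeries F R) : f * g * h = f * (g * h) := by
  ext n
  simp only [coeff_mul, sum_pow_card, Finset.mul_sum, Finset.sum_mul]
  rw [Finset.sum_sigma', Finset.sum_sigma']
  refine Finset.sum_nbij' (fun x => ⟨(x.2.1, x.2.2 + x.1.2), (x.2.2, x.1.2)⟩)
    (fun x => ⟨(x.1.1 + x.2.1, x.2.2), (x.1.1, x.2.1)⟩) ?_ ?_ ?_ ?_ ?_
  · rintro ⟨⟨a, b⟩, ⟨c, d⟩⟩ hx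
    simp only [Finset.mem_sigma, Finset.HasAntidiagonal.mem_antidiagonal] at hx ⊢
    exact ⟨by omega, trivial⟩
  · rintro ⟨⟨a, b⟩, ⟨c, d⟩⟩ hx
    simp only [Finset.mem_sigma, Finset.HasAntidiagonal.mem_antidiagonal] at hx ⊢
    exact ⟨by omega, trivial⟩
  · rintro ⟨⟨a, b⟩, ⟨c, d⟩⟩ hx
    simp only [Finset.mem_sigma, Finset.HasAntidiagonal.mem_antidiagonal] at hx ⊢
    obtain ⟨_, rfl⟩ := hx
    rfl
  · rintro ⟨⟨a, b⟩, ⟨c, d⟩⟩ hx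
    simp only [Finset.mem_sigma, Finset.HasAntidiagonal.mem_antidiagonal] at hx ⊢
    obtain ⟨_, rfl⟩ := hx
    rfl
  · rintro ⟨⟨a, b⟩, ⟨c, d⟩⟩ hx
    simp only [Finset.mem_sigma, Finset.HasAntidiagonal.mem_antidiagonal] at hx
    obtain ⟨_, rfl⟩ := hx
    simp only [mul_pow, ← pow_mul, ← pow_add, mul_assoc, add_comm]

instance : Ring (FrobSeries F R) where
  mul_assoc := mul_assoc'
  one_mul f := ext fun n => by simp [one_def]
  mul_one f := ext fun n => by simp [one_def]
  zero_mul f := ext fun n => by simp [coeff_mul]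
  mul_zero f := ext fun n => by simp [coeff_mul, zero_pow_card (F := F) (R := R)]
  left_distrib f g h := ext fun n => by
    simp [coeff_mul, add_pow_card, mul_add, Finset.sum_add_distrib]
  right_distrib f g h := ext fun n => by
    simp [coeff_mul, add_mul, Finset.sum_add_distrib]
  neg_add_cancel := neg_add_cancel
  zsmul := zsmulRec

/-- Elements of `F` commute with `τ`, so `R[[τ]]` is an `F`-algebra. -/
instance : Algebra F (FrobSeries F R) := RingHom.toAlgebra'
  { toFun := fun c => C (algebraMap F R c)
    map_one' := by rw [map_one]; rfl
    map_mul' := fun a b => ext fun n => by by_cases h : n = 0 <;> simp [coeff_C, h]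
    map_zero' := ext fun n => by simp [coeff_C]
    map_add' := fun a b => ext fun n => by by_cases h : n = 0 <;> simp [coeff_C, h] }
  fun c f => ext fun n => by
    change (C (algebraMap F R c) * f).coeff n = (f * C (algebraMap F R c)).coeff n
    rw [coeff_C_mul, coeff_mul_C, algebraMap_pow_card, mul_comm]

theorem algebraMap_eq (c : F) : algebraMap F (FrobSeries F R) c = C (algebraMap F R c) := rfl

end Ring

/-- Apply a ring homomorphism `R → S` to all coefficients. -/
def map [CommRing R] [CommRing S] (f : R →+* S) (E : FrobSeries F R) : FrobSeries F S :=
  ⟨fun n => f (E.coeff n)⟩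

/-- The `F`-linear series `∑ Eₙ z ^ (q ^ n)` attached to `E = ∑ Eₙ τⁿ` over `R`
converges at the point `z` of the topological `R`-algebra `S`, with sum `w`. -/
def HasValue [Fintype F] [CommRing R] [CommRing S] [TopologicalSpace S] [Algebra R S]
    (E : FrobSeries F R) (z w : S) : Prop :=
  HasSum (fun n => algebraMap R S (E.coeff n) * z ^ Fintype.card F ^ n) w

end FrobSeries

/-- The skew polynomial ring `R[τ]`, as the subalgebra of `R[[τ]]` of the series with only
finitely many nonzero coefficients. -/
def FrobPoly (F R : Type*) [Field F] [Fintype F] [CommRing R] [Algebra F R] :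
    Subalgebra F (FrobSeries F R) where
  carrier := {f | ∃ N, ∀ n, N ≤ n → f.coeff n = 0}
  mul_mem' := by
    rintro f g ⟨M, hM⟩ ⟨N, hN⟩
    refine ⟨M + N, fun n hn => ?_⟩
    rw [FrobSeries.coeff_mul]
    refine Finset.sum_eq_zero fun p hp => ?_
    rw [Finset.HasAntidiagonal.mem_antidiagonal] at hp
    by_cases h : M ≤ p.1
    · rw [hM _ h, zero_mul]
    · rw [hN _ (by omega), FrobSeries.zero_pow_card, mul_zero]
  add_mem' := by
    rintro f g ⟨M, hM⟩ ⟨N, hN⟩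
    refine ⟨M + N, fun n hn => ?_⟩
    rw [FrobSeries.coeff_add, hM _ (by omega), hN _ (by omega), add_zero]
  algebraMap_mem' := fun c => ⟨1, fun n hn => by
    rw [FrobSeries.algebraMap_eq, FrobSeries.coeff_C, if_neg (by omega)]⟩

/-! ### The function field, its rational place, and the base ring -/

/-- `K` is the function field of a geometrically connected smooth projective curve over the finite
field `F`: it is a finite extension of a rational function field `F(x)`, and
`F` is algebraically closed in `K`. -/
def IsCurveFunctionField (F K : Type*) [Field F] [Field K] [Algebra F K] : Prop :=
  (∃ x : K, Transcendental F x ∧ FiniteDimensional (IntermediateField.adjoin F {x}) K) ∧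
    ∀ x : K, IsAlgebraic F x → x ∈ Set.range (algebraMap F K)

/-- A place of degree one of `K` over `F`, given by its normalized valuation, written
multiplicatively: `v f = exp (-ord f)`, where `ord` is the additive valuation. -/
structure RationalPlace (F K : Type*) [Field F] [Field K] [Algebra F K] where
  /-- The multiplicative valuation `v f = exp (-ord f)`. -/
  v : Valuation K (WithZero (Multiplicative ℤ))
  /-- The valuation is trivial on the constants. -/
  v_const : ∀ c : F, c ≠ 0 → v (algebraMap F K c) = 1
  /-- The valuation is normalized. -/
  v_surjective : Function.Surjective v
  /-- The residue field is `F`. -/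
  residue : ∀ f : K, v f ≤ 1 → ∃ c : F, v (f - algebraMap F K c) < 1

namespace RationalPlace

variable {F K : Type*} [Field F] [Field K] [Algebra F K]

section Base

variable (P : RationalPlace F K)

/-- The base ring `A`: the elements of `K` regular at all places other than `∞`. The places of `K`
are the valuation rings of `K` that contain `F` (and `K` itself, which imposes no condition). -/
def A : Subalgebra F K where
  carrier := {f | ∀ O : ValuationSubring K, (∀ c : F, algebraMap F K c ∈ O) →
    O ≠ P.v.valuationSubring → f ∈ O}
  mul_mem' := fun hf hg O h1 h2 => mul_mem (hf O h1 h2) (hg O h1 h2)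
  add_mem' := fun hf hg O h1 h2 => add_mem (hf O h1 h2) (hg O h1 h2)
  algebraMap_mem' := fun c _ h1 _ => h1 c

/-- `f` is nonzero of degree `d`, where `deg f = -ord f`. -/
def HasDegree (f : K) (d : ℕ) : Prop := P.v f = WithZero.exp (d : ℤ)

end Base

variable [Fintype F] (P : RationalPlace F K)

theorem one_lt_card : (1 : NNReal) < (Fintype.card F : NNReal) := by
  exact_mod_cast Fintype.one_lt_card (α := F)

/-- The absolute value `|f| = q ^ (deg f)` on `K` attached to the place `∞`. -/
def abs : AbsoluteValue K ℝ where
  toFun f := (WithZeroMulInt.toNNReal (one_lt_card (F := F)).ne_zero (P.v f) : ℝ)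
  map_mul' f g := by simp
  nonneg' f := NNReal.coe_nonneg _
  eq_zero' f := by simp
  add_le' f g := by
    have h := (WithZeroMulInt.toNNReal_strictMono (one_lt_card (F := F))).monotone
      (P.v.map_add f g)
    rw [(WithZeroMulInt.toNNReal_strictMono (one_lt_card (F := F))).monotone.map_max] at h
    exact_mod_cast h.trans (max_le_add_of_nonneg zero_le zero_le)

theorem abs_add_le_max (f g : K) : P.abs (f + g) ≤ max (P.abs f) (P.abs g) := by
  have h := (WithZeroMulInt.toNNReal_strictMono (one_lt_card (F := F))).monotone
    (P.v.map_add f g)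
  rw [(WithZeroMulInt.toNNReal_strictMono (one_lt_card (F := F))).monotone.map_max] at h
  exact_mod_cast h

/-- The completion `K_∞` of `K` at the place `∞`. -/
abbrev KInf := P.abs.Completion

theorem norm_algebraMap_KInf (f : K) : ‖algebraMap K P.KInf f‖ = P.abs f :=
  UniformSpace.Completion.norm_coe (WithAbs.toAbs P.abs f)

instance isUltrametricDist_KInf : IsUltrametricDist P.KInf :=
  IsUltrametricDist.isUltrametricDist_of_forall_norm_add_le_max_norm fun x y => by
    induction x, y using UniformSpace.Completion.induction_on₂ with
    | hp => exact isClosed_le (by fun_prop) (by fun_prop)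
    | ih a b =>
      rw [← UniformSpace.Completion.coe_add]
      simp only [UniformSpace.Completion.norm_coe]
      exact P.abs_add_le_max a.ofAbs b.ofAbs

instance nontriviallyNormedField_KInf : NontriviallyNormedField P.KInf where
  non_trivial := by
    obtain ⟨f, hf⟩ := P.v_surjective (WithZero.exp 1)
    refine ⟨algebraMap K P.KInf f, ?_⟩
    rw [norm_algebraMap_KInf]
    have h : (1 : WithZero (Multiplicative ℤ)) < P.v f := by
      rw [hf, ← WithZero.exp_zero, WithZero.exp_lt_exp]; exact one_pos
    have := WithZeroMulInt.toNNReal_strictMono (one_lt_card (F := F)) h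
    rw [map_one] at this
    exact_mod_cast this

/-- A fixed algebraic closure of `K_∞`. -/
abbrev KBar := AlgebraicClosure P.KInf

/-- The unique extension of the absolute value to the algebraic closure. -/
instance normedField_KBar : NormedField P.KBar := spectralNorm.normedField P.KInf P.KBar

instance uniformContinuousConstSMul_KBar {R : Type*} [CommRing R] [Algebra R P.KBar] :
    UniformContinuousConstSMul R P.KBar where
  uniformContinuous_const_smul r := by
    simp_rw [Algebra.smul_def]
    exact (Ring.uniformContinuousConstSMul _).uniformContinuous_const_smul _

/-- The completion `ℂ_∞` of the algebraic closure of `K_∞`. -/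
abbrev CInf := UniformSpace.Completion P.KBar

/-! ### Signs and multiple zeta values -/

open Classical in
/-- The sign function attached to the uniformizer `π`: for nonzero `x`, the leading
coefficient `c` of `x = c π ^ m + ⋯` as a Laurent series in `π`. It is extended by `0` at `0`. -/
def sgn (π x : P.KInf) : F :=
  if h : ∃ c : F, c ≠ 0 ∧ ∃ m : ℤ, ‖π ^ m * x - algebraMap F P.KInf c‖ < 1 then h.choose else 0

/-- The set of the monic elements of degree `d` of the base ring. -/
def monics (π : P.KInf) (d : ℕ) : Set K :=
  {a | a ∈ P.A ∧ P.HasDegree a d ∧ P.sgn π (algebraMap K P.KInf a) = 1}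

/-- The power sum `S_d(n) = ∑ 1 / a ^ n` over the (finitely many) monic `a` of degree `d`. -/
def powerSum (π : P.KInf) (d n : ℕ) : K := ∑ᶠ a ∈ P.monics π d, 1 / a ^ n

/-- The sums `S_{<d}(s₁, …, s_r) = ∑_{i < d} S_i(s₁) S_{<i}(s₂, …, s_r)`, with value `1` for
the empty tuple. -/
def powerSumLT (π : P.KInf) : List ℕ → ℕ → K
  | [], _ => 1
  | n :: s, d => ∑ i ∈ Finset.range d, P.powerSum π i n * powerSumLT π s i

/-- Thakur's multiple zeta value `ζ_A(s₁, …, s_r)`, the limit in `K_∞` of `S_{<d}(s₁, …, s_r)`. -/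
def zeta (π : P.KInf) (s : List ℕ) : P.KInf :=
  limUnder atTop fun d => algebraMap K P.KInf (P.powerSumLT π s d)

variable (F) in
/-- The tuple `(q - 1, q (q - 1), …, q ^ (k - 1) (q - 1))` of length `k`. -/
def zagierTuple (k : ℕ) : List ℕ :=
  (List.range k).map fun i => Fintype.card F ^ i * (Fintype.card F - 1)

/-- The series `∑ (-1) ^ k ζ_A(q - 1, q (q - 1), …, q ^ (k - 1) (q - 1)) τ ^ k`. -/
def zetaSeries (π : P.KInf) : FrobSeries F P.KInf :=
  ⟨fun k => (-1) ^ k * P.zeta π (zagierTuple F k)⟩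

/-! ### The exponential of the lattice `A` -/

/-- The entire function `exp_A(z) = z ∏ (1 - z / a)` on `ℂ_∞`, the product being over the nonzero
elements of `A`. -/
def expA (z : P.CInf) : P.CInf :=
  z * ∏' a : {a : P.A // a ≠ 0}, (1 - z / algebraMap K P.CInf (a : P.A))

/-- The operator in `K_∞[[τ]]` that is identified with the function `exp_A`: the series
`∑ e_k τ ^ k` such that `exp_A(z) = ∑ e_k z ^ (q ^ k)` for all `z`. -/
def expASeries : FrobSeries F P.KInf :=
  Classical.epsilon fun E : FrobSeries F P.KInf => ∀ z : P.CInf, E.HasValue z (P.expA z)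

/-! ### Drinfeld modules -/

/-- The `F`-algebra homomorphism `φ : A → K̄_∞[τ]` is a sign-normalized Drinfeld module of rank one:
`φ_a = a + ⋯ + sgn(a) τ ^ (deg a)` for all nonzero `a`. -/
def IsSgnNormalized (π : P.KInf) (φ : P.A →ₐ[F] FrobPoly F P.KBar) : Prop :=
  ∀ (a : P.A) (d : ℕ), P.HasDegree (a : K) d →
    (φ a : FrobSeries F P.KBar).coeff 0 = algebraMap K P.KBar a ∧
    (φ a : FrobSeries F P.KBar).coeff d =
      algebraMap F P.KBar (P.sgn π (algebraMap K P.KInf a)) ∧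
    ∀ n, d < n → (φ a : FrobSeries F P.KBar).coeff n = 0

/-- `E = 1 + ⋯` satisfies `E a = φ_a E` for all `a` in `A`. -/
def IsExponential (φ : P.A →ₐ[F] FrobPoly F P.KBar) (E : FrobSeries F P.KBar) : Prop :=
  E.coeff 0 = 1 ∧
    ∀ a : P.A, E * FrobSeries.C (algebraMap K P.KBar a) = (φ a : FrobSeries F P.KBar) * E

/-- The exponential series `exp_φ` of `φ`. -/
def expSeries (φ : P.A →ₐ[F] FrobPoly F P.KBar) : FrobSeries F P.KBar :=
  Classical.epsilon (P.IsExponential φ)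

/-- `ϖ` is a fundamental period of `φ`: the kernel of the entire function `exp_φ` on `ℂ_∞` is the
free `A`-module of rank one `A ϖ`. -/
def IsFundamentalPeriod (φ : P.A →ₐ[F] FrobPoly F P.KBar) (ϖ : P.CInf) : Prop :=
  ϖ ≠ 0 ∧ {z : P.CInf | (P.expSeries φ).HasValue z 0} =
    {z : P.CInf | ∃ a : P.A, z = algebraMap K P.CInf a * ϖ}

/-- `φ` is the standard sign-normalized Drinfeld module of rank one: the kernel of `exp_φ` is a
free `A`-module of rank one. -/
def IsStandard (π : P.KInf) (φ : P.A →ₐ[F] FrobPoly F P.KBar) : Prop :=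
  P.IsSgnNormalized π φ ∧ ∃ ϖ : P.CInf, P.IsFundamentalPeriod φ ϖ

/-- `ζ_A(s)` is Eulerian with respect to the period `ϖ`: the quotient of `ζ_A(s)` by `ϖ` to
the weight of `s` is algebraic over `K`. -/
def IsEulerian (π : P.KInf) (ϖ : P.CInf) (s : List ℕ) : Prop :=
  IsAlgebraic K (algebraMap P.KInf P.CInf (P.zeta π s) / ϖ ^ s.sum)

end RationalPlace

end FunctionFieldMZV

end

/-! Let A_{<d} be the finite F-space of elements of A of degree less than d, and e_d = X ∏ (1 -
X/a), the product over its nonzero elements. An F-linear polynomial with linear coefficient 1 is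
determined by its roots, so adjoining an element m of degree d replaces e_d by (1 - s τ) e_d with s
= e_d(m)^{-(q-1)}. Grouping the new factors into F^×-orbits of monic elements and reading off the
coefficient of X^q shows that s is the power sum S_d(q-1). Since S_d(qn) = S_d(n)^q, the signed sums
(-1)^k S_{<d}(q-1, …, q^{k-1}(q-1)) obey the same recursion, so they are the coefficients of e_d
(`linPoly_zetaCoeff`). Bounds uniform in d allow d → ∞ and identify exp_A with the zeta series
(`multipliable_and_expA_eq`).

On the other side, ϖ⁻¹ exp_φ ϖ is an entire F-linear function with linear coefficient 1 and zero set
A. A nonarchimedean Weierstrass factorization (`IsEntire.tendsto_rootPoly`) makes it the limit of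
the same e_d, and an entire F-linear function determines its coefficients
(`algebraMap_zetaSeries_coeff`).

For the Eulerian property the coefficients of exp_φ must be algebraic over K; by recursion it is
enough to treat those of one φ_a with deg a = m > 0 (`isIntegral_coeff`). If one of them is not
integral over K, some valuation ring of K̄_∞ contains K but not this coefficient, and a suitable
conjugate c⁻¹ φ c has an integral model whose reduction at a has degree d with 0 < d < m. The
reduced degree is proportional to the degree on A, because ∞ is the only pole of elements of A
(`reducedDegree_mul_le`). Comparison with an element of degree m + 1 gives m ∣ d, a contradiction.
Consecutive degrees m, m + 1 occur by a Riemann inequality dim A_{<d} ≥ d - γ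
(`exists_le_finrank_lattice_add`): take u⁻¹ with a simple pole at ∞, and count the conditions that
remove the poles at the other zeros of u. -/

noncomputable section

namespace FunctionFieldMZV

/-! ### Valuation rings and integrality; elements of A of bounded degree. -/

/-- An element of a field that lies in every valuation subring containing the image of `R` is
integral over `R`. -/
theorem isIntegral_of_forall_mem_valuationSubring {R K : Type*} [CommRing R] [Field K]
    [Algebra R K] {x : K}
    (h : ∀ O : ValuationSubring K, (∀ r : R, algebraMap R K r ∈ O) → x ∈ O) : IsIntegral R x := by
  by_contra hx
  have : IsIntegrallyClosedIn (integralClosure R K).toSubring K :=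
    inferInstanceAs (IsIntegrallyClosedIn (integralClosure R K) K)
  have hx' : x ∉ (integralClosure R K).toSubring := hx
  obtain ⟨V, hV, hxV⟩ := Subring.exists_le_valuationSubring_of_isIntegrallyClosedIn hx'
  exact hxV (h V fun r => hV (show algebraMap R K r ∈ integralClosure R K from
    Subalgebra.algebraMap_mem _ r))

theorem mem_valuationSubring_of_isIntegral {R K : Type*} [CommRing R] [Field K]
    [Algebra R K] {x : K} (hx : IsIntegral R x) (O : ValuationSubring K)
    (hO : ∀ r : R, algebraMap R K r ∈ O) : x ∈ O := by
  let φ : R →+* O := (algebraMap R K).codRestrict O.toSubring hO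
  have : IsIntegral O x := by
    obtain ⟨p, hp, h⟩ := hx
    refine ⟨p.map φ, hp.map _, ?_⟩
    rw [Polynomial.eval₂_map]
    exact h
  obtain ⟨y, hy⟩ := IsIntegrallyClosed.isIntegral_iff.mp this
  exact hy ▸ y.2

namespace RationalPlace

variable {F K : Type*} [Field F] [Field K] [Algebra F K] (P : RationalPlace F K)

theorem v_const_le (c : F) : P.v (algebraMap F K c) ≤ 1 := by
  by_cases h : c = 0
  · simp [h]
  · exact (P.v_const c h).le

theorem v_smul {c : F} (hc : c ≠ 0) (f : K) : P.v (c • f) = P.v f := by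
  rw [Algebra.smul_def, map_mul, P.v_const c hc, one_mul]

theorem v_smul_le (c : F) (f : K) : P.v (c • f) ≤ P.v f := by
  rw [Algebra.smul_def, map_mul]
  exact mul_le_of_le_one_left' (P.v_const_le c)

/-- Such an f has no pole at all: it lies in every valuation ring containing F, so it is integral
over F, and F is algebraically closed in K. -/
theorem mem_of_v_le_one (hK : IsCurveFunctionField F K) {f : K} (hf : f ∈ P.A)
    (h : P.v f ≤ 1) : f ∈ Set.range (algebraMap F K) := by
  refine hK.2 f (IsIntegral.isAlgebraic (isIntegral_of_forall_mem_valuationSubring fun O hO => ?_))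
  by_cases hOP : O = P.v.valuationSubring
  · rw [hOP]; exact h
  · exact hf O hO hOP

theorem eq_zero_of_v_lt_one (hK : IsCurveFunctionField F K) {f : K} (hf : f ∈ P.A)
    (h : P.v f < 1) : f = 0 := by
  obtain ⟨c, rfl⟩ := P.mem_of_v_le_one hK hf h.le
  by_cases hc : c = 0
  · simp [hc]
  · exact absurd (P.v_const c hc) h.ne

/-- The space of the elements of `A` of degree less than `d`. -/
def lattice (d : ℕ) : Submodule F K where
  carrier := {f | f ∈ P.A ∧ P.v f < WithZero.exp (d : ℤ)}
  add_mem' := fun hf hg => ⟨add_mem hf.1 hg.1,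
    (P.v.map_add _ _).trans_lt (max_lt hf.2 hg.2)⟩
  zero_mem' := ⟨zero_mem _, by simp⟩
  smul_mem' := fun c f hf => ⟨P.A.smul_mem hf.1 c, (P.v_smul_le c f).trans_lt hf.2⟩

theorem mem_lattice {d : ℕ} {f : K} :
    f ∈ P.lattice d ↔ f ∈ P.A ∧ P.v f < WithZero.exp (d : ℤ) := Iff.rfl

theorem lattice_mono {d e : ℕ} (h : d ≤ e) : P.lattice d ≤ P.lattice e := fun _ hf =>
  ⟨hf.1, hf.2.trans_le (WithZero.exp_le_exp.mpr (by exact_mod_cast h))⟩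

theorem lattice_zero (hK : IsCurveFunctionField F K) : P.lattice 0 = ⊥ := by
  refine (Submodule.eq_bot_iff _).mpr fun f hf => P.eq_zero_of_v_lt_one hK hf.1 ?_
  simpa using hf.2

theorem lt_exp_add_one {x : WithZero (Multiplicative ℤ)} {d : ℤ} :
    x < WithZero.exp (d + 1) ↔ x ≤ WithZero.exp d := by
  induction x using WithZero.expRecOn with
  | zero => simp
  | exp n => rw [WithZero.exp_lt_exp, WithZero.exp_le_exp]; omega

theorem mem_lattice_succ {d : ℕ} {f : K} :
    f ∈ P.lattice (d + 1) ↔ f ∈ P.A ∧ P.v f ≤ WithZero.exp (d : ℤ) := by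
  rw [mem_lattice, Nat.cast_succ, lt_exp_add_one]

/-- Two elements of the same degree are proportional up to an element of smaller degree. -/
theorem exists_sub_smul_lt {f m : K} {d : ℤ} (hm : P.v m = WithZero.exp d)
    (hf : P.v f ≤ WithZero.exp d) : ∃ c : F, P.v (f - c • m) < WithZero.exp d := by
  have hm0 : m ≠ 0 := by
    rintro rfl
    exact WithZero.exp_ne_zero (hm.symm.trans (map_zero _))
  obtain ⟨c, hc⟩ := P.residue (f / m) (by
    rw [map_div₀, hm]; exact div_le_one_of_le₀ hf zero_le)
  refine ⟨c, ?_⟩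
  have : f - c • m = (f / m - algebraMap F K c) * m := by
    rw [Algebra.smul_def, sub_mul, div_mul_cancel₀ _ hm0]
  rw [this, map_mul, hm]
  exact mul_lt_of_lt_one_left (WithZero.exp_pos) hc

theorem lattice_succ_of_hasDegree {d : ℕ} {m : K} (hm : m ∈ P.A) (hd : P.HasDegree m d) :
    P.lattice (d + 1) = P.lattice d ⊔ Submodule.span F {m} := by
  apply le_antisymm
  · intro f hf
    rw [mem_lattice_succ] at hf
    obtain ⟨c, hc⟩ := P.exists_sub_smul_lt hd hf.2
    rw [← sub_add_cancel f (c • m)]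
    exact add_mem (Submodule.mem_sup_left ⟨sub_mem hf.1 (P.A.smul_mem hm c), hc⟩)
      (Submodule.mem_sup_right (Submodule.smul_mem _ _ (Submodule.mem_span_singleton_self m)))
  · refine sup_le (P.lattice_mono d.le_succ) ?_
    rw [Submodule.span_singleton_le_iff_mem, mem_lattice_succ]
    exact ⟨hm, le_of_eq hd⟩

theorem lattice_succ_of_forall_not {d : ℕ} (h : ∀ m ∈ P.A, ¬ P.HasDegree m d) :
    P.lattice (d + 1) = P.lattice d := by
  refine le_antisymm (fun f hf => ?_) (P.lattice_mono d.le_succ)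
  rw [mem_lattice_succ] at hf
  exact ⟨hf.1, lt_of_le_of_ne hf.2 fun h' => h f hf.1 h'⟩

theorem finite_lattice (hK : IsCurveFunctionField F K) (d : ℕ) :
    Module.Finite F (P.lattice d) := by
  induction d with
  | zero => rw [P.lattice_zero hK]; infer_instance
  | succ d ih =>
    by_cases h : ∀ m ∈ P.A, ¬ P.HasDegree m d
    · rw [P.lattice_succ_of_forall_not h]; exact ih
    · push Not at h
      obtain ⟨m, hm, hd⟩ := h
      rw [P.lattice_succ_of_hasDegree hm hd]
      infer_instance

theorem finrank_lattice_succ_le (hK : IsCurveFunctionField F K) (d : ℕ) :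
    Module.finrank F (P.lattice (d + 1)) ≤ Module.finrank F (P.lattice d) + 1 := by
  by_cases h : ∀ m ∈ P.A, ¬ P.HasDegree m d
  · rw [P.lattice_succ_of_forall_not h]; omega
  · push Not at h
    obtain ⟨m, hm, hd⟩ := h
    have := P.finite_lattice hK d
    rw [P.lattice_succ_of_hasDegree hm hd]
    refine (Submodule.finrank_add_le_finrank_add_finrank _ _).trans ?_
    have hm0 : m ≠ 0 := by
      rintro rfl
      exact WithZero.exp_ne_zero (hd.symm.trans (map_zero _))
    rw [finrank_span_singleton hm0]

/-- If the dimensions of the spaces `lattice d` grow like `d`, then two consecutive positive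
integers are degrees of elements of `A`. -/
theorem exists_consecutive_degrees_of_finrank_le (hK : IsCurveFunctionField F K) (γ : ℕ)
    (h : ∀ d, d ≤ Module.finrank F (P.lattice d) + γ) :
    ∃ m : ℕ, 0 < m ∧ (∃ a ∈ P.A, P.HasDegree a m) ∧ ∃ b ∈ P.A, P.HasDegree b (m + 1) := by
  by_contra hne
  push Not at hne
  -- At most one of the degrees 2k+1, 2k+2 occurs, and each degree contributes at most one
  -- dimension. Growth at rate 1/2 then contradicts `h` at d = 2γ + 3.
  have key : ∀ k : ℕ, Module.finrank F (P.lattice (2 * k + 1)) ≤ k + 1 := by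
    intro k
    induction k with
    | zero =>
      have := P.finrank_lattice_succ_le hK 0
      rw [P.lattice_zero hK] at this
      simpa using this
    | succ k ih =>
      have h1 := P.finrank_lattice_succ_le hK (2 * k + 1)
      have h2 := P.finrank_lattice_succ_le hK (2 * k + 1 + 1)
      rw [show 2 * (k + 1) + 1 = 2 * k + 1 + 1 + 1 by ring]
      by_cases ha : ∃ a ∈ P.A, P.HasDegree a (2 * k + 1)
      · rw [P.lattice_succ_of_forall_not (d := 2 * k + 1 + 1)
          (fun b hb hb' => hne _ (by omega) ha b hb hb')]
        omega
      · push Not at ha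
        rw [P.lattice_succ_of_forall_not ha] at h1 h2
        omega
  have h1 := h (2 * (γ + 1) + 1)
  have h2 := key (γ + 1)
  omega

end RationalPlace
end FunctionFieldMZV

/-! ### The extension K / F(u) and the ring of elements regular where u is regular. -/

namespace FunctionFieldMZV

-- K has transcendence degree one, so `u` is a transcendence basis just as `x` is and K is algebraic
-- over F(u). As K is also a finitely generated field extension, it is finite over F(u).
open IntermediateField in
theorem IsCurveFunctionField.finiteDimensional_adjoin {F K : Type*} [Field F] [Field K]
    [Algebra F K] (hK : IsCurveFunctionField F K) {u : K} (hu : Transcendental F u) :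
    FiniteDimensional F⟮u⟯ K := by
  obtain ⟨⟨x, hx, hfin⟩, -⟩ := hK
  have hxi : AlgebraicIndependent F (fun _ : Unit => x) :=
    algebraicIndependent_unique_type_iff.mpr hx
  have hui : AlgebraicIndependent F (fun _ : Unit => u) :=
    algebraicIndependent_unique_type_iff.mpr hu
  have hxb : IsTranscendenceBasis F (fun _ : Unit => x) := by
    rw [hxi.isTranscendenceBasis_iff_isAlgebraic, Set.range_const]
    open scoped algebraAdjoinAdjoin in
    exact (IsFractionRing.comap_isAlgebraic_iff (A := Algebra.adjoin F {x}) (K := F⟮x⟯)).mpr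
      inferInstance
  have hub : IsTranscendenceBasis F (fun _ : Unit => u) :=
    hui.isTranscendenceBasis_of_lift_trdeg_le_of_finite hxb.lift_cardinalMk_eq_trdeg.ge
  have halg := hub.isAlgebraic_field
  rw [Set.range_const] at halg
  have h1 : Algebra.EssFiniteType F F⟮x⟯ := by
    rw [essFiniteType_iff]
    exact fg_adjoin_of_finite (Set.finite_singleton x)
  have h2 : Algebra.EssFiniteType F K := Algebra.EssFiniteType.comp F F⟮x⟯ K
  have h3 : Algebra.EssFiniteType F⟮u⟯ K := Algebra.EssFiniteType.of_comp F F⟮u⟯ K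
  exact Algebra.finite_of_essFiniteType_of_isAlgebraic

section Regular

open Polynomial IntermediateField

variable {F K : Type*} [Field F] [Field K] [Algebra F K]

variable (F) in
/-- The elements of `K` that are regular at all places where `y` is regular. -/
def regularSubalgebra (y : K) : Subalgebra F K where
  carrier := {f | ∀ O : ValuationSubring K, (∀ c : F, algebraMap F K c ∈ O) → y ∈ O → f ∈ O}
  mul_mem' := fun hf hg O h1 h2 => mul_mem (hf O h1 h2) (hg O h1 h2)
  add_mem' := fun hf hg O h1 h2 => add_mem (hf O h1 h2) (hg O h1 h2)
  algebraMap_mem' := fun c _ h1 _ => h1 c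

theorem self_mem_regularSubalgebra (y : K) : y ∈ regularSubalgebra F y := fun _ _ h => h

theorem aeval_mem_regularSubalgebra (y : K) (p : F[X]) : aeval y p ∈ regularSubalgebra F y :=
  Algebra.adjoin_le (Set.singleton_subset_iff.mpr (self_mem_regularSubalgebra y))
    (Polynomial.aeval_mem_adjoin_singleton F y)

theorem mem_regularSubalgebra_of_isIntegral {y f : K}
    (hf : IsIntegral (Algebra.adjoin F {y}) f) : f ∈ regularSubalgebra F y := by
  intro O hO hy
  refine mem_valuationSubring_of_isIntegral hf O fun r => ?_
  have h : (r : K) ∈ regularSubalgebra F y :=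
    Algebra.adjoin_le (Set.singleton_subset_iff.mpr (self_mem_regularSubalgebra y)) r.2
  exact h O hO hy

/-- A family longer than the degree of `K` over `F(u)` satisfies a linear relation over `F[u]`
that is nontrivial modulo `u`. -/
theorem exists_relation_coeff_zero_ne_zero {u : K} (hu : u ≠ 0) [FiniteDimensional F⟮u⟯ K]
    {ι : Type*} [Fintype ι] (g : ι → K) (hι : Module.finrank F⟮u⟯ K < Fintype.card ι) :
    ∃ p : ι → F[X], ∑ i, aeval u (p i) * g i = 0 ∧ ∃ i, (p i).coeff 0 ≠ 0 := by
  have hdep : ¬ LinearIndependent (Algebra.adjoin F {u}) g := by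
    intro h
    open scoped algebraAdjoinAdjoin in
    have h' := (LinearIndependent.iff_fractionRing (Algebra.adjoin F {u}) F⟮u⟯).mp h
    have := h'.fintype_card_le_finrank
    omega
  rw [Fintype.not_linearIndependent_iff] at hdep
  obtain ⟨a, ha, i, hi⟩ := hdep
  have hrep : ∀ j, ∃ p : F[X], aeval u p = (a j : K) := fun j =>
    (SetLike.ext_iff.mp (Algebra.adjoin_singleton_eq_range_aeval F u) _).mp (a j).2
  choose p hp using hrep
  have hp0 : p i ≠ 0 := by
    intro h
    apply hi
    ext
    rw [← hp i, h, map_zero]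
    rfl
  have hsum : ∑ j, aeval u (p j) * g j = 0 := by
    rw [← ha]
    refine Finset.sum_congr rfl fun j _ => ?_
    rw [hp j]
    rfl
  -- As long as all constant terms vanish, the relation is divided by u. This terminates because the
  -- degree of one fixed nonzero coefficient drops each time.
  suffices H : ∀ (N : ℕ) (p : ι → F[X]), (p i).natDegree < N → p i ≠ 0 →
      ∑ j, aeval u (p j) * g j = 0 →
      ∃ p : ι → F[X], ∑ i, aeval u (p i) * g i = 0 ∧ ∃ i, (p i).coeff 0 ≠ 0 from
    H _ p (Nat.lt_succ_self _) hp0 hsum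
  intro N
  induction N with
  | zero => intro p h; omega
  | succ N ih =>
    intro p hdeg hpi hs
    by_cases hc : ∃ j, (p j).coeff 0 ≠ 0
    · exact ⟨p, hs, hc⟩
    · push Not at hc
      have hX : ∀ j, p j = X * (p j).divX := fun j => by
        conv_lhs => rw [← X_mul_divX_add (p j), hc j, C_0, add_zero]
      refine ih (fun j => (p j).divX) ?_ ?_ ?_
      · have h0 : (p i).divX ≠ 0 := by
          intro h
          apply hpi
          rw [hX i, h, mul_zero]
        have := congrArg natDegree (hX i)
        rw [natDegree_X_mul h0] at this
        omega
      · intro h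
        apply hpi
        rw [hX i, h, mul_zero]
      · have : u * ∑ j, aeval u (p j).divX * g j = 0 := by
          rw [← hs, Finset.mul_sum]
          refine Finset.sum_congr rfl fun j _ => ?_
          conv_rhs => rw [hX j, map_mul, aeval_X]
          ring
        exact (mul_eq_zero.mp this).resolve_left hu

/-- A family of elements of a ring containing `u` that is linearly independent modulo `u` has at
most `[K : F(u)]` elements. -/
theorem card_le_finrank_of_independent_mod {u : K} (hu : u ≠ 0) [FiniteDimensional F⟮u⟯ K]
    {ι : Type*} [Fintype ι] (C : Subalgebra F K) (huC : u ∈ C) (g : ι → K) (hg : ∀ i, g i ∈ C)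
    (hind : ∀ c : ι → F, (∃ h ∈ C, ∑ i, c i • g i = u * h) → c = 0) :
    Fintype.card ι ≤ Module.finrank F⟮u⟯ K := by
  by_contra hlt
  push Not at hlt
  obtain ⟨p, hp, i, hi⟩ := exists_relation_coeff_zero_ne_zero hu g hlt
  refine hi (congrFun (hind (fun j => (p j).coeff 0)
    ⟨-∑ j, aeval u (p j).divX * g j, ?_, ?_⟩) i)
  · refine neg_mem (sum_mem fun j _ => mul_mem ?_ (hg j))
    exact Algebra.adjoin_le (Set.singleton_subset_iff.mpr huC)
      (Polynomial.aeval_mem_adjoin_singleton F u)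
  · rw [mul_neg, ← sub_eq_zero, sub_neg_eq_add, ← hp, Finset.mul_sum, ← Finset.sum_add_distrib]
    refine Finset.sum_congr rfl fun j _ => ?_
    conv_rhs => rw [← X_mul_divX_add (p j), map_add, map_mul, aeval_X, aeval_C]
    rw [Algebra.smul_def]
    ring

theorem valuation_aeval_sub_coeff_zero_lt {O : ValuationSubring K}
    (hO : ∀ c : F, algebraMap F K c ∈ O) {u : K} (hu : O.valuation u < 1) (p : F[X]) :
    O.valuation (aeval u p - algebraMap F K (p.coeff 0)) < 1 := by
  have h : aeval u p - algebraMap F K (p.coeff 0) = u * aeval u p.divX := by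
    have := congrArg (aeval u) (X_mul_divX_add p)
    simp only [map_add, map_mul, aeval_X, aeval_C] at this
    linear_combination -this
  rw [h, map_mul]
  refine mul_lt_one_of_lt_of_le hu ((O.valuation_le_one_iff _).mpr ?_)
  exact aeval_mem_regularSubalgebra u _ O hO ((O.valuation_le_one_iff _).mp hu.le)

theorem valuation_algebraMap_eq_one {O : ValuationSubring K}
    (hO : ∀ c : F, algebraMap F K c ∈ O) {c : F} (hc : c ≠ 0) :
    O.valuation (algebraMap F K c) = 1 := by
  refine le_antisymm ((O.valuation_le_one_iff _).mpr (hO c)) ?_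
  have h := (O.valuation_le_one_iff _).mpr (hO c⁻¹)
  have h2 : O.valuation (algebraMap F K c) * O.valuation (algebraMap F K c⁻¹) = 1 := by
    rw [← map_mul, ← map_mul, mul_inv_cancel₀ hc, map_one, map_one]
  rw [← h2]
  exact mul_le_of_le_one_right' h

theorem valuation_eq_one_of_sub_lt {O : ValuationSubring K} {x y : K}
    (hy : O.valuation y = 1) (h : O.valuation (x - y) < 1) : O.valuation x = 1 := by
  rw [← hy] at h ⊢
  exact O.valuation.map_eq_of_sub_lt h

theorem valuation_aeval_eq_one {O : ValuationSubring K}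
    (hO : ∀ c : F, algebraMap F K c ∈ O) {u : K} (hu : O.valuation u < 1) {p : F[X]}
    (hp : p.coeff 0 ≠ 0) : O.valuation (aeval u p) = 1 :=
  valuation_eq_one_of_sub_lt (valuation_algebraMap_eq_one hO hp)
    (valuation_aeval_sub_coeff_zero_lt hO hu p)

/-- Two places with the same center on the ring of elements regular where `u` is regular are
comparable. -/
theorem le_of_center_eq {u : K} (hu0 : u ≠ 0) [FiniteDimensional F⟮u⟯ K]
    {O₁ O₂ : ValuationSubring K}
    (h₂ : ∀ c : F, algebraMap F K c ∈ O₂) (hu₂ : O₂.valuation u < 1)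
    (hc : ∀ s ∈ regularSubalgebra F u, O₁.valuation s < 1 ↔ O₂.valuation s < 1) : O₁ ≤ O₂ := by
  intro f hf₁
  by_contra hf₂
  have hf0 : f ≠ 0 := by rintro rfl; exact hf₂ (zero_mem _)
  obtain ⟨h, hh⟩ : ∃ h, h = f⁻¹ := ⟨_, rfl⟩
  have hh0 : h ≠ 0 := hh ▸ inv_ne_zero hf0
  have hh₁ : ¬ O₁.valuation h < 1 := by
    intro hlt
    have h1 := mul_lt_one_of_lt_of_le hlt ((O₁.valuation_le_one_iff f).mpr hf₁)
    rw [← map_mul, hh, inv_mul_cancel₀ hf0, map_one] at h1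
    exact lt_irrefl _ h1
  have hh₂ : O₂.valuation h < 1 := by
    rw [hh, map_inv₀]
    refine inv_lt_one_of_one_lt₀ (lt_of_not_ge fun hle => hf₂ ?_)
    exact (O₂.valuation_le_one_iff f).mp hle
  obtain ⟨n, hn⟩ : ∃ n, Module.finrank F⟮u⟯ K < n := ⟨_, Nat.lt_succ_self _⟩
  obtain ⟨p, hp, i, hi⟩ := exists_relation_coeff_zero_ne_zero hu0
    (fun i : Fin n => h ^ (i : ℕ)) (by simpa using hn)
  let a : ℕ → K := fun k => if hk : k < n then aeval u (p ⟨k, hk⟩) else 0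
  have ha : ∀ k, a k ∈ regularSubalgebra F u := fun k => by
    by_cases hk : k < n
    · simp only [a, hk, dif_pos]; exact aeval_mem_regularSubalgebra u _
    · simp only [a, hk, dif_neg, not_false_eq_true]; exact zero_mem _
  have hsum : ∑ k ∈ Finset.range n, a k * h ^ k = 0 := by
    rw [← hp, Finset.sum_range]
    refine Finset.sum_congr rfl fun k _ => ?_
    simp [a]
  -- Horner tails b_k = ∑_{l ≥ k} a_l h^{l-k}. They are regular wherever u is: if h is in O this is
  -- clear, and otherwise the relation ∑ a_l h^l = 0 rewrites b_k, for k ≤ n, as a polynomial in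
  -- h⁻¹.
  let b : ℕ → K := fun k => ∑ l ∈ Finset.Ico k n, a l * (h ^ l / h ^ k)
  have hb : ∀ k, b k ∈ regularSubalgebra F u := by
    intro k O hO huO
    by_cases hhO : h ∈ O
    · refine sum_mem fun l hl => mul_mem (ha l O hO huO) ?_
      rw [div_eq_mul_inv, ← pow_sub₀ _ hh0 (Finset.mem_Ico.mp hl).1]
      exact pow_mem hhO _
    · have hiO : h⁻¹ ∈ O := (O.mem_or_inv_mem h).resolve_left hhO
      by_cases hk : k ≤ n
      · have hbk : b k = -∑ l ∈ Finset.range k, a l * (h ^ l / h ^ k) := by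
          rw [eq_neg_iff_add_eq_zero, add_comm, Finset.sum_range_add_sum_Ico _ hk]
          simp only [mul_div_assoc', ← Finset.sum_div, hsum, zero_div]
        rw [hbk]
        refine neg_mem (sum_mem fun l hl => mul_mem (ha l O hO huO) ?_)
        have hlk := (Finset.mem_range.mp hl).le
        have : h ^ l / h ^ k = h⁻¹ ^ (k - l) := by
          rw [inv_pow, pow_sub₀ _ hh0 hlk, mul_inv, inv_inv, div_eq_mul_inv, mul_comm]
        rw [this]
        exact pow_mem hiO _
      · have : b k = 0 := by
          simp only [b]
          rw [Finset.Ico_eq_empty (by omega), Finset.sum_empty]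
        rw [this]; exact zero_mem _
  have hrec : ∀ k < n, b k = a k + h * b (k + 1) := by
    intro k hk
    simp only [b]
    rw [Finset.sum_eq_sum_Ico_succ_bot hk, div_self (pow_ne_zero _ hh0), mul_one, Finset.mul_sum]
    congr 1
    refine Finset.sum_congr rfl fun l _ => ?_
    rw [pow_succ]
    field_simp
  -- The element h b_{k+1} = b_k - a_k is regular and vanishes at `O₂`, hence at `O₁` by equality of
  -- centers. As h does not vanish at `O₁`, b_{k+1} does, and so it vanishes at `O₂` too. Then a_i =
  -- b_i - h b_{i+1} vanishes at `O₂`, although its constant term makes it a unit there.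
  have hb1 : ∀ k < n, O₂.valuation (b (k + 1)) < 1 := by
    intro k hk
    have hmem : h * b (k + 1) ∈ regularSubalgebra F u := by
      rw [← sub_eq_iff_eq_add'.mpr (hrec k hk)]
      exact sub_mem (hb k) (ha k)
    have hlt : O₂.valuation (h * b (k + 1)) < 1 := by
      rw [map_mul]
      exact mul_lt_one_of_lt_of_le hh₂ ((O₂.valuation_le_one_iff _).mpr
        (hb _ O₂ h₂ ((O₂.valuation_le_one_iff u).mp hu₂.le)))
    rw [← hc _ hmem, map_mul] at hlt
    rw [← hc _ (hb _)]
    by_contra hge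
    exact absurd hlt (not_lt.mpr (one_le_mul (not_lt.mp hh₁) (not_lt.mp hge)))
  have hb0 : b 0 = 0 := by
    simp only [b, pow_zero, div_one]
    rw [← hsum, Finset.range_eq_Ico]
  have hblt : ∀ k < n, O₂.valuation (b k) < 1 := by
    intro k hk
    cases k with
    | zero => rw [hb0, map_zero]; exact zero_lt_one
    | succ k => exact hb1 k (by omega)
  have hai : O₂.valuation (a i) = 1 := by
    have : a i = aeval u (p i) := by simp [a]
    rw [this]
    exact valuation_aeval_eq_one h₂ hu₂ hi
  have : a i = b i - h * b (i + 1) := by rw [hrec i i.2]; ring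
  rw [this] at hai
  refine absurd hai (ne_of_lt (lt_of_le_of_lt (O₂.valuation.map_sub _ _)
    (max_lt (hblt i i.2) ?_)))
  rw [map_mul]
  exact mul_lt_one_of_lt_of_le hh₂ (hb1 i i.2).le

end Regular

end FunctionFieldMZV

/-! ### Divisibility by powers of u after inverting t. -/

namespace FunctionFieldMZV

section CommRing

variable {F C : Type*} [Field F] [CommRing C] [Algebra F C]

/-- The elements of `C` that become divisible by `u` after multiplication by a power of `t`. -/
def awayIdeal (u t : C) : Ideal C where
  carrier := {h | ∃ N : ℕ, u ∣ h * t ^ N}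
  add_mem' := by
    rintro a b ⟨M, hM⟩ ⟨N, hN⟩
    refine ⟨M + N, ?_⟩
    rw [add_mul, pow_add]
    refine dvd_add ?_ ?_
    · rw [← mul_assoc]; exact hM.mul_right _
    · rw [mul_comm (t ^ M), ← mul_assoc]; exact hN.mul_right _
  zero_mem' := ⟨0, by simp⟩
  smul_mem' := by
    rintro c a ⟨N, hN⟩
    exact ⟨N, by rw [smul_eq_mul, mul_assoc]; exact hN.mul_left c⟩

theorem awayIdeal_one (t : C) : awayIdeal 1 t = ⊤ :=
  (Ideal.eq_top_iff_one _).mpr ⟨0, one_dvd _⟩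

/-- If `t` is idempotent modulo `u`, then the codimension of `awayIdeal (u ^ j) t` is at most `j`
times that of `awayIdeal u t`. -/
theorem finrank_quotient_awayIdeal_pow_le {u t : C} (ht : u ∣ (1 - t) * t)
    [Module.Finite F (C ⧸ awayIdeal u t)] (j : ℕ) :
    Module.Finite F (C ⧸ awayIdeal (u ^ j) t) ∧
      Module.finrank F (C ⧸ awayIdeal (u ^ j) t) ≤
        j * Module.finrank F (C ⧸ awayIdeal u t) := by
  induction j with
  | zero =>
    have : Subsingleton (C ⧸ awayIdeal (u ^ 0) t) := by
      rw [pow_zero, awayIdeal_one]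
      exact Ideal.Quotient.subsingleton_iff.mpr rfl
    exact ⟨inferInstance, by rw [Module.finrank_zero_of_subsingleton]; omega⟩
  | succ j ih =>
    obtain ⟨ih₁, ih₂⟩ := ih
    let I := awayIdeal (u ^ j) t
    let I' := awayIdeal (u ^ (j + 1)) t
    let J := awayIdeal u t
    obtain ⟨s, hs⟩ := ((Ideal.Quotient.mkₐ F J).toLinearMap).exists_rightInverse_of_surjective
      (LinearMap.range_eq_top.mpr (Ideal.Quotient.mkₐ_surjective F J))
    have hmul : I ≤ LinearMap.ker ((Submodule.mkQ I').comp (LinearMap.mulLeft C u)) := by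
      rintro h ⟨N, hN⟩
      rw [LinearMap.mem_ker, LinearMap.comp_apply, Submodule.mkQ_apply,
        Submodule.Quotient.mk_eq_zero]
      refine ⟨N, ?_⟩
      rw [LinearMap.mulLeft_apply, mul_assoc, pow_succ']
      exact mul_dvd_mul_left u hN
    let f₁ : (C ⧸ I) →ₗ[F] (C ⧸ I') := (Submodule.liftQ I _ hmul).restrictScalars F
    let f₂ : (C ⧸ J) →ₗ[F] (C ⧸ I') := ((Ideal.Quotient.mkₐ F I').toLinearMap).comp s
    -- The bound follows from the surjection (x, y) ↦ u x + s(y) of C/I ⊕ C/J onto C/I', where s is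
    -- a linear section of C → C/J.
    have hsurj : Function.Surjective (f₁.coprod f₂) := by
      intro y
      obtain ⟨y, rfl⟩ := Ideal.Quotient.mk_surjective y
      have hy : y - s (Ideal.Quotient.mk J y) ∈ J := by
        rw [← Ideal.Quotient.eq_zero_iff_mem, map_sub, sub_eq_zero]
        exact (LinearMap.congr_fun hs (Ideal.Quotient.mk J y)).symm
      set z := y - s (Ideal.Quotient.mk J y) with hz
      obtain ⟨N, hN⟩ := hy
      -- This w is a multiple of t congruent to 1 modulo (1 - t)^{j+1}. The first property gives u ∣
      -- z w^N. By the second, t^{j+1} z (1 - w^N) is divisible by ((1 - t) t)^{j+1}, hence by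
      -- u^{j+1}.
      set w := 1 - (1 - t) ^ (j + 1) with hw
      have htw : t ∣ w := by
        have := sub_dvd_pow_sub_pow (1 : C) (1 - t) (j + 1)
        rwa [one_pow, sub_sub_cancel] at this
      have hzw : u ∣ z * w ^ N := hN.trans (mul_dvd_mul_left z (pow_dvd_pow_of_dvd htw N))
      obtain ⟨x, hx⟩ := hzw
      have hgw : (1 - t) ^ (j + 1) ∣ 1 - w ^ N := by
        have := sub_dvd_pow_sub_pow (1 : C) w N
        rwa [one_pow, hw, sub_sub_cancel] at this
      have hrest : z * (1 - w ^ N) ∈ I' := by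
        refine ⟨j + 1, ?_⟩
        have h1 : u ^ (j + 1) ∣ (1 - t) ^ (j + 1) * t ^ (j + 1) := by
          rw [← mul_pow]; exact pow_dvd_pow_of_dvd ht _
        rw [mul_assoc]
        exact (h1.trans (mul_dvd_mul_right hgw _)).mul_left z
      refine ⟨(Ideal.Quotient.mk I x, Ideal.Quotient.mk J y), ?_⟩
      have hval : (f₁.coprod f₂) (Ideal.Quotient.mk I x, Ideal.Quotient.mk J y) =
          Ideal.Quotient.mk I' (u * x + s (Ideal.Quotient.mk J y)) := by
        rw [LinearMap.coprod_apply, map_add]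
        rfl
      rw [hval, Ideal.Quotient.eq]
      have : u * x + s (Ideal.Quotient.mk J y) - y = -(z * (1 - w ^ N)) := by
        rw [← hx, hz]; ring
      rw [this]
      exact neg_mem hrest
    refine ⟨Module.Finite.of_surjective _ hsurj, ?_⟩
    have := LinearMap.finrank_le_finrank_of_surjective hsurj
    rw [Module.finrank_prod] at this
    change Module.finrank F (C ⧸ I') ≤ _
    calc _ ≤ _ := this
      _ ≤ _ := by rw [add_mul, one_mul]; exact Nat.add_le_add_right ih₂ _

/-- In a ring which is Artinian modulo `u`, an ideal `𝔭` contains an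
element `t` which is idempotent modulo `u` and generates a power of `𝔭` modulo `u`. -/
theorem exists_idempotent_mod (u : C) [IsArtinianRing (C ⧸ Ideal.span {u})] (𝔭 : Ideal C) :
    ∃ t ∈ 𝔭, u ∣ (1 - t) * t ∧ ∀ s ∈ 𝔭, ∃ N : ℕ, u ∣ (1 - t) * s ^ N := by
  let π := Ideal.Quotient.mk (Ideal.span {u})
  have hπ : ∀ x, π x = 0 ↔ u ∣ x := fun x => by
    rw [Ideal.Quotient.eq_zero_iff_mem, Ideal.mem_span_singleton]
  let Q := 𝔭.map π
  -- The powers of the image of 𝔭 stabilize, so a high power is an idempotent, finitely generated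
  -- ideal, hence generated by an idempotent; `t` lifts this generator.
  obtain ⟨n, hn⟩ := IsArtinian.monotone_stabilizes (R := C ⧸ Ideal.span {u})
    (M := C ⧸ Ideal.span {u}) ⟨fun k => OrderDual.toDual (Q ^ k), fun a b h => Ideal.pow_le_pow_right h⟩
  have hn' : ∀ m, n ≤ m → Q ^ n = Q ^ m := hn
  have hidem : IsIdempotentElem (Q ^ (n + 1)) := by
    unfold IsIdempotentElem
    rw [← pow_add, ← hn' (n + 1) (by omega), ← hn' _ (by omega)]
  obtain ⟨e, he, heQ⟩ := (Ideal.isIdempotentElem_iff_of_fg _ (IsNoetherian.noetherian _)).mp hidem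
  have heQ1 : e ∈ Q := Ideal.pow_le_self n.succ_ne_zero
    (heQ ▸ Ideal.mem_span_singleton_self e)
  obtain ⟨t, ht, rfl⟩ := (Ideal.mem_map_iff_of_surjective π Ideal.Quotient.mk_surjective).mp heQ1
  refine ⟨t, ht, ?_, fun s hs => ⟨n + 1, ?_⟩⟩
  · rw [← hπ, map_mul, map_sub, map_one, sub_mul, one_mul, he.eq, sub_self]
  · have h1 : π s ^ (n + 1) ∈ Q ^ (n + 1) := Ideal.pow_mem_pow (Ideal.mem_map_of_mem π hs) _
    rw [heQ, Ideal.mem_span_singleton] at h1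
    obtain ⟨y, hy⟩ := h1
    rw [← hπ, map_mul, map_sub, map_one, map_pow, hy, ← mul_assoc, sub_mul, one_mul, he.eq,
      sub_self, zero_mul]

end CommRing

end FunctionFieldMZV

/-! ### A Riemann inequality for A and the existence of consecutive degrees. -/

namespace FunctionFieldMZV

theorem isArtinianRing_of_finite {F B : Type*} [Field F] [CommRing B] [Algebra F B]
    [Module.Finite F B] : IsArtinianRing B := IsArtinianRing.of_finite F B

section Regular

open Polynomial IntermediateField

variable {F K : Type*} [Field F] [Field K] [Algebra F K]

theorem finite_quotient_of_card_le {V : Type*} [AddCommGroup V] [Module F V] (n : ℕ)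
    (h : ∀ (k : ℕ) (g : Fin k → V), LinearIndependent F g → k ≤ n) : Module.Finite F V := by
  rw [← Module.rank_lt_aleph0_iff]
  refine lt_of_le_of_lt (rank_le (n := n) fun s hs => ?_) (Cardinal.natCast_lt_aleph0)
  exact h _ _ (hs.comp s.equivFin.symm s.equivFin.symm.injective)

/-- The ring of elements regular where `u` is regular is finite over `F` modulo `u`. -/
theorem finite_regularSubalgebra_quotient {u : K} (hu : u ≠ 0) [FiniteDimensional F⟮u⟯ K]
    (u' : regularSubalgebra F u) (hu' : (u' : K) = u) :
    Module.Finite F (regularSubalgebra F u ⧸ Ideal.span {u'}) := by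
  refine finite_quotient_of_card_le (Module.finrank F⟮u⟯ K) fun k g hg => ?_
  choose f hf using fun i => Ideal.Quotient.mk_surjective (g i)
  have := card_le_finrank_of_independent_mod hu (regularSubalgebra F u)
    (self_mem_regularSubalgebra u) (fun i => (f i : K)) (fun i => (f i).2) (by
      rintro c ⟨h, hh, hc⟩
      have h1 : ∑ i, c i • f i = u' * ⟨h, hh⟩ := by
        apply Subtype.ext
        push_cast
        rw [hu', ← hc]
      have h2 : ∑ i, c i • g i = 0 := by
        have := congrArg (Ideal.Quotient.mkₐ F (Ideal.span {u'})) h1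
        rw [map_sum] at this
        simp only [map_smul, map_mul] at this
        have h3 : (Ideal.Quotient.mkₐ F (Ideal.span {u'})) u' = 0 :=
          Ideal.Quotient.eq_zero_iff_mem.mpr (Ideal.mem_span_singleton_self _)
        rw [h3, zero_mul] at this
        rw [← this]
        exact Finset.sum_congr rfl fun i _ => by rw [← hf i]; rfl
      funext i
      exact Fintype.linearIndependent_iff.mp hg c h2 i)
  simpa using this

end Regular

namespace RationalPlace

open Polynomial IntermediateField

variable {F K : Type*} [Field F] [Field K] [Algebra F K] (P : RationalPlace F K)

theorem valuation_lt_one_iff (f : K) :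
    P.v.valuationSubring.valuation f < 1 ↔ P.v f < 1 :=
  (P.v.isEquiv_valuation_valuationSubring.lt_one_iff_lt_one).symm

theorem algebraMap_mem_valuationSubring (c : F) :
    algebraMap F K c ∈ P.v.valuationSubring := P.v_const_le c

theorem v_le_one_of_mem_regularSubalgebra {u s : K} (hu : P.v u < 1)
    (hs : s ∈ regularSubalgebra F u) : P.v s ≤ 1 :=
  hs P.v.valuationSubring P.algebraMap_mem_valuationSubring hu.le

/-- A place other than `∞` at which `u` vanishes does not have the same center as `∞`. -/
theorem exists_separating {u : K} (hu0 : u ≠ 0) (hu : P.v u < 1) [FiniteDimensional F⟮u⟯ K]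
    {O : ValuationSubring K} (hO : ∀ c : F, algebraMap F K c ∈ O) (huO : O.valuation u < 1)
    (hne : O ≠ P.v.valuationSubring) :
    ∃ s ∈ regularSubalgebra F u, P.v s < 1 ∧ O.valuation s = 1 := by
  by_contra hcon
  push Not at hcon
  -- Without a separating element the two places have the same center: if s vanishes at `O` but has
  -- residue c ≠ 0 at ∞, then s - c vanishes at ∞ and is a unit at `O`, so it would separate them.
  -- Equal centers force equal valuation rings.
  have hc : ∀ s ∈ regularSubalgebra F u,
      O.valuation s < 1 ↔ P.v.valuationSubring.valuation s < 1 := by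
    intro s hs
    have hsO := (O.valuation_le_one_iff s).mpr (hs O hO ((O.valuation_le_one_iff u).mp huO.le))
    rw [valuation_lt_one_iff]
    refine ⟨fun h => ?_, fun h => lt_of_le_of_ne hsO (hcon s hs h)⟩
    obtain ⟨c, hcs⟩ := P.residue s (P.v_le_one_of_mem_regularSubalgebra hu hs)
    by_cases hc0 : c = 0
    · simpa [hc0] using hcs
    · exfalso
      have h1 := hcon _ (sub_mem hs ((regularSubalgebra F u).algebraMap_mem c)) hcs
      refine h1 ?_
      rw [Valuation.map_sub_eq_of_lt_right _ (by rwa [valuation_algebraMap_eq_one hO hc0])]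
      exact valuation_algebraMap_eq_one hO hc0
  refine hne (le_antisymm ?_ ?_)
  · exact le_of_center_eq hu0 P.algebraMap_mem_valuationSubring
      ((P.valuation_lt_one_iff u).mpr hu) hc
  · exact le_of_center_eq hu0 hO huO fun s hs => (hc s hs).symm

theorem transcendental_of_v_ne_one (hK : IsCurveFunctionField F K) {f : K} (h0 : f ≠ 0)
    (h1 : P.v f ≠ 1) : Transcendental F f := by
  intro halg
  obtain ⟨c, rfl⟩ := hK.2 f halg
  refine h1 (P.v_const c ?_)
  rintro rfl
  exact h0 (map_zero _)

end RationalPlace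

section Basis

open Polynomial IntermediateField

variable {F K : Type*} [Field F] [Field K] [Algebra F K]

theorem isAlgebraic_adjoin_of_finiteDimensional {x : K} [FiniteDimensional F⟮x⟯ K] :
    Algebra.IsAlgebraic (Algebra.adjoin F {x}) K := by
  open scoped algebraAdjoinAdjoin in
  exact (IsFractionRing.comap_isAlgebraic_iff (A := Algebra.adjoin F {x}) (K := F⟮x⟯)).mpr
    inferInstance

/-- A basis of `K` over `F(u)` consisting of elements regular where `u⁻¹` is regular, with
bounded denominators at the zeros of `u`. -/
theorem exists_regular_basis {u : K} (hux : Transcendental F u⁻¹)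
    [FiniteDimensional F⟮u⟯ K] [FiniteDimensional F⟮u⁻¹⟯ K] {n : ℕ}
    (hn : Module.finrank F⟮u⟯ K = n) :
    ∃ b : Fin n → K, (∀ i, b i ∈ regularSubalgebra F u⁻¹) ∧
      (∀ (m : ℕ) (c : Fin m × Fin n → F),
        ∑ j, c j • (u⁻¹ ^ (j.1 : ℕ) * b j.2) = 0 → c = 0) ∧
      ∃ (p : F[X]) (r : ℕ), p.coeff 0 ≠ 0 ∧
        ∀ i, aeval u p * u ^ r * b i ∈ regularSubalgebra F u := by
  classical
  subst hn
  have ha₁ : Algebra.IsAlgebraic (Algebra.adjoin F {u}) K := isAlgebraic_adjoin_of_finiteDimensional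
  have ha₂ : Algebra.IsAlgebraic (Algebra.adjoin F {u⁻¹}) K :=
    isAlgebraic_adjoin_of_finiteDimensional
  let b₀ := Module.finBasis F⟮u⟯ K
  -- A common denominator `y` in F[u⁻¹] makes a basis integral over F[u⁻¹]. A second denominator `e`
  -- in F[u] makes the result integral over F[u], and splitting off the power of u from `e` yields
  -- `p` and `r`.
  obtain ⟨y, hy0, hy⟩ := Algebra.IsAlgebraic.exists_integral_multiples
    (Algebra.adjoin F {u⁻¹}) (Finset.univ.image b₀)
  have hyK : (y : K) ≠ 0 := fun h => hy0 (Subtype.ext h)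
  let b : Fin (Module.finrank F⟮u⟯ K) → K := fun i => y * b₀ i
  obtain ⟨e, he0, he⟩ := Algebra.IsAlgebraic.exists_integral_multiples
    (Algebra.adjoin F {u}) (Finset.univ.image b)
  refine ⟨b, fun i => ?_, fun m c hc => ?_, ?_⟩
  · exact mem_regularSubalgebra_of_isIntegral
      (hy _ (Finset.mem_image_of_mem _ (Finset.mem_univ i)))
  · have hxmem : u⁻¹ ∈ F⟮u⟯ := inv_mem (mem_adjoin_simple_self F u)
    let x' : F⟮u⟯ := ⟨u⁻¹, hxmem⟩
    have h1 : ∑ i, (∑ l, c (l, i) • x' ^ (l : ℕ)) • b₀ i = 0 := by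
      have h2 : (y : K) * ∑ i, (∑ l, c (l, i) • x' ^ (l : ℕ)) • b₀ i = 0 := by
        rw [← hc, Fintype.sum_prod_type_right, Finset.mul_sum]
        refine Finset.sum_congr rfl fun i _ => ?_
        rw [Finset.sum_smul, Finset.mul_sum]
        refine Finset.sum_congr rfl fun l _ => ?_
        rw [smul_assoc, mul_smul_comm]
        congr 1
        change (y : K) * (u⁻¹ ^ (l : ℕ) * b₀ i) = u⁻¹ ^ (l : ℕ) * (y * b₀ i)
        ring
      exact (mul_eq_zero.mp h2).resolve_left hyK
    have h3 := Fintype.linearIndependent_iff.mp b₀.linearIndependent _ h1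
    have h4 : ∀ i, ∑ l, C (c (l, i)) * X ^ (l : ℕ) = (0 : F[X]) := by
      intro i
      refine transcendental_iff.mp hux _ ?_
      have := congrArg (algebraMap F⟮u⟯ K) (h3 i)
      rw [map_sum, map_zero] at this
      rw [map_sum, ← this]
      refine Finset.sum_congr rfl fun l _ => ?_
      rw [map_mul, aeval_C, map_pow, aeval_X, ← Algebra.smul_def]
      rfl
    funext ⟨l, i⟩
    have := congrArg (fun q => coeff q (l : ℕ)) (h4 i)
    simp only [finsetSum_coeff, coeff_C_mul, coeff_X_pow, coeff_zero, Fin.val_inj] at this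
    simpa using this
  · obtain ⟨p, hp⟩ : ∃ p : F[X], aeval u p = (e : K) :=
      (SetLike.ext_iff.mp (Algebra.adjoin_singleton_eq_range_aeval F u) _).mp e.2
    have hp0 : p ≠ 0 := by
      rintro rfl
      exact he0 (Subtype.ext (by rw [← hp, map_zero]; rfl))
    obtain ⟨q, hq, hq0⟩ := exists_eq_pow_rootMultiplicity_mul_and_not_dvd p hp0 0
    rw [C_0, sub_zero] at hq hq0
    refine ⟨q, rootMultiplicity 0 p, fun h => hq0 (X_dvd_iff.mpr h), fun i => ?_⟩
    have h := mem_regularSubalgebra_of_isIntegral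
      (he _ (Finset.mem_image_of_mem _ (Finset.mem_univ i)))
    have h' : e • b i = aeval u q * u ^ rootMultiplicity 0 p * b i := by
      rw [Algebra.smul_def]
      change (e : K) * b i = _
      rw [← hp]
      nth_rewrite 1 [hq]
      rw [map_mul, map_pow, aeval_X]
      ring
    rwa [h'] at h

end Basis

namespace RationalPlace

open Polynomial IntermediateField

variable {F K : Type*} [Field F] [Field K] [Algebra F K] (P : RationalPlace F K)

/-- The dimension of the space of elements of `A` of degree less than `d` is at least `d - γ` for
some constant `γ`. -/
theorem exists_le_finrank_lattice_add (hK : IsCurveFunctionField F K) :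
    ∃ γ : ℕ, ∀ d, d ≤ Module.finrank F (P.lattice d) + γ := by
  obtain ⟨x, hx⟩ := P.v_surjective (WithZero.exp 1)
  have hx0 : x ≠ 0 := by
    rintro rfl
    exact WithZero.exp_ne_zero (hx.symm.trans (map_zero _))
  obtain ⟨u, rfl⟩ : ∃ u, x = u⁻¹ := ⟨x⁻¹, (inv_inv x).symm⟩
  have hu0 : u ≠ 0 := fun h => hx0 (by rw [h, inv_zero])
  have hx1 : 1 < P.v u⁻¹ := by
    rw [hx, ← WithZero.exp_zero, WithZero.exp_lt_exp]; exact one_pos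
  have hu1 : P.v u < 1 := by
    rw [← inv_inv u, map_inv₀]; exact inv_lt_one_of_one_lt₀ hx1
  have hxt := P.transcendental_of_v_ne_one hK hx0 hx1.ne'
  have hf₁ := hK.finiteDimensional_adjoin (P.transcendental_of_v_ne_one hK hu0 hu1.ne)
  have hf₂ := hK.finiteDimensional_adjoin hxt
  obtain ⟨n, hn⟩ : ∃ n, Module.finrank F⟮u⟯ K = n := ⟨_, rfl⟩
  obtain ⟨b, hb, hinj, p, r, hp, hpb⟩ := exists_regular_basis hxt hn
  let C := regularSubalgebra F u
  let u' : C := ⟨u, self_mem_regularSubalgebra u⟩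
  have hfin := finite_regularSubalgebra_quotient hu0 u' rfl
  have : IsArtinianRing (C ⧸ Ideal.span {u'}) := isArtinianRing_of_finite (F := F)
  let 𝔭 : Ideal C :=
    { carrier := {s | P.v s < 1}
      add_mem' := fun ha hb => (P.v.map_add _ _).trans_lt (max_lt ha hb)
      zero_mem' := by simp
      smul_mem' := fun c s hs => by
        change P.v (c * s) < 1
        rw [map_mul, mul_comm]
        exact mul_lt_one_of_lt_of_le hs (P.v_le_one_of_mem_regularSubalgebra hu1 c.2) }
  -- Here `t` vanishes at ∞ and takes the value 1 at every other zero of u. Inverting `t` therefore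
  -- ignores ∞ and keeps the conditions at the other zeros.
  obtain ⟨t, ht, hidem, hgen⟩ := exists_idempotent_mod u' 𝔭
  have ht1 : P.v t < 1 := ht
  let J := awayIdeal u' t
  have hJ : Ideal.span {u'} ≤ J := (Ideal.span_singleton_le_iff_mem _).mpr ⟨0, by simp⟩
  have hJfin : Module.Finite F (C ⧸ J) :=
    Module.Finite.of_surjective (Ideal.Quotient.factorₐ F hJ).toLinearMap
      (Ideal.Quotient.factor_surjective hJ)
  obtain ⟨n', hn'⟩ : ∃ n', n' = Module.finrank F (C ⧸ J) := ⟨_, rfl⟩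
  -- The element 1 - t is zero in C/J but equals 1 at ∞. Joined to lifts of a basis of C/J it stays
  -- independent modulo u, and such a family has at most n members. This saved dimension is the
  -- contribution of ∞.
  have hnn' : n' + 1 ≤ n := by
    let B := Module.finBasis F (C ⧸ J)
    choose h hh using fun i => Ideal.Quotient.mk_surjective (B i)
    let g : Option (Fin (Module.finrank F (C ⧸ J))) → C := fun o => o.elim (1 - t) h
    have := card_le_finrank_of_independent_mod hu0 C (self_mem_regularSubalgebra u)
      (fun i => (g i : K)) (fun i => (g i).2) (by
        rintro c ⟨w, hw, hc⟩
        have hc' : ∑ i, c i • g i = u' * ⟨w, hw⟩ := by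
          apply Subtype.ext
          push_cast
          rw [← hc]
        have h1 : ∑ i, c (some i) • B i = 0 := by
          have h2 : (Ideal.Quotient.mkₐ F J) (u' * ⟨w, hw⟩) = 0 :=
            Ideal.Quotient.eq_zero_iff_mem.mpr
              (J.mul_mem_right _ (hJ (Ideal.mem_span_singleton_self _)))
          rw [← hc', Fintype.sum_option, map_add, map_smul, map_sum] at h2
          have h3 : (Ideal.Quotient.mkₐ F J) (g none) = 0 :=
            Ideal.Quotient.eq_zero_iff_mem.mpr ⟨1, by rw [pow_one]; exact hidem⟩
          rw [h3, smul_zero, zero_add] at h2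
          rw [← h2]
          refine Finset.sum_congr rfl fun i _ => ?_
          rw [map_smul, ← hh i]
          rfl
        have h4 := Fintype.linearIndependent_iff.mp B.linearIndependent _ h1
        have h5 : c none = 0 := by
          rw [Fintype.sum_option] at hc
          simp only [h4, zero_smul, Finset.sum_const_zero, add_zero] at hc
          by_contra hne
          have h6 : P.v (c none • (g none : K)) < 1 := by
            rw [hc, map_mul]
            exact mul_lt_one_of_lt_of_le hu1 (P.v_le_one_of_mem_regularSubalgebra hu1 hw)
          rw [P.v_smul hne] at h6
          have h7 : (g none : K) = 1 - t := rfl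
          rw [h7, Valuation.map_sub_eq_of_lt_left _ (by rwa [map_one]), map_one] at h6
          exact lt_irrefl _ h6
        funext o
        cases o with
        | none => exact h5
        | some i => exact h4 i)
    rw [Fintype.card_option, Fintype.card_fin, ← hn', hn] at this
    exact this
  obtain ⟨β, hβ⟩ : ∃ β : ℕ, ∀ i, P.v (b i) ≤ WithZero.exp (β : ℤ) := by
    have : ∀ y : WithZero (Multiplicative ℤ), ∃ β : ℕ, y ≤ WithZero.exp (β : ℤ) := by
      intro y
      induction y using WithZero.expRecOn with
      | zero => exact ⟨0, zero_le⟩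
      | exp k => exact ⟨k.toNat, WithZero.exp_le_exp.mpr (Int.self_le_toNat k)⟩
    choose β hβ using fun i => this (P.v (b i))
    refine ⟨Finset.univ.sup β, fun i => (hβ i).trans (WithZero.exp_le_exp.mpr ?_)⟩
    exact_mod_cast Finset.le_sup (f := β) (Finset.mem_univ i)
  -- At a place other than ∞ where u⁻¹ has a pole, a separating s gives 1 - t positive valuation, so
  -- `t` is a unit, and so is p(u). Hence regularity of p(u) f t^N there implies regularity of f.
  have hfilter : ∀ f : K, f ∈ regularSubalgebra F u⁻¹ →
      (∃ N : ℕ, aeval u p * f * (t : K) ^ N ∈ C) → f ∈ P.A := by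
    rintro f hf ⟨N, hN⟩ O hO hne
    by_cases hxO : u⁻¹ ∈ O
    · exact hf O hO hxO
    have huO : u ∈ O := (O.mem_or_inv_mem u).resolve_right hxO
    have huO1 : O.valuation u < 1 := by
      refine lt_of_le_of_ne ((O.valuation_le_one_iff u).mpr huO) fun h => hxO ?_
      rw [← O.valuation_le_one_iff, map_inv₀, h, inv_one]
    obtain ⟨s, hsC, hs1, hsO⟩ := P.exists_separating hu0 hu1 hO huO1 hne
    obtain ⟨M, w, hw⟩ := hgen ⟨s, hsC⟩ hs1
    have hw' : (1 - (t : K)) * s ^ M = u * w := congrArg Subtype.val hw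
    have hlt : O.valuation (1 - (t : K)) < 1 := by
      have h1 : O.valuation ((1 - (t : K)) * s ^ M) < 1 := by
        rw [hw', map_mul]
        exact mul_lt_one_of_lt_of_le huO1 ((O.valuation_le_one_iff _).mpr (w.2 O hO huO))
      rwa [map_mul, map_pow, hsO, one_pow, mul_one] at h1
    have htO : O.valuation (t : K) = 1 := by
      refine valuation_eq_one_of_sub_lt (map_one O.valuation) ?_
      rwa [← Valuation.map_sub_swap]
    have h2 := (O.valuation_le_one_iff _).mpr (hN O hO huO)
    rw [map_mul, map_mul, map_pow, htO, one_pow, mul_one, valuation_aeval_eq_one hO huO1 hp,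
      one_mul] at h2
    exact (O.valuation_le_one_iff f).mp h2
  -- The combinations of u^{-l} b_i with l ≤ m form a space of dimension (m+1)n. Divisibility of
  -- p(u) u^{m+r} f by u^{m+r} away from ∞ costs at most (m+r)n' conditions, and n' < n leaves at
  -- least m - rn dimensions.
  have hkey : ∀ m : ℕ, m ≤ Module.finrank F (P.lattice (m + β + 1)) + r * n := by
    intro m
    let S : (Fin (m + 1) × Fin n → F) →ₗ[F] K :=
      Fintype.linearCombination F (fun j => u⁻¹ ^ (j.1 : ℕ) * b j.2)
    have hS : ∀ c, S c = ∑ j, c j • (u⁻¹ ^ (j.1 : ℕ) * b j.2) := fun c => rfl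
    have hSC : ∀ c, aeval u p * u ^ (m + r) * S c ∈ C := by
      intro c
      rw [hS, Finset.mul_sum]
      refine sum_mem fun j _ => ?_
      have : aeval u p * u ^ (m + r) * c j • (u⁻¹ ^ (j.1 : ℕ) * b j.2) =
          c j • (u ^ (m - j.1) * (aeval u p * u ^ r * b j.2)) := by
        rw [mul_smul_comm, pow_sub₀ _ hu0 (Nat.le_of_lt_succ j.1.2), pow_add, inv_pow]
        congr 1
        ring
      rw [this]
      exact C.smul_mem (mul_mem (pow_mem (self_mem_regularSubalgebra u) _) (hpb _)) _
    let T : (Fin (m + 1) × Fin n → F) →ₗ[F] C :=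
      LinearMap.codRestrict (Subalgebra.toSubmodule C)
        ((LinearMap.mulLeft F (aeval u p * u ^ (m + r))).comp S) hSC
    let I := awayIdeal (u' ^ (m + r)) t
    obtain ⟨hIfin, hIrank⟩ := finrank_quotient_awayIdeal_pow_le (F := F) hidem (m + r)
    let W := LinearMap.ker ((Ideal.Quotient.mkₐ F I).toLinearMap.comp T)
    have hW : (m + 1) * n ≤ Module.finrank F W + (m + r) * n' := by
      have h1 := LinearMap.finrank_range_add_finrank_ker
        ((Ideal.Quotient.mkₐ F I).toLinearMap.comp T)
      have h2 := Submodule.finrank_le (LinearMap.range ((Ideal.Quotient.mkₐ F I).toLinearMap.comp T))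
      rw [Module.finrank_fintype_fun_eq_card, Fintype.card_prod, Fintype.card_fin,
        Fintype.card_fin] at h1
      have h3 := h2.trans (hIrank.trans_eq (congrArg ((m + r) * ·) hn'.symm))
      rw [← h1, add_comm]
      exact Nat.add_le_add_left h3 _
    have hmem : ∀ c : W, S c ∈ P.lattice (m + β + 1) := by
      rintro ⟨c, hc⟩
      rw [mem_lattice_succ]
      refine ⟨hfilter _ ?_ ?_, ?_⟩
      · rw [hS]
        refine sum_mem fun j _ => (regularSubalgebra F u⁻¹).smul_mem
          (mul_mem (pow_mem (self_mem_regularSubalgebra _) _) (hb _)) _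
      · obtain ⟨N, w, hw⟩ : T c ∈ I := Ideal.Quotient.eq_zero_iff_mem.mp hc
        refine ⟨N, ?_⟩
        have hw' : aeval u p * u ^ (m + r) * S c * (t : K) ^ N = u ^ (m + r) * w :=
          congrArg Subtype.val hw
        have : aeval u p * S c * (t : K) ^ N = w := by
          refine mul_left_cancel₀ (pow_ne_zero (m + r) hu0) ?_
          rw [← hw']
          ring
        rw [this]
        exact w.2
      · rw [hS]
        refine P.v.map_sum_le fun j _ => (P.v_smul_le _ _).trans ?_
        rw [map_mul, map_pow, hx, ← WithZero.exp_nsmul, Nat.cast_add, WithZero.exp_add]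
        refine mul_le_mul' (WithZero.exp_le_exp.mpr ?_) (hβ _)
        have := j.1.2
        simp only [nsmul_eq_mul, mul_one, Nat.cast_le]
        omega
    have hSinj : Function.Injective S := by
      rw [← LinearMap.ker_eq_bot]
      exact LinearMap.ker_eq_bot'.mpr fun c hc => hinj _ c hc
    have hWle : Module.finrank F W ≤ Module.finrank F (P.lattice (m + β + 1)) := by
      have := P.finite_lattice hK (m + β + 1)
      refine LinearMap.finrank_le_finrank_of_injective
        (f := LinearMap.codRestrict _ (S.comp W.subtype) hmem) ?_
      intro c d hcd
      exact Subtype.ext (hSinj (congrArg Subtype.val hcd))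
    have h1 : (m + 1) * (n' + 1) ≤ (m + 1) * n := Nat.mul_le_mul_left _ hnn'
    have h2 : r * n' ≤ r * n := Nat.mul_le_mul_left _ (by omega)
    have h3 : (m + 1) * (n' + 1) = m * n' + n' + m + 1 := by ring
    have h4 : (m + r) * n' = m * n' + r * n' := by ring
    omega
  refine ⟨r * n + β + 1, fun d => ?_⟩
  by_cases hd : d ≤ β + 1
  · omega
  · have := hkey (d - β - 1)
    rw [show d - β - 1 + β + 1 = d by omega] at this
    omega

/-- The base ring has elements of two consecutive positive degrees. -/
theorem exists_consecutive_degrees (hK : IsCurveFunctionField F K) :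
    ∃ m : ℕ, 0 < m ∧ (∃ a ∈ P.A, P.HasDegree a m) ∧ ∃ b ∈ P.A, P.HasDegree b (m + 1) := by
  obtain ⟨γ, h⟩ := P.exists_le_finrank_lattice_add hK
  exact P.exists_consecutive_degrees_of_finrank_le hK γ h

end RationalPlace

end FunctionFieldMZV

/-! ### F-linear polynomials and products over their roots. -/

namespace FunctionFieldMZV

theorem norm_sub_le_max' {E : Type*} [SeminormedAddCommGroup E] [IsUltrametricDist E] (x y : E) :
    ‖x - y‖ ≤ max ‖x‖ ‖y‖ := by
  rw [sub_eq_add_neg, ← norm_neg y]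
  exact IsUltrametricDist.norm_add_le_max _ _

theorem norm_eq_of_norm_sub_lt {E : Type*} [SeminormedAddCommGroup E] [IsUltrametricDist E]
    {x y : E} (h : ‖x - y‖ < ‖y‖) : ‖x‖ = ‖y‖ := by
  refine le_antisymm ?_ (not_lt.mp fun hlt => ?_)
  · rw [← sub_add_cancel x y]
    exact (IsUltrametricDist.norm_add_le_max _ _).trans (max_le h.le le_rfl)
  · have := norm_sub_le_max' x (x - y)
    rw [sub_sub_cancel] at this
    exact absurd this (not_le.mpr (max_lt hlt h))

section LinearPolynomial

open Polynomial

variable (F : Type*) {L : Type*} [Field F] [Fintype F] [Field L] [Algebra F L]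

/-- The `F`-linear polynomial `∑_{k ≤ N} c_k X ^ (q ^ k)`. -/
def linPoly (c : ℕ → L) (N : ℕ) : L[X] :=
  ∑ k ∈ Finset.range (N + 1), C (c k) * X ^ Fintype.card F ^ k

variable {F}

theorem eval_linPoly (c : ℕ → L) (N : ℕ) (z : L) :
    (linPoly F c N).eval z = ∑ k ∈ Finset.range (N + 1), c k * z ^ Fintype.card F ^ k := by
  simp [linPoly, eval_finsetSum]

theorem smul_pow_card (a : F) (z : L) (k : ℕ) :
    (a • z) ^ Fintype.card F ^ k = a • z ^ Fintype.card F ^ k := by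
  rw [Algebra.smul_def, mul_pow, FrobSeries.algebraMap_pow_card, ← Algebra.smul_def]

theorem eval_linPoly_add (c : ℕ → L) (N : ℕ) (y z : L) :
    (linPoly F c N).eval (y + z) = (linPoly F c N).eval y + (linPoly F c N).eval z := by
  simp only [eval_linPoly, FrobSeries.add_pow_card, mul_add, Finset.sum_add_distrib]

theorem eval_linPoly_smul (c : ℕ → L) (N : ℕ) (a : F) (z : L) :
    (linPoly F c N).eval (a • z) = a • (linPoly F c N).eval z := by
  simp only [eval_linPoly, smul_pow_card, mul_smul_comm, Finset.smul_sum]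

theorem eval_linPoly_neg (c : ℕ → L) (N : ℕ) (z : L) :
    (linPoly F c N).eval (-z) = -(linPoly F c N).eval z := by
  have := eval_linPoly_smul (F := F) c N (-1) z
  simpa using this

theorem eval_linPoly_sub (c : ℕ → L) (N : ℕ) (y z : L) :
    (linPoly F c N).eval (y - z) = (linPoly F c N).eval y - (linPoly F c N).eval z := by
  rw [sub_eq_add_neg, eval_linPoly_add, eval_linPoly_neg, ← sub_eq_add_neg]

theorem natDegree_linPoly_le (c : ℕ → L) (N : ℕ) :
    (linPoly F c N).natDegree ≤ Fintype.card F ^ N := by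
  refine natDegree_sum_le_of_forall_le _ _ fun k hk => ?_
  refine (natDegree_C_mul_X_pow_le _ _).trans (Nat.pow_le_pow_right Fintype.card_pos ?_)
  exact Nat.le_of_lt_succ (Finset.mem_range.mp hk)

theorem coeff_linPoly_pow (c : ℕ → L) (N k : ℕ) (hk : k ≤ N) :
    (linPoly F c N).coeff (Fintype.card F ^ k) = c k := by
  simp only [linPoly, finsetSum_coeff, coeff_C_mul, coeff_X_pow,
    (Nat.pow_right_injective (Fintype.one_lt_card (α := F))).eq_iff]
  simp only [mul_ite, mul_one, mul_zero]
  rw [Finset.sum_ite_eq, if_pos (Finset.mem_range.mpr (Nat.lt_succ_of_le hk))]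

theorem coeff_linPoly_zero (c : ℕ → L) (N : ℕ) : (linPoly F c N).coeff 0 = 0 := by
  rw [coeff_zero_eq_eval_zero, eval_linPoly]
  exact Finset.sum_eq_zero fun k _ => by
    rw [FrobSeries.zero_pow_card, mul_zero]

theorem coeff_linPoly_one (c : ℕ → L) (N : ℕ) : (linPoly F c N).coeff 1 = c 0 := by
  have := coeff_linPoly_pow (F := F) c N 0 N.zero_le
  rwa [pow_zero] at this

/-- Only the linear term survives, since q = 0 in L. Consequently such a polynomial with c₀ = 1 is
separable. -/
theorem derivative_linPoly (c : ℕ → L) (N : ℕ) : (linPoly F c N).derivative = C (c 0) := by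
  have hq : ((Fintype.card F : ℕ) : L) = 0 := by
    rw [← map_natCast (algebraMap F L), Nat.cast_card_eq_zero, map_zero]
  rw [linPoly, derivative_sum, Finset.sum_eq_single 0]
  · simp
  · intro k _ hk
    rw [derivative_C_mul_X_pow, Nat.cast_pow, hq, zero_pow hk, mul_zero, C_0, zero_mul]
  · simp

/-- The polynomial `X ∏ (1 - X / a)`, the product being over the nonzero elements of `V`. -/
def rootPoly [DecidableEq L] (V : Finset L) : L[X] := X * ∏ a ∈ V.erase 0, (1 - C a⁻¹ * X)

variable [DecidableEq L]

theorem eval_rootPoly (V : Finset L) (z : L) :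
    (rootPoly V).eval z = z * ∏ a ∈ V.erase 0, (1 - z / a) := by
  simp [rootPoly, eval_prod, div_eq_inv_mul]

theorem natDegree_rootPoly_le {V : Finset L} (h0 : 0 ∈ V) : (rootPoly V).natDegree ≤ V.card := by
  refine natDegree_mul_le.trans ?_
  have h1 : (∏ a ∈ V.erase 0, (1 - C a⁻¹ * X : L[X])).natDegree ≤ ∑ a ∈ V.erase 0, 1 := by
    refine (natDegree_prod_le _ _).trans (Finset.sum_le_sum fun a _ => ?_)
    refine (natDegree_sub_le _ _).trans (max_le ?_ ((natDegree_C_mul_le _ _).trans natDegree_X_le))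
    rw [natDegree_one]; exact zero_le
  rw [Finset.sum_const, smul_eq_mul, mul_one, Finset.card_erase_of_mem h0] at h1
  have := Finset.card_pos.mpr ⟨0, h0⟩
  rw [natDegree_X]
  omega

theorem coeff_rootPoly_one (V : Finset L) : (rootPoly V).coeff 1 = 1 := by
  rw [rootPoly, coeff_X_mul, coeff_zero_eq_eval_zero, eval_prod]
  exact Finset.prod_eq_one fun a _ => by simp

/-- An `F`-linear polynomial with linear coefficient `1` whose degree is at most the number of its
known roots is the product of the corresponding factors. -/
theorem linPoly_eq_rootPoly {c : ℕ → L} {N : ℕ} (hc : c 0 = 1) {V : Finset L} (h0 : 0 ∈ V)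
    (hV : ∀ a ∈ V, (linPoly F c N).eval a = 0) (hdeg : (linPoly F c N).natDegree ≤ V.card) :
    linPoly F c N = rootPoly V := by
  have hpos := Finset.card_pos.mpr ⟨0, h0⟩
  set D := linPoly F c N - rootPoly V with hD
  have hD0 : D.coeff 0 = 0 := by
    rw [hD, coeff_sub, coeff_linPoly_zero, rootPoly, mul_coeff_zero, coeff_X_zero]; simp
  have hDX : D = X * D.divX := by
    conv_lhs => rw [← X_mul_divX_add D, hD0, C_0, add_zero]
  have hDdeg : D.natDegree ≤ V.card :=
    (natDegree_sub_le _ _).trans (max_le hdeg (natDegree_rootPoly_le h0))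
  -- D/X has degree less than the size of V and vanishes on all of V; at 0 this is the equality of
  -- the two linear coefficients.
  have hS : D.divX = 0 := by
    refine eq_zero_of_natDegree_lt_card_of_eval_eq_zero' _ V (fun a ha => ?_) ?_
    · by_cases ha0 : a = 0
      · rw [ha0, ← coeff_zero_eq_eval_zero, coeff_divX, zero_add, hD, coeff_sub,
          coeff_linPoly_one, hc, coeff_rootPoly_one, sub_self]
      · have h1 : D.eval a = 0 := by
          rw [hD, eval_sub, hV a ha, eval_rootPoly, Finset.prod_eq_zero (i := a)
            (Finset.mem_erase.mpr ⟨ha0, ha⟩) (by rw [div_self ha0, sub_self])]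
          simp
        rw [hDX, eval_mul, eval_X] at h1
        exact (mul_eq_zero.mp h1).resolve_left ha0
    · rw [natDegree_divX_eq_natDegree_tsub_one]
      omega
  rw [hS, mul_zero] at hDX
  exact sub_eq_zero.mp hDX

/-- Modulo X^{n+1} the product is 1 - (∑ b_i) X^n. The remaining terms do not reach index n + 1
because A has no constant term. -/
theorem coeff_mul_prod_one_sub {n : ℕ} (hn : 1 ≤ n) {A : L[X]} (h0 : A.coeff 0 = 0)
    {ι : Type*} (s : Finset ι) (b : ι → L) :
    (A * ∏ i ∈ s, (1 - C (b i) * X ^ n)).coeff (n + 1) =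
      A.coeff (n + 1) - A.coeff 1 * ∑ i ∈ s, b i := by
  have key : ∃ D : L[X],
      ∏ i ∈ s, (1 - C (b i) * X ^ n) = 1 - C (∑ i ∈ s, b i) * X ^ n + D * X ^ (n + 1) := by
    classical
    induction s using Finset.induction_on with
    | empty => exact ⟨0, by simp⟩
    | insert i s hi ih =>
      obtain ⟨D, hD⟩ := ih
      obtain ⟨m, rfl⟩ := Nat.exists_eq_add_of_le' hn
      refine ⟨(1 - C (b i) * X ^ (m + 1)) * D + C (b i) * C (∑ i ∈ s, b i) * X ^ m, ?_⟩
      rw [Finset.prod_insert hi, hD, Finset.sum_insert hi, C_add]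
      ring
  obtain ⟨D, hD⟩ := key
  have : A * (1 - C (∑ i ∈ s, b i) * X ^ n + D * X ^ (n + 1)) =
      A - C (∑ i ∈ s, b i) * (A * X ^ n) + A * D * X ^ (n + 1) := by ring
  have h1 : (A * X ^ n).coeff (n + 1) = A.coeff 1 := by
    rw [add_comm]; exact coeff_mul_X_pow A n 1
  have h2 : (A * D * X ^ (n + 1)).coeff (n + 1) = 0 := by
    have := coeff_mul_X_pow (A * D) (n + 1) 0
    rw [zero_add] at this
    rw [this, mul_coeff_zero, h0, zero_mul]
  rw [hD, this, coeff_add, coeff_sub, coeff_C_mul, h1, h2, add_zero, mul_comm]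

/-- After multiplication by X both sides are the F-linear polynomial of degree q with linear
coefficient 1 and root set the line F a. This turns an F^×-orbit of factors into one factor that
involves only the power 1/a^{q-1}. -/
theorem prod_one_sub_smul_inv [DecidableEq F] {a : L} (ha : a ≠ 0) :
    ∏ c ∈ (Finset.univ : Finset F).erase 0, (1 - C (c • a)⁻¹ * X) =
      1 - C (a ^ (Fintype.card F - 1))⁻¹ * X ^ (Fintype.card F - 1) := by
  have hq : Fintype.card F - 1 + 1 = Fintype.card F := Nat.sub_add_cancel Fintype.card_pos
  obtain ⟨e, he0, he1⟩ : ∃ e : ℕ → L, e 0 = 1 ∧ e 1 = -(a ^ (Fintype.card F - 1))⁻¹ :=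
    ⟨fun k => if k = 0 then 1 else -(a ^ (Fintype.card F - 1))⁻¹, rfl, rfl⟩
  have hinj : Function.Injective fun c : F => c • a := smul_left_injective F ha
  have h1 : linPoly F e 1 = X * (1 - C (a ^ (Fintype.card F - 1))⁻¹ * X ^ (Fintype.card F - 1)) := by
    have hX : (X : L[X]) ^ Fintype.card F = X ^ (Fintype.card F - 1) * X := by rw [← pow_succ, hq]
    rw [linPoly, Finset.sum_range_succ, Finset.sum_range_one, he0, he1, pow_zero, pow_one, pow_one,
      hX, C_1, C_neg]
    ring
  have h2 : linPoly F e 1 = rootPoly (Finset.univ.image fun c : F => c • a) := by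
    refine linPoly_eq_rootPoly he0 ?_ (fun x hx => ?_) ((natDegree_linPoly_le _ _).trans ?_)
    · rw [Finset.mem_image]
      exact ⟨0, Finset.mem_univ _, zero_smul _ _⟩
    · obtain ⟨c, -, rfl⟩ := Finset.mem_image.mp hx
      rw [eval_linPoly_smul, h1, eval_mul, eval_sub, eval_mul, eval_C, eval_pow, eval_X, eval_one,
        inv_mul_cancel₀ (pow_ne_zero _ ha), sub_self, mul_zero, smul_zero]
    · rw [Finset.card_image_of_injective _ hinj, pow_one, Finset.card_univ]
  have h3 : (Finset.univ.image fun c : F => c • a).erase 0 =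
      ((Finset.univ : Finset F).erase 0).image fun c : F => c • a := by
    rw [Finset.image_erase hinj, zero_smul]
  rw [h1, rootPoly, h3, Finset.prod_image hinj.injOn] at h2
  exact (mul_left_cancel₀ X_ne_zero h2).symm

end LinearPolynomial

/-! ### Absolute values and signs at ∞. -/

namespace RationalPlace

variable {F K : Type*} [Field F] [Fintype F] [Field K] [Algebra F K] (P : RationalPlace F K)

theorem abs_eq_zpow {f : K} {d : ℤ} (h : P.v f = WithZero.exp d) :
    P.abs f = (Fintype.card F : ℝ) ^ d := by
  change ((WithZeroMulInt.toNNReal (one_lt_card (F := F)).ne_zero (P.v f) : NNReal) : ℝ) = _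
  rw [h, WithZeroMulInt.toNNReal_neg_apply _ WithZero.exp_ne_zero]
  push_cast
  rfl

theorem abs_lt_one_iff (f : K) : P.abs f < 1 ↔ P.v f < 1 := by
  change ((WithZeroMulInt.toNNReal (one_lt_card (F := F)).ne_zero (P.v f) : NNReal) : ℝ) < 1 ↔ _
  have := (WithZeroMulInt.toNNReal_strictMono (one_lt_card (F := F))).lt_iff_lt (a := P.v f) (b := 1)
  rw [map_one] at this
  rw [← this]
  exact_mod_cast Iff.rfl

theorem abs_le_one_iff (f : K) : P.abs f ≤ 1 ↔ P.v f ≤ 1 := by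
  change ((WithZeroMulInt.toNNReal (one_lt_card (F := F)).ne_zero (P.v f) : NNReal) : ℝ) ≤ 1 ↔ _
  have := (WithZeroMulInt.toNNReal_strictMono (one_lt_card (F := F))).le_iff_le (a := P.v f) (b := 1)
  rw [map_one] at this
  rw [← this]
  exact_mod_cast Iff.rfl

theorem norm_algebraMap_const {c : F} (hc : c ≠ 0) : ‖algebraMap F P.KInf c‖ = 1 := by
  rw [IsScalarTower.algebraMap_apply F K P.KInf, norm_algebraMap_KInf,
    P.abs_eq_zpow (d := 0) (by rw [P.v_const c hc, WithZero.exp_zero]), zpow_zero]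

theorem exists_norm_sub_lt (x : P.KInf) {ε : ℝ} (hε : 0 < ε) :
    ∃ y : K, ‖x - algebraMap K P.KInf y‖ < ε := by
  obtain ⟨y, hy⟩ := UniformSpace.Completion.denseRange_coe.exists_dist_lt x hε
  exact ⟨y.ofAbs, by rw [dist_eq_norm] at hy; exact hy⟩

theorem exists_leading_coeff (x : P.KInf) (hx : ‖x‖ = 1) :
    ∃ c : F, c ≠ 0 ∧ ‖x - algebraMap F P.KInf c‖ < 1 := by
  obtain ⟨y, hy⟩ := P.exists_norm_sub_lt x one_pos
  have hy1 : P.abs y ≤ 1 := by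
    rw [← norm_algebraMap_KInf, ← sub_sub_cancel x (algebraMap K P.KInf y)]
    refine (norm_sub_le_max' _ _).trans (max_le hx.le hy.le)
  obtain ⟨c, hc⟩ := P.residue y ((P.abs_le_one_iff y).mp hy1)
  have h : ‖x - algebraMap F P.KInf c‖ < 1 := by
    rw [← sub_add_sub_cancel x (algebraMap K P.KInf y)]
    refine lt_of_le_of_lt (IsUltrametricDist.norm_add_le_max _ _) (max_lt hy ?_)
    rw [IsScalarTower.algebraMap_apply F K P.KInf, ← map_sub, norm_algebraMap_KInf]
    exact (P.abs_lt_one_iff _).mpr hc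
  refine ⟨c, ?_, h⟩
  rintro rfl
  rw [map_zero, sub_zero, hx] at h
  exact lt_irrefl _ h

theorem one_lt_card_real : (1 : ℝ) < Fintype.card F := by
  exact_mod_cast Fintype.one_lt_card (α := F)

variable {P} in
/-- The characterization of the sign of an element of norm `q ^ d`. -/
theorem sgn_eq_iff {π : P.KInf} (hπ : ‖π‖ = (Fintype.card F : ℝ)⁻¹) {x : P.KInf} {d : ℤ}
    (hx : ‖x‖ = (Fintype.card F : ℝ) ^ d) {c : F} (hc : c ≠ 0) :
    P.sgn π x = c ↔ ‖π ^ d * x - algebraMap F P.KInf c‖ < 1 := by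
  have hq := one_lt_card_real (F := F)
  have hnorm : ∀ m : ℤ, ‖π ^ m * x‖ = (Fintype.card F : ℝ) ^ (d - m) := fun m => by
    rw [norm_mul, norm_zpow, hπ, hx, inv_zpow', ← zpow_add₀ (by positivity)]
    congr 1
    ring
  obtain ⟨c₀, hc₀, h₀⟩ := P.exists_leading_coeff (π ^ d * x) (by rw [hnorm, sub_self, zpow_zero])
  -- The definition of `sgn` allows any exponent m. A nonzero leading constant forces norm 1, hence
  -- m = d, and two nonzero constants at distance less than 1 coincide.
  have huniq : ∀ (c : F) (m : ℤ), c ≠ 0 → ‖π ^ m * x - algebraMap F P.KInf c‖ < 1 → c = c₀ := by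
    intro c m hc h
    have h1 : ‖π ^ m * x‖ = 1 := by
      rw [← P.norm_algebraMap_const hc] at h ⊢
      exact norm_eq_of_norm_sub_lt h
    have hdm : d - m = 0 := by
      rw [hnorm] at h1
      exact (zpow_eq_one_iff_right₀ (by positivity) hq.ne').mp h1
    obtain rfl : m = d := by omega
    by_contra hne
    have h2 : ‖algebraMap F P.KInf (c - c₀)‖ < 1 := by
      rw [map_sub, ← sub_sub_sub_cancel_left _ _ (π ^ m * x)]
      exact lt_of_le_of_lt (norm_sub_le_max' _ _) (max_lt h₀ h)
    rw [P.norm_algebraMap_const (sub_ne_zero.mpr hne)] at h2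
    exact lt_irrefl _ h2
  have hex : ∃ c : F, c ≠ 0 ∧ ∃ m : ℤ, ‖π ^ m * x - algebraMap F P.KInf c‖ < 1 :=
    ⟨c₀, hc₀, d, h₀⟩
  have hsgn : P.sgn π x = c₀ := by
    rw [sgn, dif_pos hex]
    obtain ⟨h1, m, h2⟩ := hex.choose_spec
    exact huniq _ m h1 h2
  rw [hsgn]
  constructor
  · rintro rfl; exact h₀
  · exact fun h => (huniq c d hc h).symm

variable {P} in
theorem sgn_ne_zero {π : P.KInf} (hπ : ‖π‖ = (Fintype.card F : ℝ)⁻¹) {x : P.KInf} {d : ℤ}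
    (hx : ‖x‖ = (Fintype.card F : ℝ) ^ d) : P.sgn π x ≠ 0 := by
  have hq := one_lt_card_real (F := F)
  obtain ⟨c₀, hc₀, h₀⟩ := P.exists_leading_coeff (π ^ d * x) (by
    rw [norm_mul, norm_zpow, hπ, hx, inv_zpow', ← zpow_add₀ (by positivity), neg_add_cancel,
      zpow_zero])
  rw [(sgn_eq_iff hπ hx hc₀).mpr h₀]
  exact hc₀

variable {P} in
theorem sgn_smul {π : P.KInf} (hπ : ‖π‖ = (Fintype.card F : ℝ)⁻¹) {x : P.KInf} {d : ℤ}
    (hx : ‖x‖ = (Fintype.card F : ℝ) ^ d) {c : F} (hc : c ≠ 0) :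
    P.sgn π (c • x) = c * P.sgn π x := by
  have h0 := sgn_ne_zero hπ hx
  have hcx : ‖c • x‖ = (Fintype.card F : ℝ) ^ d := by
    rw [Algebra.smul_def, norm_mul, P.norm_algebraMap_const hc, one_mul, hx]
  rw [sgn_eq_iff hπ hcx (mul_ne_zero hc h0)]
  have : π ^ d * c • x - algebraMap F P.KInf (c * P.sgn π x) =
      algebraMap F P.KInf c * (π ^ d * x - algebraMap F P.KInf (P.sgn π x)) := by
    rw [Algebra.smul_def, map_mul]; ring
  rw [this, norm_mul, P.norm_algebraMap_const hc, one_mul]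
  exact (sgn_eq_iff hπ hx h0).mp rfl

theorem norm_of_hasDegree {f : K} {d : ℕ} (h : P.HasDegree f d) :
    ‖algebraMap K P.KInf f‖ = (Fintype.card F : ℝ) ^ (d : ℤ) := by
  rw [norm_algebraMap_KInf, P.abs_eq_zpow h]

end RationalPlace
end FunctionFieldMZV

/-! ### The polynomials e_d of the spaces A_{<d} and their coefficients. -/

namespace FunctionFieldMZV

open Polynomial

/-- Composing an `F`-linear polynomial with `1 - s τ`. -/
theorem eval_linPoly_succ {F L : Type*} [Field F] [Fintype F] [Field L] [Algebra F L]
    {c e : ℕ → L} {N : ℕ} {s : L} (hN : c (N + 1) = 0) (h0 : e 0 = c 0)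
    (hs : ∀ k, e (k + 1) = c (k + 1) - s * c k ^ Fintype.card F) (z : L) :
    (linPoly F e (N + 1)).eval z =
      (linPoly F c N).eval z - s * (linPoly F c N).eval z ^ Fintype.card F := by
  have hpow := FrobSeries.sum_pow_card (F := F) (Finset.range (N + 1))
    (fun k => c k * z ^ Fintype.card F ^ k) 1
  rw [pow_one] at hpow
  rw [eval_linPoly, eval_linPoly, hpow, Finset.sum_range_succ', h0]
  have h1 : ∑ k ∈ Finset.range (N + 1), e (k + 1) * z ^ Fintype.card F ^ (k + 1) =
      ∑ k ∈ Finset.range (N + 1), c (k + 1) * z ^ Fintype.card F ^ (k + 1) -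
      s * ∑ k ∈ Finset.range (N + 1), (c k * z ^ Fintype.card F ^ k) ^ Fintype.card F := by
    rw [Finset.mul_sum, ← Finset.sum_sub_distrib]
    refine Finset.sum_congr rfl fun k _ => ?_
    rw [mul_pow, ← pow_mul, ← pow_succ, hs]
    ring
  have h2 : ∑ k ∈ Finset.range (N + 1), c k * z ^ Fintype.card F ^ k =
      ∑ k ∈ Finset.range (N + 1), c (k + 1) * z ^ Fintype.card F ^ (k + 1) +
        c 0 * z ^ Fintype.card F ^ 0 := by
    rw [Finset.sum_range_succ', Finset.sum_range_succ _ N, hN]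
    simp
  rw [h1, h2]
  ring

namespace RationalPlace

variable {F K : Type*} [Field F] [Fintype F] [Field K] [Algebra F K] (P : RationalPlace F K)

theorem set_finite_lattice (hK : IsCurveFunctionField F K) (d : ℕ) :
    (P.lattice d : Set K).Finite := by
  have := P.finite_lattice hK d
  have : Finite (P.lattice d) := Module.finite_of_finite F
  exact Set.toFinite _

/-- The finite set of the elements of `A` of degree less than `d`. -/
def latticeFinset (hK : IsCurveFunctionField F K) (d : ℕ) : Finset K :=
  (P.set_finite_lattice hK d).toFinset

variable (hK : IsCurveFunctionField F K)

theorem mem_latticeFinset {d : ℕ} {a : K} :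
    a ∈ P.latticeFinset hK d ↔ a ∈ P.lattice d := by simp [latticeFinset]

theorem card_latticeFinset (d : ℕ) :
    (P.latticeFinset hK d).card = Fintype.card F ^ Module.finrank F (P.lattice d) := by
  have := P.finite_lattice hK d
  rw [← Nat.card_eq_fintype_card, ← Module.natCard_eq_pow_finrank (V := P.lattice d),
    latticeFinset, ← Set.ncard_eq_toFinset_card _ (P.set_finite_lattice hK d)]
  rfl

theorem zero_mem_latticeFinset (d : ℕ) : (0 : K) ∈ P.latticeFinset hK d :=
  (P.mem_latticeFinset hK).mpr (zero_mem _)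

theorem monics_subset (π : P.KInf) (d : ℕ) : P.monics π d ⊆ P.lattice (d + 1) := fun _ ha =>
  P.mem_lattice_succ.mpr ⟨ha.1, le_of_eq ha.2.1⟩

include hK in
theorem finite_monics (π : P.KInf) (d : ℕ) : (P.monics π d).Finite :=
  (P.set_finite_lattice hK (d + 1)).subset (P.monics_subset π d)

theorem powerSum_eq_sum (π : P.KInf) (d n : ℕ) :
    P.powerSum π d n = ∑ a ∈ (P.finite_monics hK π d).toFinset, 1 / a ^ n :=
  finsum_mem_eq_finite_toFinset_sum _ _

include hK in
theorem powerSum_card_mul (π : P.KInf) (d n : ℕ) :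
    P.powerSum π d (Fintype.card F * n) = P.powerSum π d n ^ Fintype.card F := by
  rw [P.powerSum_eq_sum hK, P.powerSum_eq_sum hK]
  have := FrobSeries.sum_pow_card (F := F) (P.finite_monics hK π d).toFinset
    (fun a => 1 / a ^ n) 1
  rw [pow_one] at this
  rw [this]
  refine Finset.sum_congr rfl fun a _ => ?_
  rw [div_pow, one_pow, ← pow_mul, mul_comm]

include hK in
theorem powerSumLT_map_card_mul (π : P.KInf) (s : List ℕ) (d : ℕ) :
    P.powerSumLT π (s.map (Fintype.card F * ·)) d = P.powerSumLT π s d ^ Fintype.card F := by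
  induction s generalizing d with
  | nil => simp [powerSumLT]
  | cons n s ih =>
    have := FrobSeries.sum_pow_card (F := F) (Finset.range d)
      (fun i => P.powerSum π i n * P.powerSumLT π s i) 1
    rw [pow_one] at this
    rw [List.map_cons, powerSumLT, powerSumLT, this]
    refine Finset.sum_congr rfl fun i _ => ?_
    rw [ih, P.powerSum_card_mul hK, mul_pow]

theorem zagierTuple_succ (k : ℕ) : zagierTuple F (k + 1) =
    (Fintype.card F - 1) :: (zagierTuple F k).map (Fintype.card F * ·) := by
  simp only [zagierTuple, List.range_succ_eq_map, List.map_cons, List.map_map, pow_zero, one_mul]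
  congr 1
  refine List.map_congr_left fun i _ => ?_
  simp only [Function.comp_apply, Nat.succ_eq_add_one, pow_succ']
  ring

theorem neg_one_pow_card {R : Type*} [CommRing R] [Algebra F R] :
    (-1 : R) ^ Fintype.card F = -1 := by
  have := FrobSeries.algebraMap_pow_card (R := R) (-1 : F) 1
  simpa using this

/-- The signed sums `(-1) ^ k S_{<d}(q - 1, …, q ^ (k - 1) (q - 1))`. -/
def zetaCoeff (π : P.KInf) (d k : ℕ) : K := (-1) ^ k * P.powerSumLT π (zagierTuple F k) d

theorem zetaCoeff_zero_right (π : P.KInf) (d : ℕ) : P.zetaCoeff π d 0 = 1 := by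
  simp [zetaCoeff, zagierTuple, powerSumLT]

theorem zetaCoeff_zero_left (π : P.KInf) (k : ℕ) : P.zetaCoeff π 0 (k + 1) = 0 := by
  rw [zetaCoeff, zagierTuple_succ, powerSumLT, Finset.sum_range_zero, mul_zero]

-- The term i = d of the outer sum splits off, and its inner sum belongs to q times the shorter
-- tuple, so it is a q-th power by Frobenius. In operator form: e_{d+1} = (1 - S_d(q-1) τ) e_d.
include hK in
theorem zetaCoeff_succ (π : P.KInf) (d k : ℕ) : P.zetaCoeff π (d + 1) (k + 1) =
    P.zetaCoeff π d (k + 1) -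
      P.powerSum π d (Fintype.card F - 1) * P.zetaCoeff π d k ^ Fintype.card F := by
  simp only [zetaCoeff, zagierTuple_succ, powerSumLT, Finset.sum_range_succ,
    P.powerSumLT_map_card_mul hK, mul_pow]
  rw [← pow_mul, mul_comm k, pow_mul, neg_one_pow_card (F := F), pow_succ]
  ring

theorem latticeFinset_succ_of_forall_not {d : ℕ} (h : ∀ m ∈ P.A, ¬ P.HasDegree m d) :
    P.latticeFinset hK (d + 1) = P.latticeFinset hK d := by
  ext a
  rw [mem_latticeFinset, mem_latticeFinset, P.lattice_succ_of_forall_not h]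

include hK in
theorem finrank_lattice_succ_of_hasDegree {d : ℕ} {m : K} (hm : m ∈ P.A) (hd : P.HasDegree m d) :
    Module.finrank F (P.lattice (d + 1)) = Module.finrank F (P.lattice d) + 1 := by
  have := P.finite_lattice hK (d + 1)
  refine le_antisymm (P.finrank_lattice_succ_le hK d) (Submodule.finrank_lt_finrank_of_lt ?_)
  refine lt_of_le_of_ne (P.lattice_mono d.le_succ) fun h => ?_
  have h1 : m ∈ P.lattice d := h ▸ P.mem_lattice_succ.mpr ⟨hm, le_of_eq hd⟩
  have h2 : P.v m < WithZero.exp (d : ℤ) := h1.2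
  exact absurd hd h2.ne

variable {P} in
theorem hasDegree_smul_iff {c : F} (hc : c ≠ 0) {a : K} {d : ℕ} :
    P.HasDegree (c • a) d ↔ P.HasDegree a d := by
  unfold HasDegree
  rw [P.v_smul hc]

theorem ne_zero_of_hasDegree {a : K} {d : ℕ} (h : P.HasDegree a d) : a ≠ 0 := by
  rintro rfl
  exact WithZero.exp_ne_zero (h.symm.trans (map_zero _))

variable {π : P.KInf} (hπ : ‖π‖ = (Fintype.card F : ℝ)⁻¹)

theorem sgn_algebraMap_smul (hπ : ‖π‖ = (Fintype.card F : ℝ)⁻¹) {a : K} {d : ℕ}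
    (h : P.HasDegree a d) {c : F} (hc : c ≠ 0) :
    P.sgn π (algebraMap K P.KInf (c • a)) = c * P.sgn π (algebraMap K P.KInf a) := by
  rw [← sgn_smul hπ (P.norm_of_hasDegree h) hc]
  congr 1
  rw [Algebra.smul_def, map_mul, ← IsScalarTower.algebraMap_apply F K P.KInf, ← Algebra.smul_def]

open Classical in
include hπ in
/-- The nonzero elements of degree at most `d` are those of degree less than `d` and the multiples
of the monic elements of degree `d`. -/
theorem prod_latticeFinset_succ {M : Type*} [CommMonoid M] (f : K → M) (d : ℕ) :
    ∏ a ∈ (P.latticeFinset hK (d + 1)).erase 0, f a =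
      (∏ a ∈ (P.latticeFinset hK d).erase 0, f a) *
        ∏ a ∈ (P.finite_monics hK π d).toFinset,
          ∏ c ∈ (Finset.univ : Finset F).erase 0, f (c • a) := by
  have hsub : (P.latticeFinset hK d).erase 0 ⊆ (P.latticeFinset hK (d + 1)).erase 0 := by
    refine Finset.erase_subset_erase _ fun a ha => ?_
    rw [mem_latticeFinset] at ha ⊢
    exact P.lattice_mono d.le_succ ha
  rw [← Finset.prod_sdiff hsub, mul_comm]
  congr 1
  rw [← Finset.prod_product' (P.finite_monics hK π d).toFinset
    ((Finset.univ : Finset F).erase 0) (fun a c => f (c • a))]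
  symm
  have hmem : ∀ a, a ∈ (P.latticeFinset hK (d + 1)).erase 0 \ (P.latticeFinset hK d).erase 0 ↔
      a ∈ P.A ∧ P.HasDegree a d := by
    intro a
    simp only [Finset.mem_sdiff, Finset.mem_erase, mem_latticeFinset, mem_lattice_succ, mem_lattice]
    constructor
    · rintro ⟨⟨h0, hA, hle⟩, h⟩
      exact ⟨hA, le_antisymm hle (not_lt.mp fun hlt => h ⟨h0, hA, hlt⟩)⟩
    · rintro ⟨hA, hd⟩
      exact ⟨⟨P.ne_zero_of_hasDegree hd, hA, le_of_eq hd⟩, fun h => absurd hd h.2.2.ne⟩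
  refine Finset.prod_nbij' (fun x => x.2 • x.1)
    (fun a => ((P.sgn π (algebraMap K P.KInf a))⁻¹ • a, P.sgn π (algebraMap K P.KInf a)))
    ?_ ?_ ?_ ?_ ?_
  · rintro ⟨a, c⟩ h
    simp only [Finset.mem_product, Set.Finite.mem_toFinset, Finset.mem_erase, Finset.mem_univ,
      and_true] at h
    rw [hmem]
    exact ⟨P.A.smul_mem h.1.1 c, (hasDegree_smul_iff h.2).mpr h.1.2.1⟩
  · intro a h
    rw [hmem] at h
    have h0 := sgn_ne_zero hπ (P.norm_of_hasDegree h.2)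
    simp only [Finset.mem_product, Set.Finite.mem_toFinset, Finset.mem_erase, Finset.mem_univ,
      and_true]
    refine ⟨⟨P.A.smul_mem h.1 _, (hasDegree_smul_iff (inv_ne_zero h0)).mpr h.2, ?_⟩, h0⟩
    rw [P.sgn_algebraMap_smul hπ h.2 (inv_ne_zero h0), inv_mul_cancel₀ h0]
  · rintro ⟨a, c⟩ h
    simp only [Finset.mem_product, Set.Finite.mem_toFinset, Finset.mem_erase, Finset.mem_univ,
      and_true] at h
    have h1 : P.sgn π (algebraMap K P.KInf (c • a)) = c := by
      rw [P.sgn_algebraMap_smul hπ h.1.2.1 h.2, h.1.2.2, mul_one]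
    simp only [h1, smul_smul, inv_mul_cancel₀ h.2, one_smul]
  · intro a h
    rw [hmem] at h
    have h0 := sgn_ne_zero hπ (P.norm_of_hasDegree h.2)
    simp only [smul_smul, mul_inv_cancel₀ h0, one_smul]
  · rintro ⟨a, c⟩ _
    rfl

-- The new factors, grouped by monic elements, are 1 - X^{q-1}/a^{q-1}, and multiplying by them
-- lowers the coefficient of X^q by ∑ 1/a^{q-1}. This identifies the scalar s of the composition
-- step with a power sum.
open Classical in
include hπ in
theorem coeff_rootPoly_latticeFinset_succ (d : ℕ) :
    (rootPoly (P.latticeFinset hK (d + 1))).coeff (Fintype.card F) =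
      (rootPoly (P.latticeFinset hK d)).coeff (Fintype.card F) -
        P.powerSum π d (Fintype.card F - 1) := by
  have hq : Fintype.card F - 1 + 1 = Fintype.card F := Nat.sub_add_cancel Fintype.card_pos
  have hq1 : 1 ≤ Fintype.card F - 1 := by
    have := Fintype.one_lt_card (α := F); omega
  have h1 : rootPoly (P.latticeFinset hK (d + 1)) = rootPoly (P.latticeFinset hK d) *
      ∏ a ∈ (P.finite_monics hK π d).toFinset,
        (1 - C (a ^ (Fintype.card F - 1))⁻¹ * X ^ (Fintype.card F - 1)) := by
    rw [rootPoly, rootPoly, P.prod_latticeFinset_succ hK hπ, mul_assoc]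
    congr 2
    refine Finset.prod_congr rfl fun a ha => prod_one_sub_smul_inv ?_
    exact P.ne_zero_of_hasDegree ((Set.Finite.mem_toFinset _).mp ha).2.1
  have h2 := coeff_mul_prod_one_sub hq1 (A := rootPoly (P.latticeFinset hK d))
    (by rw [rootPoly, mul_coeff_zero, coeff_X_zero, zero_mul])
    (P.finite_monics hK π d).toFinset fun a => (a ^ (Fintype.card F - 1))⁻¹
  rw [hq, coeff_rootPoly_one, one_mul] at h2
  rw [h1, h2, P.powerSum_eq_sum hK]
  simp only [one_div]

open Classical in
include hπ in
/-- The polynomial `X ∏ (1 - X / a)` over the nonzero elements `a` of `A` of degree less than `d`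
has the coefficients `(-1) ^ k S_{<d}(q - 1, …, q ^ (k - 1) (q - 1))`. -/
theorem linPoly_zetaCoeff (d : ℕ) :
    (∀ k, Module.finrank F (P.lattice d) < k → P.zetaCoeff π d k = 0) ∧
    linPoly F (P.zetaCoeff π d) (Module.finrank F (P.lattice d)) =
      rootPoly (P.latticeFinset hK d) := by
  induction d with
  | zero =>
    rw [P.lattice_zero hK, finrank_bot]
    refine ⟨fun k hk => ?_, ?_⟩
    · obtain ⟨k, rfl⟩ := Nat.exists_eq_succ_of_ne_zero hk.ne'
      exact P.zetaCoeff_zero_left π k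
    · have : P.latticeFinset hK 0 = {0} := by
        ext a
        rw [mem_latticeFinset, P.lattice_zero hK, Submodule.mem_bot, Finset.mem_singleton]
      rw [this, rootPoly, Finset.erase_singleton, Finset.prod_empty, linPoly,
        Finset.sum_range_one, zetaCoeff_zero_right, C_1, pow_zero]
      ring
  | succ d ih =>
    obtain ⟨ih₁, ih₂⟩ := ih
    by_cases h : ∀ m ∈ P.A, ¬ P.HasDegree m d
    · have hS : P.powerSum π d (Fintype.card F - 1) = 0 := by
        rw [P.powerSum_eq_sum hK]
        refine Finset.sum_eq_zero fun a ha => ?_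
        have ha' := (Set.Finite.mem_toFinset _).mp ha
        exact absurd ha'.2.1 (h a ha'.1)
      have hc : P.zetaCoeff π (d + 1) = P.zetaCoeff π d := by
        funext k
        cases k with
        | zero => rw [zetaCoeff_zero_right, zetaCoeff_zero_right]
        | succ k => rw [P.zetaCoeff_succ hK, hS, zero_mul, sub_zero]
      rw [hc, P.lattice_succ_of_forall_not h, P.latticeFinset_succ_of_forall_not hK h]
      exact ⟨ih₁, ih₂⟩
    · push Not at h
      obtain ⟨m, hm, hd⟩ := h
      have hrank := P.finrank_lattice_succ_of_hasDegree hK hm hd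
      rw [hrank]
      set N := Module.finrank F (P.lattice d) with hN
      have hvan : ∀ k, N + 1 < k → P.zetaCoeff π (d + 1) k = 0 := by
        intro k hk
        obtain ⟨k, rfl⟩ := Nat.exists_eq_succ_of_ne_zero (show k ≠ 0 by omega)
        rw [Nat.succ_eq_add_one, P.zetaCoeff_succ hK, ih₁ _ (by omega), ih₁ k (by omega),
          zero_pow Fintype.card_ne_zero, mul_zero, sub_zero]
      refine ⟨hvan, ?_⟩
      set p := linPoly F (P.zetaCoeff π d) N with hp
      have hroot : ∀ a ∈ P.latticeFinset hK d, p.eval a = 0 := by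
        intro a ha
        rw [ih₂, eval_rootPoly]
        by_cases ha0 : a = 0
        · rw [ha0, zero_mul]
        · rw [Finset.prod_eq_zero (i := a) (Finset.mem_erase.mpr ⟨ha0, ha⟩)
            (by rw [div_self ha0, sub_self]), mul_zero]
      have hm0 : p.eval m ≠ 0 := by
        rw [ih₂, eval_rootPoly]
        refine mul_ne_zero (P.ne_zero_of_hasDegree hd) (Finset.prod_ne_zero_iff.mpr fun a ha => ?_)
        rw [sub_ne_zero, Ne, eq_comm, div_eq_one_iff_eq (Finset.ne_of_mem_erase ha)]
        rintro rfl
        have := (P.mem_latticeFinset hK).mp (Finset.mem_of_mem_erase ha)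
        exact absurd hd this.2.ne
      -- This is the scalar for which z ↦ p(z) - s p(z)^q kills `m`; by F-linearity it then kills
      -- A_{<d} + F m = A_{<d+1}.
      let s : K := (p.eval m ^ (Fintype.card F - 1))⁻¹
      let e : ℕ → K := fun k => match k with
        | 0 => 1
        | k + 1 => P.zetaCoeff π d (k + 1) - s * P.zetaCoeff π d k ^ Fintype.card F
      have he : ∀ z, (linPoly F e (N + 1)).eval z = p.eval z - s * p.eval z ^ Fintype.card F :=
        eval_linPoly_succ (ih₁ _ (Nat.lt_succ_self _)) (P.zetaCoeff_zero_right π d).symm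
          fun _ => rfl
      have hroot' : ∀ a ∈ P.latticeFinset hK (d + 1), (linPoly F e (N + 1)).eval a = 0 := by
        intro a ha
        rw [mem_latticeFinset, P.lattice_succ_of_hasDegree hm hd, Submodule.mem_sup] at ha
        obtain ⟨b, hb, y, hy, rfl⟩ := ha
        obtain ⟨c, rfl⟩ := Submodule.mem_span_singleton.mp hy
        have hpow := smul_pow_card (L := K) c (p.eval m) 1
        rw [pow_one] at hpow
        rw [he, hp, eval_linPoly_add, eval_linPoly_smul, ← hp,
          hroot b ((P.mem_latticeFinset hK).mpr hb), zero_add, hpow,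
          ← Nat.sub_add_cancel (Fintype.card_pos (α := F)), pow_succ, mul_smul_comm, ← mul_assoc,
          inv_mul_cancel₀ (pow_ne_zero _ hm0), one_mul, sub_self]
      have heq : linPoly F e (N + 1) = rootPoly (P.latticeFinset hK (d + 1)) := by
        refine linPoly_eq_rootPoly rfl (P.zero_mem_latticeFinset hK _) hroot' ?_
        rw [P.card_latticeFinset hK, hrank]
        exact natDegree_linPoly_le _ _
      have hs : s = P.powerSum π d (Fintype.card F - 1) := by
        have h1 := P.coeff_rootPoly_latticeFinset_succ hK hπ d
        have h2 := coeff_linPoly_pow (F := F) e (N + 1) 1 (by omega)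
        -- For N = 0 the polynomial has degree at most 1 < q, so its coefficient of X^q is zero, as
        -- is the corresponding `zetaCoeff`.
        have h3 : (linPoly F (P.zetaCoeff π d) N).coeff (Fintype.card F) = P.zetaCoeff π d 1 := by
          by_cases hN0 : 1 ≤ N
          · have := coeff_linPoly_pow (F := F) (P.zetaCoeff π d) N 1 hN0
            rwa [pow_one] at this
          · rw [ih₁ 1 (by omega)]
            refine coeff_eq_zero_of_natDegree_lt ((natDegree_linPoly_le _ _).trans_lt ?_)
            rw [show N = 0 by omega, pow_zero]
            exact Fintype.one_lt_card
        rw [pow_one] at h2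
        rw [← heq, h2, ← ih₂, h3] at h1
        simp only [e, zetaCoeff_zero_right, one_pow, mul_one] at h1
        exact sub_right_injective h1
      have hce : P.zetaCoeff π (d + 1) = e := by
        funext k
        cases k with
        | zero => exact P.zetaCoeff_zero_right π _
        | succ k => rw [P.zetaCoeff_succ hK, ← hs]
      rw [hce, heq]

end RationalPlace
end FunctionFieldMZV

/-! ### Entire F-linear functions: zeros and Weierstrass products over an ultrametric field. -/

namespace FunctionFieldMZV

open Polynomial

theorem norm_prod_sub_one_le {ι L : Type*} [NormedField L] [IsUltrametricDist L] {s : Finset ι}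
    {f : ι → L} {ε : ℝ} (hε0 : 0 ≤ ε) (hε1 : ε ≤ 1) (h : ∀ i ∈ s, ‖f i - 1‖ ≤ ε) :
    ‖∏ i ∈ s, f i - 1‖ ≤ ε := by
  classical
  induction s using Finset.induction_on with
  | empty => simpa using hε0
  | insert a s ha ih =>
    have h1 := h a (Finset.mem_insert_self a s)
    have h2 := ih fun i hi => h i (Finset.mem_insert_of_mem hi)
    have h3 : ‖f a‖ ≤ 1 := by
      rw [← sub_add_cancel (f a) 1]
      refine (IsUltrametricDist.norm_add_le_max _ _).trans (max_le (h1.trans hε1) ?_)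
      rw [norm_one]
    rw [Finset.prod_insert ha, show f a * ∏ i ∈ s, f i - 1 = f a * (∏ i ∈ s, f i - 1) + (f a - 1) by
      ring]
    refine (IsUltrametricDist.norm_add_le_max _ _).trans (max_le ?_ h1)
    rw [norm_mul]
    exact (mul_le_of_le_one_left (norm_nonneg _) h3).trans h2

/-- An infinite product in an ultrametric field converges if it does so along a sequence of
finite sets off which the factors tend uniformly to `1`. -/
theorem hasProd_of_tendsto_prod {ι L : Type*} [NormedField L] [IsUltrametricDist L] {f : ι → L}
    {s : ℕ → Finset ι} {r : ℕ → ℝ} (hr : Tendsto r atTop (𝓝 0))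
    (hf : ∀ n, ∀ i ∉ s n, ‖f i - 1‖ ≤ r n) {w : L}
    (hw : Tendsto (fun n => ∏ i ∈ s n, f i) atTop (𝓝 w)) : HasProd f w := by
  classical
  have hr' : Tendsto (fun n => |r n|) atTop (𝓝 0) := by simpa using hr.abs
  rw [HasProd, SummationFilter.unconditional_filter, Metric.tendsto_nhds]
  intro ε hε
  have hmul : Tendsto (fun n => ‖∏ i ∈ s n, f i‖ * |r n|) atTop (𝓝 0) := by
    simpa using hw.norm.mul hr'
  have e1 := (Metric.tendsto_nhds.mp hw) ε hε
  have e2 := hmul.eventually_lt_const hε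
  have e3 := hr'.eventually_lt_const one_pos
  obtain ⟨n, h1, h2, h3⟩ := (e1.and (e2.and e3)).exists
  refine (eventually_ge_atTop (s n)).mono fun t ht => ?_
  have h4 : ‖∏ i ∈ t \ s n, f i - 1‖ ≤ |r n| :=
    norm_prod_sub_one_le (_root_.abs_nonneg _) h3.le fun i hi =>
      (hf n i (Finset.mem_sdiff.mp hi).2).trans (le_abs_self _)
  have h5 : ∏ i ∈ t, f i - w = (∏ i ∈ s n, f i) * (∏ i ∈ t \ s n, f i - 1) +
      (∏ i ∈ s n, f i - w) := by
    rw [← Finset.prod_sdiff ht]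
    ring
  rw [dist_eq_norm, h5]
  refine (IsUltrametricDist.norm_add_le_max _ _).trans_lt (max_lt ?_ ?_)
  · rw [norm_mul]
    exact (mul_le_mul_of_nonneg_left h4 (norm_nonneg _)).trans_lt h2
  · rwa [← dist_eq_norm]

/-! ### Entire `F`-linear functions -/

variable (F : Type*) {L : Type*} [Field F] [Fintype F] [NormedField L] [Algebra F L]

/-- The series `∑ f_k z ^ (q ^ k)` converges everywhere. -/
def IsEntire (f : ℕ → L) : Prop :=
  ∀ R : ℝ, 0 ≤ R → Tendsto (fun k => ‖f k‖ * R ^ Fintype.card F ^ k) atTop (𝓝 0)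

/-- The sum of the series `∑ f_k z ^ (q ^ k)`. -/
def frobSum (f : ℕ → L) (z : L) : L := ∑' k, f k * z ^ Fintype.card F ^ k

variable {F} [IsUltrametricDist L]

theorem IsEntire.hasSum [CompleteSpace L] {f : ℕ → L} (hf : IsEntire F f) (z : L) :
    HasSum (fun k => f k * z ^ Fintype.card F ^ k) (frobSum F f z) := by
  refine Summable.hasSum (NonarchimedeanAddGroup.summable_of_tendsto_cofinite_zero ?_)
  rw [Nat.cofinite_eq_atTop, tendsto_zero_iff_norm_tendsto_zero]
  simpa [norm_mul, norm_pow] using hf ‖z‖ (norm_nonneg z)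

theorem IsEntire.tendsto_linPoly [CompleteSpace L] {f : ℕ → L} (hf : IsEntire F f) (z : L) :
    Tendsto (fun N => (linPoly F f N).eval z) atTop (𝓝 (frobSum F f z)) := by
  simp only [eval_linPoly]
  exact (hf.hasSum z).tendsto_sum_nat.comp (tendsto_add_atTop_nat 1)

theorem norm_eval_linPoly_sub_le {f : ℕ → L} {N M : ℕ} (hNM : N ≤ M) {z : L} {δ : ℝ} (hδ : 0 ≤ δ)
    (h : ∀ k, N < k → ‖f k‖ * ‖z‖ ^ Fintype.card F ^ k ≤ δ) :
    ‖(linPoly F f M).eval z - (linPoly F f N).eval z‖ ≤ δ := by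
  rw [eval_linPoly, eval_linPoly, ← Finset.sum_Ico_eq_sub _ (Nat.succ_le_succ hNM)]
  refine IsUltrametricDist.norm_sum_le_of_forall_le_of_nonneg hδ fun k hk => ?_
  rw [norm_mul, norm_pow]
  exact h k (Finset.mem_Ico.mp hk).1

/-- A splitting `F`-linear polynomial with linear coefficient `1` is the product over its roots. -/
theorem linPoly_eq_rootPoly_of_splits [DecidableEq L] {f : ℕ → L} {N : ℕ} (h0 : f 0 = 1)
    (hs : (linPoly F f N).Splits) :
    linPoly F f N = rootPoly (linPoly F f N).roots.toFinset ∧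
      ∀ y, y ∈ (linPoly F f N).roots.toFinset ↔ (linPoly F f N).eval y = 0 := by
  have hne : linPoly F f N ≠ 0 := fun h => by
    have := coeff_linPoly_one (F := F) f N
    rw [h, h0, coeff_zero] at this
    exact zero_ne_one this
  have hmem : ∀ y, y ∈ (linPoly F f N).roots.toFinset ↔ (linPoly F f N).eval y = 0 := fun y => by
    rw [Multiset.mem_toFinset, mem_roots hne, IsRoot.def]
  refine ⟨linPoly_eq_rootPoly h0 ((hmem 0).mpr ?_) (fun a ha => (hmem a).mp ha) ?_, hmem⟩
  · rw [← coeff_zero_eq_eval_zero, coeff_linPoly_zero]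
  · have hsep : (linPoly F f N).Separable := by
      rw [Polynomial.Separable, derivative_linPoly, h0, C_1]
      exact isCoprime_one_right
    rw [Multiset.toFinset_card_of_nodup (nodup_roots hsep), hs.natDegree_eq_card_roots]

/-- Every point `z` has a root of the `F`-linear polynomial `p = X + ⋯` at distance at most
`|p(z)|`. -/
theorem exists_root_norm_sub_le {f : ℕ → L} {N : ℕ} (h0 : f 0 = 1)
    (hs : (linPoly F f N).Splits) (z : L) :
    ∃ y, (linPoly F f N).eval y = 0 ∧ ‖z - y‖ ≤ ‖(linPoly F f N).eval z‖ := by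
  classical
  obtain ⟨hp, hmem⟩ := linPoly_eq_rootPoly_of_splits h0 hs
  set V := (linPoly F f N).roots.toFinset
  have h0V : (0 : L) ∈ V := (hmem 0).mpr (by rw [← coeff_zero_eq_eval_zero, coeff_linPoly_zero])
  -- With y₀ a root nearest to z, p(z) = p(z - y₀) = (z - y₀) ∏ (1 - (z - y₀)/y). Every factor has
  -- norm at least 1, because z - y₀ is no closer to y than to 0.
  obtain ⟨y₀, hy₀, hmin⟩ := V.exists_min_image (fun y => ‖z - y‖) ⟨0, h0V⟩
  refine ⟨y₀, (hmem y₀).mp hy₀, ?_⟩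
  have h1 : (linPoly F f N).eval z = (linPoly F f N).eval (z - y₀) := by
    rw [eval_linPoly_sub, (hmem y₀).mp hy₀, sub_zero]
  rw [h1, hp, eval_rootPoly, norm_mul, norm_prod]
  refine le_mul_of_one_le_right (norm_nonneg _) ?_
  rw [← Finset.prod_const_one (s := V.erase 0)]
  refine Finset.prod_le_prod (fun _ _ => zero_le_one) fun y hy => ?_
  have hy0 := Finset.ne_of_mem_erase hy
  have h2 : ‖z - y₀‖ ≤ ‖z - y₀ - y‖ := by
    rw [sub_sub]
    refine hmin _ ((hmem _).mpr ?_)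
    rw [eval_linPoly_add, (hmem y₀).mp hy₀, (hmem y).mp (Finset.mem_of_mem_erase hy), add_zero]
  have h3 : ‖y‖ ≤ ‖z - y₀ - y‖ := by
    rw [← sub_sub_cancel (z - y₀) y]
    refine (norm_sub_le_max' _ _).trans (max_le ?_ ?_) <;> simp [h2]
  rw [← div_self hy0, ← sub_div, norm_div, ← norm_neg (y - _), neg_sub]
  exact (one_le_div (norm_pos_iff.mpr hy0)).mpr h3

/-- The coefficients are bounded, so near 0 the linear term dominates with a radius independent of
N. By additivity, distinct roots of any truncation are at distance at least ρ. -/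
theorem IsEntire.exists_norm_linPoly_eq {f : ℕ → L} (hf : IsEntire F f) (h0 : f 0 = 1) :
    ∃ ρ : ℝ, 0 < ρ ∧ ∀ N z, ‖z‖ < ρ → ‖(linPoly F f N).eval z‖ = ‖z‖ := by
  obtain ⟨C, hC⟩ := (hf 1 zero_le_one).bddAbove_range
  have hC' : ∀ k, ‖f k‖ ≤ C := fun k => by
    have := hC ⟨k, rfl⟩
    simpa using this
  have hC0 : 0 ≤ C := (norm_nonneg _).trans (hC' 0)
  refine ⟨(C + 1)⁻¹, by positivity, fun N z hz => ?_⟩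
  by_cases hz0 : z = 0
  · rw [hz0, ← coeff_zero_eq_eval_zero, coeff_linPoly_zero]
  have hzpos := norm_pos_iff.mpr hz0
  have hz1 : ‖z‖ ≤ 1 := hz.le.trans (inv_le_one_of_one_le₀ (by linarith))
  have hzC : C * ‖z‖ < 1 := by
    have : (C + 1) * ‖z‖ < 1 := by rwa [mul_comm, ← lt_div_iff₀ (by positivity), one_div]
    nlinarith
  refine norm_eq_of_norm_sub_lt ?_
  rw [eval_linPoly, Finset.sum_range_succ', h0, pow_zero, pow_one, one_mul, add_sub_cancel_right]
  refine lt_of_le_of_lt (b := C * ‖z‖ * ‖z‖)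
    (IsUltrametricDist.norm_sum_le_of_forall_le_of_nonneg (by positivity) fun k _ => ?_) ?_
  · rw [norm_mul, norm_pow, mul_assoc, ← pow_two]
    refine mul_le_mul (hC' _) (pow_le_pow_of_le_one (norm_nonneg _) hz1 ?_) (by positivity) hC0
    have h2 : 2 ≤ Fintype.card F := Fintype.one_lt_card (α := F)
    exact h2.trans (Nat.le_self_pow k.succ_ne_zero _)
  · exact mul_lt_of_lt_one_left hzpos hzC

section Complete

variable [CompleteSpace L]

theorem IsEntire.norm_frobSum_sub_le {f : ℕ → L} (hf : IsEntire F f) {N : ℕ} {z : L} {δ : ℝ}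
    (hδ : 0 ≤ δ) (h : ∀ k, N < k → ‖f k‖ * ‖z‖ ^ Fintype.card F ^ k ≤ δ) :
    ‖frobSum F f z - (linPoly F f N).eval z‖ ≤ δ :=
  le_of_tendsto ((hf.tendsto_linPoly z).sub_const _).norm
    ((eventually_ge_atTop N).mono fun _ hM => norm_eval_linPoly_sub_le hM hδ h)

theorem IsEntire.frobSum_sub {f : ℕ → L} (hf : IsEntire F f) (x y : L) :
    frobSum F f (x - y) = frobSum F f x - frobSum F f y := by
  refine tendsto_nhds_unique (hf.tendsto_linPoly _) ?_
  simp only [eval_linPoly_sub]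
  exact (hf.tendsto_linPoly _).sub (hf.tendsto_linPoly _)

/-- A root of a truncation in the disc is close to a true zero: passing repeatedly to a nearby root
of the next truncation moves it by at most the norm of the newly added term, and these norms tend to
0. -/
theorem IsEntire.exists_zero_norm_sub_le {f : ℕ → L} (hf : IsEntire F f) (h0 : f 0 = 1)
    (hs : ∀ N, (linPoly F f N).Splits) {N : ℕ} {r δ : ℝ} (hδ : 0 ≤ δ) (hr : δ < r)
    (h : ∀ k, N < k → ‖f k‖ * r ^ Fintype.card F ^ k ≤ δ) {y : L} (hyr : ‖y‖ < r)
    (hy : (linPoly F f N).eval y = 0) :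
    ∃ x, frobSum F f x = 0 ∧ ‖x - y‖ ≤ δ ∧ ‖x‖ < r := by
  have hr0 : 0 ≤ r := hδ.trans hr.le
  choose g hg₁ hg₂ using fun M => exists_root_norm_sub_le h0 (hs M)
  let Y : ℕ → L := fun n => Nat.rec y (fun n z => g (N + n + 1) z) n
  have hYs : ∀ n, Y (n + 1) = g (N + n + 1) (Y n) := fun _ => rfl
  have hY0 : ∀ n, (linPoly F f (N + n)).eval (Y n) = 0 := by
    intro n
    cases n with
    | zero => exact hy
    | succ n => rw [hYs]; exact hg₁ _ _
  have hstep' : ∀ n, ‖Y n‖ < r →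
      ‖Y n - Y (n + 1)‖ ≤ ‖f (N + n + 1)‖ * r ^ Fintype.card F ^ (N + n + 1) := by
    intro n hn
    refine (hg₂ (N + n + 1) (Y n)).trans ?_
    have h1 := hY0 n
    rw [eval_linPoly] at h1
    rw [eval_linPoly, Finset.sum_range_succ, h1, zero_add, norm_mul, norm_pow]
    gcongr
  have hYr : ∀ n, ‖Y n - y‖ ≤ δ ∧ ‖Y n‖ < r := by
    intro n
    induction n with
    | zero => exact ⟨by simpa [Y] using hδ, hyr⟩
    | succ n ih =>
      have h1 : ‖Y (n + 1) - y‖ ≤ δ := by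
        rw [show Y (n + 1) - y = (Y n - y) - (Y n - Y (n + 1)) by ring]
        exact (norm_sub_le_max' _ _).trans
          (max_le ih.1 ((hstep' n ih.2).trans (h _ (by omega))))
      refine ⟨h1, ?_⟩
      rw [← sub_add_cancel (Y (n + 1)) y]
      exact (IsUltrametricDist.norm_add_le_max _ _).trans_lt (max_lt (h1.trans_lt hr) hyr)
  have hcauchy : CauchySeq Y := by
    refine NonarchimedeanAddGroup.cauchySeq_of_tendsto_sub_nhds_zero ?_
    refine squeeze_zero_norm (fun n => ?_)
      ((hf r hr0).comp (tendsto_add_atTop_nat (N + 1)))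
    rw [← norm_neg, neg_sub]
    refine (hstep' n (hYr n).2).trans (le_of_eq ?_)
    simp only [Function.comp_apply]
    rw [show n + (N + 1) = N + n + 1 by ring]
  obtain ⟨x, hx⟩ := cauchySeq_tendsto_of_complete hcauchy
  have hxy : ‖x - y‖ ≤ δ :=
    le_of_tendsto (hx.sub_const y).norm (Eventually.of_forall fun n => (hYr n).1)
  refine ⟨x, ?_, hxy, ?_⟩
  -- Near the limit x the truncations satisfy |p_{N+n}(x)| = |x - Y_n|, which tends to 0.
  · obtain ⟨ρ, hρ, hρN⟩ := hf.exists_norm_linPoly_eq h0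
    refine tendsto_nhds_unique ((hf.tendsto_linPoly x).comp (tendsto_add_atTop_nat N)) ?_
    have hx0 : Tendsto (fun n => ‖x - Y n‖) atTop (𝓝 0) := by
      simpa using (hx.const_sub x).norm
    rw [tendsto_zero_iff_norm_tendsto_zero]
    refine (tendsto_congr' ?_).mpr hx0
    filter_upwards [hx0.eventually_lt_const hρ] with n hn
    rw [← hρN (N + n) _ hn, eval_linPoly_sub, hY0, sub_zero, Function.comp_apply, add_comm n N]
  · rw [← sub_add_cancel x y]
    exact (IsUltrametricDist.norm_add_le_max _ _).trans_lt (max_lt (hxy.trans_lt hr) hyr)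

open Classical in
/-- The Weierstrass product over the zeros `V` in the disc of radius `r` approximates the entire
function `z + ⋯` on this disc. -/
theorem IsEntire.norm_frobSum_sub_rootPoly_le {f : ℕ → L} (hf : IsEntire F f) (h0 : f 0 = 1)
    (hs : ∀ N, (linPoly F f N).Splits) {r : ℝ} (hr : 0 < r) {V : Finset L}
    (hV : ∀ x, x ∈ V ↔ ‖x‖ < r ∧ frobSum F f x = 0) {z : L} (hz : ‖z‖ < r) :
    ‖frobSum F f z - (rootPoly V).eval z‖ ≤ ‖(rootPoly V).eval z‖ * (‖z‖ / r) := by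
  obtain ⟨ρ, hρ, hρN⟩ := hf.exists_norm_linPoly_eq h0
  choose g hg₁ hg₂ using fun M => exists_root_norm_sub_le h0 (hs M)
  have hg : ∀ x ∈ V, Tendsto (fun N => g N x) atTop (𝓝 x) := by
    intro x hx
    rw [tendsto_iff_norm_sub_tendsto_zero]
    have := (hf.tendsto_linPoly x).norm
    rw [((hV x).mp hx).2, norm_zero] at this
    refine squeeze_zero (fun _ => norm_nonneg _) (fun N => ?_) this
    rw [← norm_neg, neg_sub]
    exact hg₂ N x
  have hzero : ∀ N, (linPoly F f N).eval 0 = 0 := fun N => by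
    rw [← coeff_zero_eq_eval_zero, coeff_linPoly_zero]
  have hfzero : frobSum F f 0 = 0 := tendsto_nhds_unique (hf.tendsto_linPoly 0) (by simp [hzero])
  have h0V : (0 : L) ∈ V := (hV 0).mpr ⟨by simpa using hr, hfzero⟩
  have hsepN : ∀ N x y, (linPoly F f N).eval x = 0 → (linPoly F f N).eval y = 0 →
      ‖x - y‖ < ρ → x = y := by
    intro N x y hx hy hxy
    have := hρN N _ hxy
    rw [eval_linPoly_sub, hx, hy, sub_zero, norm_zero] at this
    exact sub_eq_zero.mp (norm_eq_zero.mp this.symm)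
  have hsep : ∀ x ∈ V, ∀ y ∈ V, ‖x - y‖ < ρ → x = y := by
    intro x hx y hy hxy
    have h1 := (hf.tendsto_linPoly (x - y)).norm
    rw [hf.frobSum_sub, ((hV x).mp hx).2, ((hV y).mp hy).2, sub_zero, norm_zero] at h1
    have h2 : ‖x - y‖ = 0 :=
      tendsto_nhds_unique (tendsto_const_nhds.congr fun N => (hρN N _ hxy).symm) h1
    exact sub_eq_zero.mp (norm_eq_zero.mp h2)
  have hg0 : ∀ N, g N 0 = 0 := by
    intro N
    have h1 := hg₂ N 0
    rw [hzero, norm_zero, zero_sub, norm_neg] at h1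
    exact norm_le_zero_iff.mp h1
  -- Moving a point by at most η < r keeps it in the disc of radius r, and η < ρ makes the matching
  -- of zeros with roots injective.
  set η := min r ρ / 2 with hη
  have hη0 : 0 < η := by positivity
  have hηr : η < r := (half_lt_self (lt_min hr hρ)).trans_le (min_le_left _ _)
  have hηρ : η < ρ := (half_lt_self (lt_min hr hρ)).trans_le (min_le_right _ _)
  have hev : ∀ᶠ N in atTop, ∀ k, N < k → ‖f k‖ * r ^ Fintype.card F ^ k ≤ η := by
    obtain ⟨N₀, hN₀⟩ := eventually_atTop.mp ((hf r hr.le).eventually_le_const hη0)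
    exact (eventually_ge_atTop N₀).mono fun N hN k hk => hN₀ k (hN.trans hk.le)
  set Q : ℕ → L := fun N => z * ∏ x ∈ V.erase 0, (1 - z / g N x) with hQ
  have hbound : ∀ᶠ N in atTop, ‖(linPoly F f N).eval z - Q N‖ ≤ ‖Q N‖ * (‖z‖ / r) := by
    filter_upwards [hev] with N hN
    obtain ⟨hp, hmem⟩ := linPoly_eq_rootPoly_of_splits h0 (hs N)
    set R := (linPoly F f N).roots.toFinset
    have hgV : ∀ x ∈ V, ‖x - g N x‖ ≤ η := by
      intro x hx
      obtain ⟨hxr, hx0⟩ := (hV x).mp hx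
      refine (hg₂ N x).trans ?_
      have := hf.norm_frobSum_sub_le (N := N) (z := x) hη0.le fun k hk => by
        refine le_trans ?_ (hN k hk)
        gcongr
      rwa [hx0, zero_sub, norm_neg] at this
    -- For large N the map x ↦ g_N(x) is a bijection from the zeros in the disc to the roots of the
    -- truncation in the disc, with 0 going to 0. Surjectivity uses the true zeros found near each
    -- root.
    have hprod : ∏ x ∈ V.erase 0, (1 - z / g N x) =
        ∏ y ∈ (R.erase 0).filter (‖·‖ < r), (1 - z / y) := by
      refine Finset.prod_bij (fun x _ => g N x) ?_ ?_ ?_ (fun _ _ => rfl)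
      · intro x hx
        obtain ⟨hx0, hx⟩ := Finset.mem_erase.mp hx
        have h1 := hgV x hx
        refine Finset.mem_filter.mpr ⟨Finset.mem_erase.mpr ⟨fun h => ?_, (hmem _).mpr (hg₁ N x)⟩, ?_⟩
        · refine hx0 (hsep x hx 0 h0V ?_)
          rw [h] at h1
          exact h1.trans_lt hηρ
        · rw [← sub_sub_cancel x (g N x)]
          exact (norm_sub_le_max' _ _).trans_lt (max_lt ((hV x).mp hx).1 (h1.trans_lt hηr))
      · intro x hx y hy hxy
        have hx := Finset.mem_of_mem_erase hx
        have hy := Finset.mem_of_mem_erase hy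
        refine hsep x hx y hy ?_
        rw [show x - y = (x - g N x) - (y - g N y) by rw [hxy]; ring]
        exact (norm_sub_le_max' _ _).trans_lt
          (max_lt ((hgV x hx).trans_lt hηρ) ((hgV y hy).trans_lt hηρ))
      · intro y hy
        obtain ⟨hy, hyr⟩ := Finset.mem_filter.mp hy
        obtain ⟨hy0, hy⟩ := Finset.mem_erase.mp hy
        obtain ⟨x, hx, hxy, hxr⟩ :=
          hf.exists_zero_norm_sub_le h0 hs hη0.le hηr hN hyr ((hmem y).mp hy)
        have hxV : x ∈ V := (hV x).mpr ⟨hxr, hx⟩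
        have hgy : g N x = y := by
          refine hsepN N _ _ (hg₁ N x) ((hmem y).mp hy) ?_
          rw [show g N x - y = (x - y) - (x - g N x) by ring]
          exact (norm_sub_le_max' _ _).trans_lt
            (max_lt (hxy.trans_lt hηρ) ((hgV x hxV).trans_lt hηρ))
        refine ⟨x, Finset.mem_erase.mpr ⟨?_, hxV⟩, hgy⟩
        rintro rfl
        exact hy0 (hgy.symm.trans (hg0 N))
    -- The remaining roots have norm at least r, so their factors lie within |z|/r of 1, and so does
    -- their product.
    have hsplit : (linPoly F f N).eval z =
        Q N * ∏ y ∈ (R.erase 0).filter (¬ ‖·‖ < r), (1 - z / y) := by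
      rw [hp, eval_rootPoly, hQ]
      simp only
      rw [hprod, mul_assoc, Finset.prod_filter_mul_prod_filter_not]
    rw [hsplit, ← mul_sub_one, norm_mul]
    refine mul_le_mul_of_nonneg_left (norm_prod_sub_one_le (by positivity)
      ((div_le_one hr).mpr hz.le) fun y hy => ?_) (norm_nonneg _)
    have hyr := not_lt.mp (Finset.mem_filter.mp hy).2
    rw [sub_sub_cancel_left, norm_neg, norm_div]
    gcongr
  have hQlim : Tendsto Q atTop (𝓝 ((rootPoly V).eval z)) := by
    rw [eval_rootPoly]
    refine (tendsto_finsetProd _ fun x hx => ?_).const_mul z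
    obtain ⟨hx0, hx⟩ := Finset.mem_erase.mp hx
    exact (tendsto_const_nhds.div (hg x hx) hx0).const_sub 1
  exact le_of_tendsto_of_tendsto ((hf.tendsto_linPoly z).sub hQlim).norm
    (hQlim.norm.mul_const _) hbound

open Classical in
/-- An entire `F`-linear function is the limit of the Weierstrass products over its zeros in
growing discs. -/
theorem IsEntire.tendsto_rootPoly {f : ℕ → L} (hf : IsEntire F f) (h0 : f 0 = 1)
    (hs : ∀ N, (linPoly F f N).Splits) {r : ℕ → ℝ} (hr : Tendsto r atTop atTop) {V : ℕ → Finset L}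
    (hV : ∀ n x, x ∈ V n ↔ ‖x‖ < r n ∧ frobSum F f x = 0) (z : L) :
    Tendsto (fun n => (rootPoly (V n)).eval z) atTop (𝓝 (frobSum F f z)) := by
  rw [tendsto_iff_norm_sub_tendsto_zero]
  have hlim : Tendsto (fun n => ‖frobSum F f z‖ * (‖z‖ / r n)) atTop (𝓝 0) := by
    simpa using (hr.const_div_atTop ‖z‖).const_mul ‖frobSum F f z‖
  refine squeeze_zero' (Eventually.of_forall fun _ => norm_nonneg _) ?_ hlim
  filter_upwards [hr.eventually_gt_atTop 0, hr.eventually_gt_atTop ‖z‖] with n hn hzn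
  have h1 := hf.norm_frobSum_sub_rootPoly_le h0 hs hn (hV n) hzn
  -- A relative error below 1 preserves the norm, so the error bound can be expressed through the
  -- fixed number ‖f(z)‖.
  have h2 : ‖frobSum F f z‖ = ‖(rootPoly (V n)).eval z‖ := by
    by_cases h : (rootPoly (V n)).eval z = 0
    · rw [h, norm_zero, zero_mul, sub_zero] at h1
      rw [h, norm_zero]
      exact le_antisymm h1 (norm_nonneg _)
    · refine norm_eq_of_norm_sub_lt (h1.trans_lt ?_)
      exact mul_lt_of_lt_one_right (norm_pos_iff.mpr h) ((div_lt_one hn).mpr hzn)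
  rw [← norm_neg, neg_sub, h2]
  exact h1

end Complete

/-- The coefficients of an entire function `∑ f_k z ^ (q ^ k)` are determined by its values. -/
theorem eq_zero_of_hasSum_zero {f : ℕ → L} (hL : ∀ ε : ℝ, 0 < ε → ∃ z : L, z ≠ 0 ∧ ‖z‖ < ε)
    (h : ∀ z : L, HasSum (fun k => f k * z ^ Fintype.card F ^ k) 0) : f = 0 := by
  have h1 : Tendsto (fun k => ‖f k‖) atTop (𝓝 0) := by
    have := (h 1).summable.tendsto_atTop_zero
    simpa using this.norm
  obtain ⟨C, hC⟩ := h1.bddAbove_range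
  have hC' : ∀ k, ‖f k‖ ≤ C := fun k => hC ⟨k, rfl⟩
  have hC0 : 0 ≤ C := (norm_nonneg _).trans (hC' 0)
  funext n
  induction n using Nat.strong_induction_on with
  | _ n ih =>
    by_contra hn
    have hnpos : 0 < ‖f n‖ := norm_pos_iff.mpr hn
    -- For z this small the first nonzero term strictly exceeds all later ones, whose exponents are
    -- at least q^n + 1, so the sum cannot vanish.
    obtain ⟨z, hz0, hz⟩ := hL (min 1 (‖f n‖ / (C + 1))) (by positivity)
    have hzpos := norm_pos_iff.mpr hz0
    have hz1 : ‖z‖ ≤ 1 := (hz.trans_le (min_le_left _ _)).le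
    have hz2 : C * ‖z‖ < ‖f n‖ := by
      have := (lt_div_iff₀ (by positivity)).mp (hz.trans_le (min_le_right _ _))
      nlinarith
    set q := Fintype.card F with hq
    have hqn : ∀ k, n < k → q ^ n + 1 ≤ q ^ k := fun k hk =>
      Nat.pow_lt_pow_right Fintype.one_lt_card hk
    have hsum : HasSum (fun k => f (k + (n + 1)) * z ^ q ^ (k + (n + 1))) (-(f n * z ^ q ^ n)) := by
      rw [hasSum_nat_add_iff (f := fun k => f k * z ^ q ^ k), Finset.sum_range_succ,
        Finset.sum_eq_zero fun k hk => by
          rw [ih k (Finset.mem_range.mp hk), Pi.zero_apply, zero_mul]]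
      simpa using h z
    have hle : ‖f n * z ^ q ^ n‖ ≤ C * ‖z‖ * ‖z‖ ^ q ^ n := by
      rw [← norm_neg]
      refine le_of_tendsto hsum.tendsto_sum_nat.norm (Eventually.of_forall fun N => ?_)
      refine IsUltrametricDist.norm_sum_le_of_forall_le_of_nonneg (by positivity) fun k _ => ?_
      rw [norm_mul, norm_pow, mul_assoc, ← pow_succ']
      exact mul_le_mul (hC' _) (pow_le_pow_of_le_one (norm_nonneg _) hz1 (hqn _ (by omega)))
        (by positivity) hC0
    rw [norm_mul, norm_pow] at hle
    exact absurd (le_of_mul_le_mul_right hle (by positivity)) (not_le.mpr hz2)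

end FunctionFieldMZV

/-! ### Uniform estimates and the limit d → ∞: the function exp_A. -/

namespace FunctionFieldMZV

namespace RationalPlace

open Polynomial

section Norms

variable {F K : Type*} [Field F] [Fintype F] [Field K] [Algebra F K] (P : RationalPlace F K)

instance isUltrametricDist_KBar : IsUltrametricDist P.KBar :=
  IsUltrametricDist.isUltrametricDist_of_forall_norm_add_le_max_norm fun x y =>
    isNonarchimedean_spectralNorm (K := P.KInf) (L := P.KBar) x y

instance isUltrametricDist_CInf : IsUltrametricDist P.CInf :=
  IsUltrametricDist.isUltrametricDist_of_forall_norm_add_le_max_norm fun x y => by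
    induction x, y using UniformSpace.Completion.induction_on₂ with
    | hp => exact isClosed_le (by fun_prop) (by fun_prop)
    | ih a b =>
      rw [← UniformSpace.Completion.coe_add]
      simp only [UniformSpace.Completion.norm_coe]
      exact IsUltrametricDist.norm_add_le_max a b

theorem norm_algebraMap_KBar_CInf (x : P.KBar) : ‖algebraMap P.KBar P.CInf x‖ = ‖x‖ :=
  UniformSpace.Completion.norm_coe x

theorem norm_algebraMap_KInf_CInf (x : P.KInf) : ‖algebraMap P.KInf P.CInf x‖ = ‖x‖ := by
  rw [IsScalarTower.algebraMap_apply P.KInf P.KBar P.CInf, norm_algebraMap_KBar_CInf]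
  exact spectralNorm_extends (K := P.KInf) (L := P.KBar) x

theorem norm_algebraMap_CInf (f : K) : ‖algebraMap K P.CInf f‖ = P.abs f := by
  rw [IsScalarTower.algebraMap_apply K P.KInf P.CInf, norm_algebraMap_KInf_CInf,
    norm_algebraMap_KInf]

theorem continuous_algebraMap_KInf_CInf : Continuous (algebraMap P.KInf P.CInf) :=
  (AddMonoidHomClass.isometry_of_norm (algebraMap P.KInf P.CInf)
    P.norm_algebraMap_KInf_CInf).continuous

theorem exists_v_eq_exp {f : K} (hf : f ≠ 0) : ∃ n : ℤ, P.v f = WithZero.exp n := by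
  have h0 : P.v f ≠ 0 := (Valuation.ne_zero_iff _).mpr hf
  generalize P.v f = x at h0
  induction x using WithZero.expRecOn with
  | zero => exact absurd rfl h0
  | exp n => exact ⟨n, rfl⟩

theorem abs_lt_pow_iff {f : K} {d : ℕ} :
    P.abs f < (Fintype.card F : ℝ) ^ d ↔ P.v f < WithZero.exp (d : ℤ) := by
  by_cases hf : f = 0
  · subst hf
    simp only [map_zero]
    have : (0 : ℝ) < Fintype.card F := zero_lt_one.trans one_lt_card_real
    exact iff_of_true (by positivity) WithZero.exp_pos
  · obtain ⟨n, hn⟩ := P.exists_v_eq_exp hf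
    rw [P.abs_eq_zpow hn, hn, WithZero.exp_lt_exp, ← zpow_natCast,
      zpow_lt_zpow_iff_right₀ one_lt_card_real]

theorem exists_norm_lt {ε : ℝ} (hε : 0 < ε) : ∃ z : P.CInf, z ≠ 0 ∧ ‖z‖ < ε := by
  obtain ⟨f, hf⟩ := P.v_surjective (WithZero.exp (-1))
  have h1 : P.abs f < 1 := by
    rw [P.abs_lt_one_iff, hf, ← WithZero.exp_zero, WithZero.exp_lt_exp]
    norm_num
  have hf0 : f ≠ 0 := by
    rintro rfl
    exact WithZero.exp_ne_zero (hf.symm.trans (map_zero _))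
  obtain ⟨n, hn⟩ := exists_pow_lt_of_lt_one hε h1
  refine ⟨algebraMap K P.CInf (f ^ n), ?_, ?_⟩
  · rw [Ne, map_eq_zero]
    exact pow_ne_zero _ hf0
  · rwa [norm_algebraMap_CInf, map_pow]

theorem map_sub_le_max_abs (f g : K) : P.abs (f - g) ≤ max (P.abs f) (P.abs g) := by
  rw [sub_eq_add_neg, ← P.abs.map_neg g]
  exact P.abs_add_le_max _ _

end Norms

variable {F K : Type*} [Field F] [Fintype F] [Field K] [Algebra F K] (P : RationalPlace F K)
variable (hK : IsCurveFunctionField F K) {π : P.KInf} (hπ : ‖π‖ = (Fintype.card F : ℝ)⁻¹)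

include hK in
theorem finrank_lattice_zero : Module.finrank F (P.lattice 0) = 0 := by
  rw [P.lattice_zero hK, finrank_bot]

-- Evaluating e_{d+1} = e_d - S_d(q-1) e_d^q at its root `m` gives S_d(q-1) = e_d(m)^{-(q-1)}. A
-- lower bound for e_d(m) thus bounds the power sum from above.
open Classical in
include hπ in
theorem powerSum_mul_eval_rootPoly {d : ℕ} {m : K} (hm : m ∈ P.A) (hd : P.HasDegree m d) :
    (rootPoly (P.latticeFinset hK d)).eval m ≠ 0 ∧
    P.powerSum π d (Fintype.card F - 1) *
      (rootPoly (P.latticeFinset hK d)).eval m ^ (Fintype.card F - 1) = 1 := by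
  have hne : (rootPoly (P.latticeFinset hK d)).eval m ≠ 0 := by
    rw [eval_rootPoly]
    refine mul_ne_zero (P.ne_zero_of_hasDegree hd) (Finset.prod_ne_zero_iff.mpr fun a ha => ?_)
    rw [sub_ne_zero, Ne, eq_comm, div_eq_one_iff_eq (Finset.ne_of_mem_erase ha)]
    rintro rfl
    have := (P.mem_latticeFinset hK).mp (Finset.mem_of_mem_erase ha)
    exact absurd hd this.2.ne
  refine ⟨hne, ?_⟩
  obtain ⟨hv, h1⟩ := P.linPoly_zetaCoeff hK hπ d
  obtain ⟨-, h2⟩ := P.linPoly_zetaCoeff hK hπ (d + 1)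
  rw [P.finrank_lattice_succ_of_hasDegree hK hm hd] at h2
  have h3 := eval_linPoly_succ (F := F) (e := P.zetaCoeff π (d + 1)) (hv _ (Nat.lt_succ_self _))
    (by rw [zetaCoeff_zero_right, zetaCoeff_zero_right]) (fun k => P.zetaCoeff_succ hK π d k) m
  have hm0 := P.ne_zero_of_hasDegree hd
  rw [h2, h1, eval_rootPoly (P.latticeFinset hK (d + 1)), Finset.prod_eq_zero (i := m)
    (Finset.mem_erase.mpr ⟨hm0, (P.mem_latticeFinset hK).mpr
      (P.mem_lattice_succ.mpr ⟨hm, le_of_eq hd⟩)⟩)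
    (by rw [div_self hm0, sub_self]), mul_zero, ← Nat.sub_add_cancel (Fintype.card_pos (α := F)),
    pow_succ, ← mul_assoc] at h3
  have h4 : (rootPoly (P.latticeFinset hK d)).eval m * (1 - P.powerSum π d (Fintype.card F - 1) *
      (rootPoly (P.latticeFinset hK d)).eval m ^ (Fintype.card F - 1)) = 0 := by
    rw [Nat.add_sub_cancel] at h3
    linear_combination -h3
  exact (sub_eq_zero.mp ((mul_eq_zero.mp h4).resolve_left hne)).symm

-- For a in A_{<d} one has |1 - m/a| = |m|/|a| ≥ q, and there are q^{dim A_{<d}} - 1 such factors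
-- besides |m| = q^d.
open Classical in
theorem le_abs_eval_rootPoly {d : ℕ} {m : K} (hd : P.HasDegree m d) :
    (Fintype.card F : ℝ) ^ (d + (Fintype.card F ^ Module.finrank F (P.lattice d) - 1)) ≤
      P.abs ((rootPoly (P.latticeFinset hK d)).eval m) := by
  have hq := one_lt_card_real (F := F)
  have hmd : P.abs m = (Fintype.card F : ℝ) ^ d := by rw [P.abs_eq_zpow hd, zpow_natCast]
  rw [eval_rootPoly, map_mul, map_prod, hmd, pow_add, ← P.card_latticeFinset hK d,
    ← Finset.card_erase_of_mem (P.zero_mem_latticeFinset hK d)]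
  refine mul_le_mul_of_nonneg_left ?_ (by positivity)
  rw [← Finset.prod_const]
  refine Finset.prod_le_prod (fun _ _ => by positivity) fun a ha => ?_
  obtain ⟨ha0, ha⟩ := Finset.mem_erase.mp ha
  have hav := ((P.mem_latticeFinset hK).mp ha).2
  obtain ⟨n, hn⟩ := P.exists_v_eq_exp ha0
  rw [hn, WithZero.exp_lt_exp] at hav
  have habs := P.abs_eq_zpow hn
  have hlt : P.abs a < P.abs m := by
    rw [habs, hmd, ← zpow_natCast]
    exact zpow_lt_zpow_right₀ hq hav
  have hle : P.abs m ≤ P.abs (a - m) := by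
    by_contra! h
    have h1 := P.map_sub_le_max_abs a (a - m)
    rw [sub_sub_cancel] at h1
    exact absurd h1 (not_le.mpr (max_lt hlt h))
  rw [← div_self ha0, ← sub_div, map_div₀, habs, le_div_iff₀ (by positivity)]
  refine le_trans ?_ hle
  rw [hmd, ← zpow_natCast, ← zpow_one_add₀ (by positivity)]
  exact zpow_le_zpow_right₀ hq.le (by omega)

include hK hπ in
theorem abs_powerSum_le (d : ℕ) : P.abs (P.powerSum π d (Fintype.card F - 1)) ≤
    ((Fintype.card F : ℝ) ^ (d + (Fintype.card F ^ Module.finrank F (P.lattice d) - 1)))⁻¹ := by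
  classical
  have hq := one_lt_card_real (F := F)
  by_cases h : ∀ m ∈ P.A, ¬ P.HasDegree m d
  · rw [P.powerSum_eq_sum hK, Finset.sum_eq_zero fun a ha => by
      have ha' := (Set.Finite.mem_toFinset _).mp ha
      exact absurd ha'.2.1 (h a ha'.1), map_zero]
    positivity
  · push Not at h
    obtain ⟨m, hm, hd⟩ := h
    obtain ⟨-, h1⟩ := P.powerSum_mul_eval_rootPoly hK hπ hm hd
    have h2 := P.le_abs_eval_rootPoly hK hd
    have h3 := congrArg P.abs h1
    rw [map_mul, map_one, map_pow] at h3
    set E := P.abs ((rootPoly (P.latticeFinset hK d)).eval m)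
    have hE1 : 1 ≤ E := (one_le_pow₀ hq.le).trans h2
    have h4 : E ≤ E ^ (Fintype.card F - 1) := le_self_pow₀ hE1 (by
      have := Fintype.one_lt_card (α := F); omega)
    have hE0 : 0 < E := zero_lt_one.trans_le hE1
    rw [eq_inv_of_mul_eq_one_left h3]
    exact inv_anti₀ (by positivity) (h2.trans h4)

-- The bound is uniform in `d` and decays fast enough to dominate the exponential series at every
-- radius. The recursion in `d` preserves it, since norms of differences are bounded by maxima.
include hK hπ in
theorem abs_zetaCoeff_le (k d : ℕ) : P.abs (P.zetaCoeff π d (k + 1)) ≤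
    ((Fintype.card F : ℝ) ^ (k * Fintype.card F ^ k))⁻¹ := by
  have hq := one_lt_card_real (F := F)
  have hq0 : (0 : ℝ) < Fintype.card F := zero_lt_one.trans hq
  induction k generalizing d with
  | zero =>
    rw [zero_mul, pow_zero, inv_one]
    induction d with
    | zero => rw [zetaCoeff_zero_left, map_zero]; exact zero_le_one
    | succ d ih =>
      rw [zero_add, P.zetaCoeff_succ hK, zetaCoeff_zero_right, one_pow, mul_one]
      refine (P.map_sub_le_max_abs _ _).trans (max_le ih ((P.abs_powerSum_le hK hπ d).trans ?_))
      exact inv_le_one_of_one_le₀ (one_le_pow₀ hq.le)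
  | succ k ihk =>
    induction d with
    | zero => rw [zetaCoeff_zero_left, map_zero]; positivity
    | succ d ih =>
      rw [P.zetaCoeff_succ hK]
      refine (P.map_sub_le_max_abs _ _).trans (max_le ih ?_)
      rw [map_mul, map_pow]
      -- If dim A_{<d} ≤ k, the previous coefficient is already zero. Otherwise d ≥ 1 absorbs the -1
      -- in the power sum exponent, leaving q^{k+1}, and q^{k+1} + q · k q^k = (k+1) q^{k+1}.
      by_cases hN : Module.finrank F (P.lattice d) < k + 1
      · rw [(P.linPoly_zetaCoeff hK hπ d).1 _ hN, map_zero, zero_pow Fintype.card_ne_zero, mul_zero]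
        positivity
      · have hd : d ≠ 0 := by
          rintro rfl
          rw [P.finrank_lattice_zero hK] at hN
          omega
        have h1 : P.abs (P.powerSum π d (Fintype.card F - 1)) ≤
            ((Fintype.card F : ℝ) ^ (Fintype.card F ^ (k + 1)))⁻¹ := by
          refine (P.abs_powerSum_le hK hπ d).trans (inv_anti₀ (by positivity)
            (pow_le_pow_right₀ hq.le ?_))
          have h3 : Fintype.card F ^ (k + 1) ≤ Fintype.card F ^ Module.finrank F (P.lattice d) :=
            Nat.pow_le_pow_right Fintype.card_pos (not_lt.mp hN)
          omega
        refine (mul_le_mul h1 (pow_le_pow_left₀ (P.abs.nonneg _) (ihk d) _) (by positivity)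
          (by positivity)).trans (le_of_eq ?_)
        rw [inv_pow, ← pow_mul, ← mul_inv, ← pow_add]
        congr 2
        ring

-- Consecutive values differ by S_d(q-1) times a factor of norm at most 1, so by at most q^{-d}. In
-- an ultrametric space this already gives a Cauchy sequence.
include hK hπ in
theorem tendsto_zetaCoeff (k : ℕ) :
    ∃ x, Tendsto (fun d => algebraMap K P.KInf (P.zetaCoeff π d k)) atTop (𝓝 x) := by
  have hq := one_lt_card_real (F := F)
  cases k with
  | zero => exact ⟨1, by simp [zetaCoeff_zero_right]⟩
  | succ k =>
    refine cauchySeq_tendsto_of_complete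
      (NonarchimedeanAddGroup.cauchySeq_of_tendsto_sub_nhds_zero ?_)
    have hlim : Tendsto (fun d : ℕ => ((Fintype.card F : ℝ)⁻¹) ^ d) atTop (𝓝 0) :=
      tendsto_pow_atTop_nhds_zero_of_lt_one (by positivity) (inv_lt_one_of_one_lt₀ hq)
    refine squeeze_zero_norm (fun d => ?_) hlim
    rw [← map_sub, norm_algebraMap_KInf, P.zetaCoeff_succ hK, sub_sub_cancel_left, P.abs.map_neg,
      map_mul, map_pow]
    have h1 : P.abs (P.zetaCoeff π d k) ≤ 1 := by
      cases k with
      | zero => rw [zetaCoeff_zero_right, map_one]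
      | succ k =>
        exact (P.abs_zetaCoeff_le hK hπ k d).trans (inv_le_one_of_one_le₀ (one_le_pow₀ hq.le))
    refine (mul_le_of_le_one_right (P.abs.nonneg _) (pow_le_one₀ (P.abs.nonneg _) h1)).trans ?_
    refine (P.abs_powerSum_le hK hπ d).trans ?_
    rw [inv_pow]
    exact inv_anti₀ (by positivity) (pow_le_pow_right₀ hq.le (by omega))

include hK hπ in
theorem tendsto_zeta (k : ℕ) :
    Tendsto (fun d => algebraMap K P.KInf (P.powerSumLT π (zagierTuple F k) d)) atTop
      (𝓝 (P.zeta π (zagierTuple F k))) := by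
  refine tendsto_nhds_limUnder ?_
  obtain ⟨x, hx⟩ := P.tendsto_zetaCoeff hK hπ k
  refine ⟨(-1) ^ k * x, (hx.const_mul ((-1) ^ k)).congr fun d => ?_⟩
  rw [zetaCoeff, map_mul, map_pow, map_neg, map_one, ← mul_assoc, ← mul_pow, neg_one_mul, neg_neg,
    one_pow, one_mul]

include hK hπ in
theorem tendsto_zetaCoeff_zetaSeries (k : ℕ) :
    Tendsto (fun d => algebraMap K P.KInf (P.zetaCoeff π d k)) atTop
      (𝓝 ((P.zetaSeries π).coeff k)) := by
  refine ((P.tendsto_zeta hK hπ k).const_mul ((-1) ^ k)).congr fun d => ?_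
  rw [zetaCoeff, map_mul, map_pow, map_neg, map_one]

variable (F) in
/-- The majorant of the terms of the exponential series of the lattice `A` at the points of
absolute value `R`. -/
def expBound (R : ℝ) : ℕ → ℝ
  | 0 => R
  | k + 1 => ((Fintype.card F : ℝ) ^ (k * Fintype.card F ^ k))⁻¹ * R ^ Fintype.card F ^ (k + 1)

theorem summable_expBound {R : ℝ} (hR : 0 ≤ R) : Summable (expBound F R) := by
  have hq := one_lt_card_real (F := F)
  have hq0 : (0 : ℝ) < Fintype.card F := zero_lt_one.trans hq
  rw [← summable_nat_add_iff 1]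
  obtain ⟨M, hM⟩ := pow_unbounded_of_one_lt R hq
  have hgeom : Summable fun k : ℕ => ((Fintype.card F : ℝ)⁻¹) ^ k :=
    summable_geometric_of_lt_one (by positivity) (inv_lt_one_of_one_lt₀ hq)
  refine Summable.of_norm_bounded_eventually_nat hgeom
    ((eventually_ge_atTop (M * Fintype.card F + 1)).mono fun k hk => ?_)
  rw [expBound, Real.norm_of_nonneg (by positivity), inv_pow, ← div_eq_inv_mul,
    div_le_iff₀ (by positivity), ← div_eq_inv_mul, le_div_iff₀ (by positivity)]
  calc R ^ Fintype.card F ^ (k + 1) * (Fintype.card F : ℝ) ^ k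
      ≤ ((Fintype.card F : ℝ) ^ M) ^ Fintype.card F ^ (k + 1) *
          (Fintype.card F : ℝ) ^ Fintype.card F ^ k := by
        gcongr
        · exact hq.le
        · exact (Nat.lt_pow_self Fintype.one_lt_card).le
    _ = (Fintype.card F : ℝ) ^ ((M * Fintype.card F + 1) * Fintype.card F ^ k) := by
        rw [← pow_mul, ← pow_add]
        congr 1
        ring
    _ ≤ (Fintype.card F : ℝ) ^ (k * Fintype.card F ^ k) := by
        refine pow_le_pow_right₀ hq.le (Nat.mul_le_mul_right _ hk)

include hK hπ in
theorem abs_zetaCoeff_mul_le (d k : ℕ) {R : ℝ} (hR : 0 ≤ R) :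
    P.abs (P.zetaCoeff π d k) * R ^ Fintype.card F ^ k ≤ expBound F R k := by
  cases k with
  | zero => simp [expBound, zetaCoeff_zero_right]
  | succ k =>
    exact mul_le_mul_of_nonneg_right (P.abs_zetaCoeff_le hK hπ k d) (by positivity)

include hK hπ in
theorem isEntire_zetaSeries :
    IsEntire F fun k => algebraMap P.KInf P.CInf ((P.zetaSeries π).coeff k) := by
  intro R hR
  refine squeeze_zero (fun k => by positivity) (fun k => ?_)
    (summable_expBound (F := F) hR).tendsto_atTop_zero
  rw [norm_algebraMap_KInf_CInf]
  refine le_of_tendsto ((P.tendsto_zetaCoeff_zetaSeries hK hπ k).norm.mul_const _)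
    (Eventually.of_forall fun d => ?_)
  rw [norm_algebraMap_KInf]
  exact P.abs_zetaCoeff_mul_le hK hπ d k hR

/-- The elements of `A` of degree less than `d`, as elements of `ℂ_∞`. -/
def latticeImage (d : ℕ) : Finset P.CInf :=
  (P.latticeFinset hK d).map ⟨algebraMap K P.CInf, (algebraMap K P.CInf).injective⟩

open Classical in
theorem eval_rootPoly_latticeImage (d : ℕ) (z : P.CInf) :
    (rootPoly (P.latticeImage hK d)).eval z =
      z * ∏ a ∈ (P.latticeFinset hK d).erase 0, (1 - z / algebraMap K P.CInf a) := by
  rw [eval_rootPoly, latticeImage]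
  congr 1
  have h : ((P.latticeFinset hK d).map
      ⟨algebraMap K P.CInf, (algebraMap K P.CInf).injective⟩).erase 0 =
      ((P.latticeFinset hK d).erase 0).map
        ⟨algebraMap K P.CInf, (algebraMap K P.CInf).injective⟩ := by
    rw [Finset.map_erase, Function.Embedding.coeFn_mk, map_zero]
  rw [h, Finset.prod_map]
  rfl

-- Dominated convergence applied to the coefficients of e_d, with majorant `expBound`.
open Classical in
include hπ in
theorem tendsto_rootPoly_latticeImage (z : P.CInf) :
    Tendsto (fun d => (rootPoly (P.latticeImage hK d)).eval z) atTop
      (𝓝 (frobSum F (fun k => algebraMap P.KInf P.CInf ((P.zetaSeries π).coeff k)) z)) := by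
  have heq : ∀ d, (rootPoly (P.latticeImage hK d)).eval z =
      ∑' k, algebraMap K P.CInf (P.zetaCoeff π d k) * z ^ Fintype.card F ^ k := by
    intro d
    obtain ⟨hv, h⟩ := P.linPoly_zetaCoeff hK hπ d
    have h1 := congrArg (eval₂ (algebraMap K P.CInf) z) h
    rw [eval_rootPoly_latticeImage, tsum_eq_sum (s := Finset.range
      (Module.finrank F (P.lattice d) + 1)) fun k hk => by
        rw [hv k (by simpa using hk), map_zero, zero_mul]]
    rw [linPoly, eval₂_finsetSum, rootPoly, eval₂_mul, eval₂_X, eval₂_finsetProd] at h1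
    simp only [eval₂_mul, eval₂_C, eval₂_pow, eval₂_X, eval₂_sub, eval₂_one, map_inv₀] at h1
    rw [h1]
    simp only [div_eq_inv_mul]
  simp only [heq]
  refine tendsto_tsum_of_dominated_convergence (summable_expBound (F := F) (norm_nonneg z))
    (fun k => ?_) (Eventually.of_forall fun d k => ?_)
  · refine Tendsto.mul_const _ ?_
    simp only [IsScalarTower.algebraMap_apply K P.KInf P.CInf]
    exact (P.continuous_algebraMap_KInf_CInf.tendsto _).comp
      (P.tendsto_zetaCoeff_zetaSeries hK hπ k)
  · rw [norm_mul, norm_pow, norm_algebraMap_CInf]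
    exact P.abs_zetaCoeff_mul_le hK hπ d k (norm_nonneg z)

include hK hπ in
/-- The product of `exp_A` converges, and `exp_A` is given by the series with the multiple zeta
values as coefficients. -/
theorem multipliable_and_expA_eq (z : P.CInf) :
    Multipliable (fun a : {a : P.A // a ≠ 0} => 1 - z / algebraMap K P.CInf (a : P.A)) ∧
      P.expA z = frobSum F (fun k => algebraMap P.KInf P.CInf ((P.zetaSeries π).coeff k)) z := by
  classical
  set w := frobSum F (fun k => algebraMap P.KInf P.CInf ((P.zetaSeries π).coeff k)) z with hw
  have hq := one_lt_card_real (F := F)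
  have hq0 : (0 : ℝ) < Fintype.card F := zero_lt_one.trans hq
  have hinj : Function.Injective fun a : {a : P.A // a ≠ 0} => ((a : P.A) : K) :=
    Subtype.val_injective.comp Subtype.val_injective
  let s : ℕ → Finset {a : P.A // a ≠ 0} := fun d =>
    ((P.latticeFinset hK d).erase 0).preimage _ hinj.injOn
  have hs : ∀ d, ∏ a ∈ s d, (1 - z / algebraMap K P.CInf (a : P.A)) =
      ∏ a ∈ (P.latticeFinset hK d).erase 0, (1 - z / algebraMap K P.CInf a) := fun d => by
    refine Finset.prod_preimage _ _ hinj.injOn (fun a => 1 - z / algebraMap K P.CInf a)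
      fun a ha hna => absurd ?_ hna
    obtain ⟨ha0, ha⟩ := Finset.mem_erase.mp ha
    have hA := ((P.mem_latticeFinset hK).mp ha).1
    exact ⟨⟨⟨a, hA⟩, fun h => ha0 (congrArg Subtype.val h)⟩, rfl⟩
  have hr : Tendsto (fun d : ℕ => ‖z‖ / (Fintype.card F : ℝ) ^ d) atTop (𝓝 0) :=
    (tendsto_pow_atTop_atTop_of_one_lt hq).const_div_atTop _
  have hf : ∀ d, ∀ a ∉ s d, ‖1 - z / algebraMap K P.CInf ((a : P.A) : K) - 1‖ ≤
      ‖z‖ / (Fintype.card F : ℝ) ^ d := by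
    intro d a ha
    have ha0 : ((a : P.A) : K) ≠ 0 := fun h => a.2 (Subtype.ext h)
    have hle : (Fintype.card F : ℝ) ^ d ≤ P.abs ((a : P.A) : K) := by
      by_contra! h
      refine ha (Finset.mem_preimage.mpr (Finset.mem_erase.mpr ⟨ha0, ?_⟩))
      exact (P.mem_latticeFinset hK).mpr ⟨(a : P.A).2, P.abs_lt_pow_iff.mp h⟩
    rw [sub_sub_cancel_left, norm_neg, norm_div, norm_algebraMap_CInf]
    gcongr
  have hlim := P.tendsto_rootPoly_latticeImage hK hπ z
  simp only [eval_rootPoly_latticeImage, ← hs] at hlim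
  -- The limit is known for z times the product, so the product itself is recovered by dividing by
  -- z.
  by_cases hz : z = 0
  · have hone : (fun a : {a : P.A // a ≠ 0} => 1 - z / algebraMap K P.CInf ((a : P.A) : K)) =
        fun _ => 1 := by
      funext a
      rw [hz, zero_div, sub_zero]
    refine ⟨hone ▸ multipliable_one, ?_⟩
    have h0 := tendsto_nhds_unique hlim (by simp only [hz, zero_mul]; exact tendsto_const_nhds)
    rw [expA, hw, h0, hz, zero_mul]
  · have hlim' : Tendsto (fun d => ∏ a ∈ s d, (1 - z / algebraMap K P.CInf ((a : P.A) : K))) atTop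
        (𝓝 (z⁻¹ * w)) := by
      refine (hlim.const_mul z⁻¹).congr fun d => ?_
      rw [← mul_assoc, inv_mul_cancel₀ hz, one_mul]
    have hprod := hasProd_of_tendsto_prod hr hf hlim'
    refine ⟨hprod.multipliable, ?_⟩
    rw [expA, hprod.tprod_eq, ← mul_assoc, mul_inv_cancel₀ hz, one_mul]

include hK hπ in
theorem zetaSeries_hasValue (z : P.CInf) : (P.zetaSeries π).HasValue z (P.expA z) := by
  rw [(P.multipliable_and_expA_eq hK hπ z).2]
  exact (P.isEntire_zetaSeries hK hπ).hasSum z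

-- The zeta series witnesses the existence needed to evaluate the choice in `expASeries`.
include hK hπ in
theorem expASeries_hasValue (z : P.CInf) : P.expASeries.HasValue z (P.expA z) :=
  Classical.epsilon_spec (p := fun E : FrobSeries F P.KInf => ∀ z : P.CInf, E.HasValue z (P.expA z))
    ⟨P.zetaSeries π, P.zetaSeries_hasValue hK hπ⟩ z

include hK hπ in
theorem expASeries_eq_zetaSeries : P.expASeries = P.zetaSeries π := by
  have h := eq_zero_of_hasSum_zero (F := F) (f := fun k => algebraMap P.KInf P.CInf
    (P.expASeries.coeff k) - algebraMap P.KInf P.CInf ((P.zetaSeries π).coeff k))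
    (fun _ => P.exists_norm_lt) fun z => by
      have := (P.expASeries_hasValue hK hπ z).sub (P.zetaSeries_hasValue hK hπ z)
      rw [sub_self] at this
      simpa only [sub_mul] using this
  ext k
  exact (algebraMap P.KInf P.CInf).injective (sub_eq_zero.mp (congrFun h k))

end RationalPlace
end FunctionFieldMZV

/-! ### Functional equations and reduction of Frobenius series over a valued field. -/

namespace FunctionFieldMZV

namespace FrobSeries

section Recursion

variable {F R : Type*} [Field F] [Fintype F] [CommRing R] [Algebra F R]

theorem coeff_mul_zero (f g : FrobSeries F R) : (f * g).coeff 0 = f.coeff 0 * g.coeff 0 := by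
  simp [coeff_mul]

theorem coeff_mul_succ (f g : FrobSeries F R) (n : ℕ) :
    (f * g).coeff (n + 1) = f.coeff 0 * g.coeff (n + 1) +
      ∑ p ∈ Finset.HasAntidiagonal.antidiagonal n,
        f.coeff (p.1 + 1) * g.coeff p.2 ^ Fintype.card F ^ (p.1 + 1) := by
  rw [coeff_mul, Finset.Nat.sum_antidiagonal_succ, pow_zero, pow_one]

theorem coeff_mul_succ' (f g : FrobSeries F R) (n : ℕ) :
    (f * g).coeff (n + 1) = f.coeff (n + 1) * g.coeff 0 ^ Fintype.card F ^ (n + 1) +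
      ∑ p ∈ Finset.HasAntidiagonal.antidiagonal n,
        f.coeff p.1 * g.coeff (p.2 + 1) ^ Fintype.card F ^ p.1 := by
  rw [coeff_mul, Finset.Nat.sum_antidiagonal_succ']

theorem C_mul_C (a b : R) : (C a : FrobSeries F R) * C b = C (a * b) := by
  ext n
  rw [coeff_C_mul, coeff_C, coeff_C, mul_ite, mul_zero]

end Recursion

variable {F M : Type*} [Field F] [Fintype F] [Field M] [Algebra F M]

/-- The coefficients of the solution `E = 1 + ⋯` of `E f₀ = f E`. -/
def expCoeff (f : FrobSeries F M) : ℕ → M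
  | 0 => 1
  | n + 1 => (∑ p : {p // p ∈ Finset.HasAntidiagonal.antidiagonal n},
      f.coeff (p.1.1 + 1) * expCoeff f p.1.2 ^ Fintype.card F ^ (p.1.1 + 1)) /
        (f.coeff 0 ^ Fintype.card F ^ (n + 1) - f.coeff 0)
  decreasing_by
    have := Finset.HasAntidiagonal.mem_antidiagonal.mp p.2
    omega

theorem expCoeff_succ (f : FrobSeries F M) (n : ℕ) : expCoeff f (n + 1) =
    (∑ p ∈ Finset.HasAntidiagonal.antidiagonal n,
      f.coeff (p.1 + 1) * expCoeff f p.2 ^ Fintype.card F ^ (p.1 + 1)) /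
        (f.coeff 0 ^ Fintype.card F ^ (n + 1) - f.coeff 0) := by
  rw [expCoeff, Finset.sum_coe_sort (Finset.HasAntidiagonal.antidiagonal n)
    fun p => f.coeff (p.1 + 1) * expCoeff f p.2 ^ Fintype.card F ^ (p.1 + 1)]

theorem expCoeff_mul {f : FrobSeries F M}
    (hf : ∀ n, f.coeff 0 ^ Fintype.card F ^ (n + 1) ≠ f.coeff 0) :
    (⟨expCoeff f⟩ : FrobSeries F M) * C (f.coeff 0) = f * ⟨expCoeff f⟩ := by
  ext n
  rw [coeff_mul_C]
  cases n with
  | zero => rw [coeff_mul_zero, pow_zero, pow_one, mul_comm]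
  | succ n =>
    rw [coeff_mul_succ]
    have h := div_mul_cancel₀ (∑ p ∈ Finset.HasAntidiagonal.antidiagonal n,
      f.coeff (p.1 + 1) * expCoeff f p.2 ^ Fintype.card F ^ (p.1 + 1)) (sub_ne_zero.mpr (hf n))
    rw [← expCoeff_succ] at h
    linear_combination h

/-- A solution of `D f₀ = f D` with `D₀ = 0` vanishes. -/
theorem eq_zero_of_mul_C_eq {f D : FrobSeries F M}
    (hf : ∀ n, f.coeff 0 ^ Fintype.card F ^ (n + 1) ≠ f.coeff 0) (h0 : D.coeff 0 = 0)
    (h : D * C (f.coeff 0) = f * D) : D = 0 := by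
  ext n
  induction n using Nat.strong_induction_on with
  | _ n ih =>
    cases n with
    | zero => exact h0
    | succ n =>
      have h1 := congrArg (fun E => E.coeff (n + 1)) h
      rw [coeff_mul_C, coeff_mul_succ, Finset.sum_eq_zero fun p hp => by
        have := Finset.HasAntidiagonal.mem_antidiagonal.mp hp
        rw [ih p.2 (by omega), coeff_zero, zero_pow_card, mul_zero]] at h1
      have h2 : D.coeff (n + 1) *
          (f.coeff 0 ^ Fintype.card F ^ (n + 1) - f.coeff 0) = 0 := by
        linear_combination h1
      exact (mul_eq_zero.mp h2).resolve_right (sub_ne_zero.mpr (hf n))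

section Valuation

variable {Γ₀ : Type*} [LinearOrderedCommGroupWithZero Γ₀] (v : Valuation M Γ₀)

/-- All coefficients of `f` are integral, and those of index at least `d` reduce to zero. -/
def ReducesBelow (f : FrobSeries F M) (d : ℕ) : Prop :=
  (∀ n, v (f.coeff n) ≤ 1) ∧ ∀ n, d ≤ n → v (f.coeff n) < 1

/-- The reduction of the integral series `f` is a polynomial of degree `d`. -/
def HasReducedDegree (f : FrobSeries F M) (d : ℕ) : Prop :=
  ReducesBelow v f (d + 1) ∧ v (f.coeff d) = 1

variable {v}

theorem ReducesBelow.mono {f : FrobSeries F M} {d e : ℕ} (h : ReducesBelow v f d) (hde : d ≤ e) :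
    ReducesBelow v f e :=
  ⟨h.1, fun n hn => h.2 n (hde.trans hn)⟩

theorem ReducesBelow.add {f g : FrobSeries F M} {d : ℕ} (hf : ReducesBelow v f d)
    (hg : ReducesBelow v g d) : ReducesBelow v (f + g) d :=
  ⟨fun n => (v.map_add _ _).trans (max_le (hf.1 n) (hg.1 n)),
    fun n hn => (v.map_add _ _).trans_lt (max_lt (hf.2 n hn) (hg.2 n hn))⟩

theorem ReducesBelow.neg {f : FrobSeries F M} {d : ℕ} (hf : ReducesBelow v f d) :
    ReducesBelow v (-f) d :=
  ⟨fun n => by rw [coeff_neg, Valuation.map_neg]; exact hf.1 n,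
    fun n hn => by rw [coeff_neg, Valuation.map_neg]; exact hf.2 n hn⟩

theorem reducesBelow_C {c : M} (hc : v c ≤ 1) : ReducesBelow v (C c : FrobSeries F M) 1 := by
  refine ⟨fun n => ?_, fun n hn => ?_⟩
  · rw [coeff_C]
    split_ifs
    · exact hc
    · simp
  · rw [coeff_C, if_neg (by omega), map_zero]
    exact zero_lt_one

theorem ReducesBelow.mul {f g : FrobSeries F M} {d e : ℕ} (hf : ReducesBelow v f (d + 1))
    (hg : ReducesBelow v g e) : ReducesBelow v (f * g) (d + e) := by
  have hle : ∀ i j, v (f.coeff i * g.coeff j ^ Fintype.card F ^ i) ≤ 1 := fun i j => by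
    rw [map_mul, map_pow]
    exact mul_le_one' (hf.1 i) (pow_le_one' (hg.1 j) _)
  refine ⟨fun n => ?_, fun n hn => ?_⟩
  · rw [coeff_mul]
    exact v.map_sum_le fun p _ => hle _ _
  · rw [coeff_mul]
    refine v.map_sum_lt one_ne_zero fun p hp => ?_
    have hp' := Finset.HasAntidiagonal.mem_antidiagonal.mp hp
    rw [map_mul, map_pow]
    by_cases h : d + 1 ≤ p.1
    · exact mul_lt_one_of_nonneg_of_lt_one_left zero_le (hf.2 _ h) (pow_le_one' (hg.1 _) _)
    · exact mul_lt_one_of_nonneg_of_lt_one_right (hf.1 _) zero_le (pow_lt_one₀ zero_le (hg.2 _ (by omega))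
        (pow_ne_zero _ Fintype.card_ne_zero))

theorem HasReducedDegree.mul {f g : FrobSeries F M} {d e : ℕ} (hf : HasReducedDegree v f d)
    (hg : HasReducedDegree v g e) : HasReducedDegree v (f * g) (d + e) := by
  refine ⟨hf.1.mul hg.1, ?_⟩
  have hmem : (d, e) ∈ Finset.HasAntidiagonal.antidiagonal (d + e) :=
    Finset.HasAntidiagonal.mem_antidiagonal.mpr rfl
  rw [coeff_mul, ← Finset.add_sum_erase _ _ hmem]
  have h1 : v (f.coeff d * g.coeff e ^ Fintype.card F ^ d) = 1 := by
    rw [map_mul, map_pow, hf.2, hg.2, one_pow, one_mul]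
  rw [Valuation.map_add_eq_of_lt_left, h1]
  rw [h1]
  refine v.map_sum_lt one_ne_zero fun p hp => ?_
  obtain ⟨hne, hp⟩ := Finset.mem_erase.mp hp
  have hp' := Finset.HasAntidiagonal.mem_antidiagonal.mp hp
  rw [map_mul, map_pow]
  by_cases h : d + 1 ≤ p.1
  · exact mul_lt_one_of_nonneg_of_lt_one_left zero_le (hf.1.2 _ h) (pow_le_one' (hg.1.1 _) _)
  · have h2 : e + 1 ≤ p.2 := by
      by_contra h3
      exact hne (Prod.ext (by simp only; omega) (by simp only; omega))
    exact mul_lt_one_of_nonneg_of_lt_one_right (hf.1.1 _) zero_le (pow_lt_one₀ zero_le (hg.1.2 _ h2)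
        (pow_ne_zero _ Fintype.card_ne_zero))

theorem hasReducedDegree_one : HasReducedDegree v (1 : FrobSeries F M) 0 :=
  ⟨reducesBelow_C (by rw [map_one]), by rw [one_def, coeff_C, if_pos rfl, map_one]⟩

theorem HasReducedDegree.pow {f : FrobSeries F M} {d : ℕ} (hf : HasReducedDegree v f d) (n : ℕ) :
    HasReducedDegree v (f ^ n) (n * d) := by
  induction n with
  | zero => simpa using hasReducedDegree_one
  | succ n ih =>
    rw [pow_succ, Nat.succ_mul]
    exact ih.mul hf

/-- An integral series whose reduction is a nonzero polynomial has a reduced degree. -/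
theorem exists_hasReducedDegree {f : FrobSeries F M} (hf : ∀ n, v (f.coeff n) ≤ 1) {i N : ℕ}
    (hi : v (f.coeff i) = 1) (hN : ∀ n, N ≤ n → v (f.coeff n) < 1) :
    ∃ d, i ≤ d ∧ d < N ∧ HasReducedDegree v f d := by
  classical
  have hiN : i ≤ N := by
    by_contra! h
    exact absurd hi (hN i h.le).ne
  set d := Nat.findGreatest (fun n => v (f.coeff n) = 1) N with hd
  have h1 : v (f.coeff d) = 1 := Nat.findGreatest_spec (P := fun n => v (f.coeff n) = 1) hiN hi
  refine ⟨d, Nat.le_findGreatest hiN hi, ?_, ⟨hf, fun n hn => ?_⟩, h1⟩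
  · by_contra! h
    exact absurd h1 (hN d h).ne
  · by_cases hnN : n ≤ N
    · exact lt_of_le_of_ne (hf n) (Nat.findGreatest_is_greatest hn hnN)
    · exact hN n (by omega)

/-- A series commuting with an integral one is integral. -/
theorem valuation_coeff_le_one_of_commute {f g : FrobSeries F M} (hfg : f * g = g * f)
    (hf : ∀ n, v (f.coeff n) ≤ 1) (hg : v (g.coeff 0) ≤ 1)
    (h : ∀ n, v (f.coeff 0 ^ Fintype.card F ^ (n + 1) - f.coeff 0) = 1) (n : ℕ) :
    v (g.coeff n) ≤ 1 := by
  induction n using Nat.strong_induction_on with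
  | _ n ih =>
    cases n with
    | zero => exact hg
    | succ n =>
      have h1 := congrArg (fun E => E.coeff (n + 1)) hfg
      rw [coeff_mul_succ, coeff_mul_succ'] at h1
      -- In coefficient n + 1 of f g = g f, the unknown g_{n+1} occurs only multiplied by
      -- f₀^{q^{n+1}} - f₀, which is a unit; all other terms are integral by induction.
      rw [← mul_one (v (g.coeff (n + 1))), ← h n, ← map_mul,
        show g.coeff (n + 1) * (f.coeff 0 ^ Fintype.card F ^ (n + 1) - f.coeff 0) =
          ∑ p ∈ Finset.HasAntidiagonal.antidiagonal n,
            f.coeff (p.1 + 1) * g.coeff p.2 ^ Fintype.card F ^ (p.1 + 1) -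
          ∑ p ∈ Finset.HasAntidiagonal.antidiagonal n,
            g.coeff p.1 * f.coeff (p.2 + 1) ^ Fintype.card F ^ p.1 by linear_combination -h1]
      refine (v.map_sub _ _).trans (max_le (v.map_sum_le fun p hp => ?_)
        (v.map_sum_le fun p hp => ?_))
      · have := Finset.HasAntidiagonal.mem_antidiagonal.mp hp
        have h2 := ih p.2 (by omega)
        rw [h n, map_mul, map_pow]
        exact mul_le_one' (hf _) (pow_le_one' h2 _)
      · have := Finset.HasAntidiagonal.mem_antidiagonal.mp hp
        have h2 := ih p.1 (by omega)
        rw [h n, map_mul, map_pow]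
        exact mul_le_one' h2 (pow_le_one' (hf _) _)

end Valuation

end FrobSeries

namespace RationalPlace

open FrobSeries

variable {F K : Type*} [Field F] [Fintype F] [Field K] [Algebra F K] (P : RationalPlace F K)

/-- The degree inequality for the reduction of a homomorphism `ψ` from `A` to series over a
valued field: by the existence of valuation rings, the reduced degree of `ψ` is proportional to
the degree on `A`, as `∞` is the only place at which elements of `A` have poles. -/
theorem reducedDegree_mul_le {M Γ₀ : Type*} [Field M] [Algebra F M]
    [LinearOrderedCommGroupWithZero Γ₀] {v : Valuation M Γ₀} (ψ : P.A →+* FrobSeries F M)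
    (hc : ∀ c : F, ReducesBelow v (ψ (algebraMap F P.A c)) 1)
    {a b : P.A} {m n d e : ℕ} (ha : P.HasDegree (a : K) m) (hb : P.HasDegree (b : K) n)
    (hd : HasReducedDegree v (ψ a) d) (he : HasReducedDegree v (ψ b) e) (hd0 : 0 < d) :
    d * n ≤ e * m := by
  by_contra! hlt
  have ha0 : (a : K) ≠ 0 := P.ne_zero_of_hasDegree ha
  have hpow : ∀ N, HasReducedDegree v (ψ (a ^ N)) (N * d) := fun N => by
    rw [map_pow]
    exact hd.pow N
  have hcast : ∀ N, ((a ^ N : P.A) : K) = (a : K) ^ N := fun _ => rfl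
  have hscale : ∀ {z : K} {N : ℕ} {u : P.A} (N' : ℕ), (a : K) ^ N * z = u →
      (a : K) ^ (N' + N) * z = (a ^ N' * u : P.A) := fun {z N u} N' h => by
    rw [pow_add, mul_assoc, h]
    rfl
  -- R consists of the quotients u / a^N with reduced degree of u at most N d, and I of those with
  -- strict inequality. I is proper because 1 = a^N / a^N has reduced degree exactly N d.
  let R : Subring K :=
    { carrier := {z | ∃ N, ∃ u : P.A, (a : K) ^ N * z = u ∧ ReducesBelow v (ψ u) (N * d + 1)}
      mul_mem' := by
        rintro x y ⟨N, u, hu, hu'⟩ ⟨N', u', hw, hw'⟩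
        refine ⟨N + N', u * u', ?_, ?_⟩
        · rw [pow_add, mul_mul_mul_comm, hu, hw]
          rfl
        · rw [map_mul, add_mul, add_assoc]
          exact hu'.mul hw'
      one_mem' := ⟨0, 1, by simp, by
        rw [map_one, zero_mul]
        exact hasReducedDegree_one.1⟩
      zero_mem' := ⟨0, 0, by simp, by
        rw [zero_mul, zero_add]
        simpa using hc 0⟩
      add_mem' := by
        rintro x y ⟨N, u, hu, hu'⟩ ⟨N', u', hw, hw'⟩
        refine ⟨N' + N, a ^ N' * u + a ^ N * u', ?_, ?_⟩
        · have h1 := hscale N' hu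
          have h2 := hscale N hw
          rw [add_comm N N'] at h2
          rw [mul_add, h1, h2]
          rfl
        · rw [map_add, map_mul, map_mul]
          refine ReducesBelow.add ?_ ?_
          · rw [add_mul, add_assoc]
            exact (hpow N').1.mul hu'
          · rw [add_comm N', add_mul, add_assoc]
            exact (hpow N).1.mul hw'
      neg_mem' := by
        rintro x ⟨N, u, hu, hu'⟩
        exact ⟨N, -u, by rw [mul_neg, hu]; rfl, by rw [map_neg]; exact hu'.neg⟩ }
  let I : Ideal R :=
    { carrier := {z | ∃ N, ∃ u : P.A, (a : K) ^ N * z = u ∧ ReducesBelow v (ψ u) (N * d)}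
      add_mem' := by
        rintro x y ⟨N, u, hu, hu'⟩ ⟨N', u', hw, hw'⟩
        refine ⟨N' + N, a ^ N' * u + a ^ N * u', ?_, ?_⟩
        · have h1 := hscale N' hu
          have h2 := hscale N hw
          rw [add_comm N N'] at h2
          rw [Subring.coe_add, mul_add, h1, h2]
          rfl
        · rw [map_add, map_mul, map_mul]
          refine ReducesBelow.add ?_ ?_
          · rw [add_mul]
            exact (hpow N').1.mul hu'
          · rw [add_comm N', add_mul]
            exact (hpow N).1.mul hw'
      zero_mem' := ⟨1, 0, by simp, by
        have := (hc 0).mono (show 1 ≤ 1 * d by omega)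
        rwa [map_zero] at this⟩
      smul_mem' := by
        rintro ⟨x, N, u, hu, hu'⟩ y ⟨N', u', hw, hw'⟩
        refine ⟨N + N', u * u', ?_, ?_⟩
        · rw [smul_eq_mul, Subring.coe_mul, pow_add, mul_mul_mul_comm, hu, hw]
          rfl
        · rw [map_mul, add_mul]
          exact hu'.mul hw' }
  have hI : I ≠ ⊤ := by
    rw [Ne, Ideal.eq_top_iff_one]
    rintro ⟨N, u, hu, hu'⟩
    have h1 : u = a ^ N := Subtype.ext (by rw [← hu]; simp)
    have h2 := hu'.2 _ le_rfl
    rw [h1] at h2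
    exact absurd (hpow N).2 h2.ne
  -- A valuation ring O dominating R at I contains F and has 1/a as a nonunit, so `a` has a pole
  -- there and O must be the place ∞. If d n > e m, then b^m / a^n lies in I, but it has degree 0
  -- and is a unit at ∞.
  obtain ⟨O, hRO, hnonunits⟩ := I.image_subset_nonunits_valuationSubring hI
  have hnon : ∀ z ∈ O.nonunits, z ≠ 0 → z⁻¹ ∉ O := fun z hz hz0 hzO => by
    have := (O.inv_mem_nonunits_iff (x := z⁻¹)).mp (by rwa [inv_inv])
    exact this.resolve_left (inv_ne_zero hz0) hzO
  have key : ∀ z : K, ∀ N, ∀ u : P.A, (a : K) ^ N * z = u → ReducesBelow v (ψ u) (N * d) →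
      z ∈ O.nonunits := fun z N u h1 h2 =>
    hnonunits ⟨⟨z, N, u, h1, h2.mono (Nat.le_succ _)⟩, ⟨N, u, h1, h2⟩, rfl⟩
  have hainv : (a : K)⁻¹ ∈ O.nonunits := by
    refine key _ 1 1 (by rw [pow_one, mul_inv_cancel₀ ha0]; rfl) ?_
    rw [map_one]
    exact hasReducedDegree_one.1.mono (by omega)
  have haO : (a : K) ∉ O := by
    have := hnon _ hainv (inv_ne_zero ha0)
    rwa [inv_inv] at this
  have hOP : O = P.v.valuationSubring := by
    by_contra hne
    refine haO (a.2 O (fun c => hRO ⟨0, algebraMap F P.A c, ?_, ?_⟩) hne)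
    · rw [pow_zero, one_mul]
      rfl
    · rw [zero_mul]
      exact hc c
  have hx : (b : K) ^ m / (a : K) ^ n ∈ O.nonunits := by
    refine key _ n (b ^ m) (by rw [mul_div_cancel₀ _ (pow_ne_zero _ ha0)]; rfl) ?_
    rw [map_pow]
    exact (he.pow m).1.mono (by rw [mul_comm m, mul_comm n]; exact hlt)
  have hb0 : (b : K) ≠ 0 := P.ne_zero_of_hasDegree hb
  refine hnon _ hx (div_ne_zero (pow_ne_zero _ hb0) (pow_ne_zero _ ha0)) ?_
  rw [hOP, Valuation.mem_valuationSubring_iff, map_inv₀, map_div₀, map_pow, map_pow,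
    show P.v (b : K) = _ from hb, show P.v (a : K) = _ from ha, ← WithZero.exp_nsmul,
    ← WithZero.exp_nsmul, show m • (n : ℤ) = n • (m : ℤ) by simp [mul_comm],
    div_self WithZero.exp_ne_zero, inv_one]

end RationalPlace
end FunctionFieldMZV

/-! ### Existence of exp_φ and algebraicity of its coefficients. -/

namespace FunctionFieldMZV

namespace RationalPlace

open FrobSeries

variable {F K : Type*} [Field F] [Fintype F] [Field K] [Algebra F K] (P : RationalPlace F K)
variable (hK : IsCurveFunctionField F K)

include hK in
theorem exists_hasDegree {a : K} (ha : a ∈ P.A) (ha0 : a ≠ 0) : ∃ d : ℕ, P.HasDegree a d := by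
  obtain ⟨n, hn⟩ := P.exists_v_eq_exp ha0
  have h0 : 0 ≤ n := by
    by_contra! h
    refine ha0 (P.eq_zero_of_v_lt_one hK ha ?_)
    rwa [hn, ← WithZero.exp_zero, WithZero.exp_lt_exp]
  lift n to ℕ using h0
  exact ⟨n, hn⟩

theorem pow_card_pow_ne {a : K} {m : ℕ} (hm : 0 < m) (ha : P.HasDegree a m) (n : ℕ) :
    a ^ Fintype.card F ^ (n + 1) - a ≠ 0 := by
  refine sub_ne_zero.mpr fun h => ?_
  have h1 := congrArg P.v h
  rw [map_pow, show P.v a = _ from ha, ← WithZero.exp_nsmul, WithZero.exp_inj] at h1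
  have h2 : Fintype.card F ^ (n + 1) * m = m := by
    rw [nsmul_eq_mul] at h1
    exact_mod_cast h1
  have h3 : 1 < Fintype.card F ^ (n + 1) :=
    Nat.one_lt_pow n.succ_ne_zero Fintype.one_lt_card
  nlinarith

variable {π : P.KInf} {φ : P.A →ₐ[F] FrobPoly F P.KBar} (hφ : P.IsSgnNormalized π φ)

include hK hφ in
theorem coeff_zero_of_isSgnNormalized (a : P.A) :
    (φ a : FrobSeries F P.KBar).coeff 0 = algebraMap K P.KBar a := by
  by_cases ha : a = 0
  · subst ha
    rw [map_zero, ZeroMemClass.coe_zero, ZeroMemClass.coe_zero, map_zero]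
    rfl
  · obtain ⟨d, hd⟩ := P.exists_hasDegree hK a.2 fun h => ha (Subtype.ext h)
    exact (hφ a d hd).1

theorem coe_map_mul (a b : P.A) : (φ (a * b) : FrobSeries F P.KBar) = φ a * φ b := by
  rw [map_mul]
  rfl

include hK hφ in
/-- The exponential of a sign-normalized Drinfeld module exists. -/
theorem isExponential_expSeries : P.IsExponential φ (P.expSeries φ) := by
  refine Classical.epsilon_spec (p := P.IsExponential φ) ?_
  obtain ⟨m, hm, ⟨a, haA, ha⟩, -⟩ := P.exists_consecutive_degrees hK
  set f := (φ ⟨a, haA⟩ : FrobSeries F P.KBar) with hf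
  have hf0 : f.coeff 0 = algebraMap K P.KBar a :=
    P.coeff_zero_of_isSgnNormalized hK hφ ⟨a, haA⟩
  have hne : ∀ n, f.coeff 0 ^ Fintype.card F ^ (n + 1) ≠ f.coeff 0 := fun n h => by
    rw [hf0, ← map_pow] at h
    exact P.pow_card_pow_ne hm ha n (sub_eq_zero.mpr ((algebraMap K P.KBar).injective h))
  set E : FrobSeries F P.KBar := ⟨expCoeff f⟩
  have hE : E * C (f.coeff 0) = f * E := expCoeff_mul hne
  refine ⟨E, by simp only [E, expCoeff], fun b => ?_⟩
  set β := algebraMap K P.KBar b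
  set g := (φ b : FrobSeries F P.KBar)
  have hg0 : g.coeff 0 = β := P.coeff_zero_of_isSgnNormalized hK hφ b
  have hfg : f * g = g * f := by
    rw [hf, ← coe_map_mul, mul_comm, coe_map_mul]
  -- The series is built from the single element `a`. For any other b, commutativity of φ_a and φ_b
  -- shows that the defect E b - φ_b E solves the same equation with zero constant term, so it
  -- vanishes.
  refine sub_eq_zero.mp (eq_zero_of_mul_C_eq (D := E * C β - g * E) hne ?_ ?_)
  · rw [sub_eq_add_neg, coeff_add, coeff_neg, coeff_mul_C, coeff_mul_zero, hg0]
    ring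
  · calc (E * C β - g * E) * C (f.coeff 0)
        = E * (C β * C (f.coeff 0)) - g * (E * C (f.coeff 0)) := by noncomm_ring
      _ = (E * C (f.coeff 0)) * C β - g * (E * C (f.coeff 0)) := by
        rw [C_mul_C, mul_comm β, ← C_mul_C, mul_assoc]
      _ = f * (E * C β - g * E) := by
        rw [hE, mul_sub, ← mul_assoc g, ← hfg]
        noncomm_ring

variable (φ) in
/-- The Drinfeld module `c⁻¹ φ c`, as a homomorphism to `K̄_∞[[τ]]`. -/
def conj (c : P.KBar) (hc : c ≠ 0) : P.A →+* FrobSeries F P.KBar where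
  toFun a := C c⁻¹ * (φ a : FrobSeries F P.KBar) * C c
  map_one' := by
    rw [map_one, OneMemClass.coe_one, mul_one, C_mul_C, inv_mul_cancel₀ hc]
    rfl
  map_mul' a b := by
    rw [coe_map_mul, mul_assoc (C c⁻¹ * _), ← mul_assoc (C c), ← mul_assoc (C c), C_mul_C,
      mul_inv_cancel₀ hc, ← one_def, one_mul]
    noncomm_ring
  map_zero' := by rw [map_zero, ZeroMemClass.coe_zero, mul_zero, zero_mul]
  map_add' a b := by
    rw [map_add]
    change C c⁻¹ * ((φ a : FrobSeries F P.KBar) + (φ b : FrobSeries F P.KBar)) * C c = _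
    rw [mul_add, add_mul]

theorem coeff_conj (c : P.KBar) (hc : c ≠ 0) (a : P.A) (n : ℕ) : (P.conj φ c hc a).coeff n =
    (φ a : FrobSeries F P.KBar).coeff n * c ^ (Fintype.card F ^ n - 1) := by
  change (C c⁻¹ * (φ a : FrobSeries F P.KBar) * C c).coeff n = _
  rw [coeff_mul_C, coeff_C_mul, ← Nat.sub_add_cancel (Nat.one_le_pow n _ Fintype.card_pos),
    pow_succ, Nat.add_sub_cancel]
  field_simp

theorem conj_algebraMap (c : P.KBar) (hc : c ≠ 0) (x : F) :
    P.conj φ c hc (algebraMap F P.A x) = C (algebraMap F P.KBar x) := by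
  change C c⁻¹ * (φ (algebraMap F P.A x) : FrobSeries F P.KBar) * C c = _
  rw [AlgHom.commutes]
  change C c⁻¹ * (C (algebraMap F P.KBar x)) * C c = _
  rw [C_mul_C, C_mul_C]
  congr 1
  field_simp

include hK hφ in
/-- The coefficients of a sign-normalized Drinfeld module of rank one are integral over `K`. -/
theorem isIntegral_coeff {a : P.A} {m : ℕ} (hm : 0 < m) (ha : P.HasDegree (a : K) m) {b : P.A}
    (hb : P.HasDegree (b : K) (m + 1)) (i : ℕ) :
    IsIntegral K ((φ a : FrobSeries F P.KBar).coeff i) := by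
  refine isIntegral_of_forall_mem_valuationSubring fun O hO => ?_
  by_contra hi
  set v := O.valuation
  have hvK : ∀ x : K, x ≠ 0 → v (algebraMap K P.KBar x) = 1 := fun x hx => by
    refine le_antisymm ((O.valuation_le_one_iff _).mpr (hO x)) ?_
    have h1 := (O.valuation_le_one_iff _).mpr (hO x⁻¹)
    rw [map_inv₀, map_inv₀] at h1
    exact (inv_le_one₀ (by simpa [zero_lt_iff] using hx)).mp h1
  have hq1 : ∀ n, n ≠ 0 → Fintype.card F ^ n - 1 ≠ 0 := fun n hn => by
    have := Nat.one_lt_pow hn (Fintype.one_lt_card (α := F))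
    omega
  obtain ⟨ha_zero, ha_top, ha_large⟩ := hφ a m ha
  -- Conjugation by c scales the n-th coefficient by c^{q^n-1}. These roots put all coefficients on
  -- one scale, and taking c⁻¹ to be a root of largest value makes all of them integral and one of
  -- them a unit.
  have hroot : ∀ n : ℕ, ∃ x : P.KBar, n ≠ 0 →
      x ^ (Fintype.card F ^ n - 1) = (φ a : FrobSeries F P.KBar).coeff n := fun n => by
    by_cases hn : n = 0
    · exact ⟨0, fun h => absurd hn h⟩
    · obtain ⟨x, hx⟩ := IsAlgClosed.exists_pow_nat_eq ((φ a : FrobSeries F P.KBar).coeff n)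
        (Nat.pos_of_ne_zero (hq1 n hn))
      exact ⟨x, fun _ => hx⟩
  choose x hx using hroot
  have hi0 : i ≠ 0 := by
    rintro rfl
    exact hi (ha_zero ▸ hO a)
  have him : i ≤ m := by
    by_contra! h
    exact hi (ha_large i h ▸ O.zero_mem)
  obtain ⟨j, hj, hjmax⟩ := (Finset.Icc 1 m).exists_max_image (fun n => v (x n))
    ⟨i, Finset.mem_Icc.mpr ⟨Nat.one_le_iff_ne_zero.mpr hi0, him⟩⟩
  obtain ⟨hj1, hjm⟩ := Finset.mem_Icc.mp hj
  have hvi : 1 < v (x i) := by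
    by_contra! h
    refine hi ((O.valuation_le_one_iff _).mp ?_)
    rw [← hx i hi0]
    change v _ ≤ 1
    rw [map_pow]
    exact pow_le_one' h _
  have hvj : 1 < v (x j) :=
    hvi.trans_le (hjmax i (Finset.mem_Icc.mpr ⟨Nat.one_le_iff_ne_zero.mpr hi0, him⟩))
  have hxj : x j ≠ 0 := by
    intro h
    rw [h, map_zero] at hvj
    exact absurd hvj (not_lt.mpr zero_le)
  have hvc : v (x j)⁻¹ < 1 := by
    rw [map_inv₀]
    exact inv_lt_one_of_one_lt₀ hvj
  set ψ := P.conj φ (x j)⁻¹ (inv_ne_zero hxj)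
  have hψ0 : ∀ u : P.A, (ψ u).coeff 0 = algebraMap K P.KBar u := fun u => by
    rw [coeff_conj, pow_zero, Nat.sub_self, pow_zero, mul_one,
      P.coeff_zero_of_isSgnNormalized hK hφ]
  have hψa : ∀ n, n ≠ 0 → (ψ a).coeff n = (x n / x j) ^ (Fintype.card F ^ n - 1) := fun n hn => by
    rw [coeff_conj, ← hx n hn, ← mul_pow, div_eq_mul_inv]
  -- The leading coefficient of φ_u is a constant, and it gets multiplied by a positive power of c,
  -- which has value less than 1. The reduction thus loses its top term.
  have hψtop : ∀ (u : P.A) (d : ℕ), 0 < d → P.HasDegree (u : K) d →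
      ∀ n, d ≤ n → v ((ψ u).coeff n) < 1 := by
    intro u d hd0 hd n hn
    obtain ⟨-, h2, h3⟩ := hφ u d hd
    rw [coeff_conj]
    rcases hn.eq_or_lt with rfl | hn
    · have h4 := (O.valuation_le_one_iff _).mpr
        (hO (algebraMap F K (P.sgn π (algebraMap K P.KInf u))))
      rw [← IsScalarTower.algebraMap_apply F K P.KBar, ← h2] at h4
      rw [map_mul, map_pow]
      exact mul_lt_one_of_nonneg_of_lt_one_right h4 zero_le
        (pow_lt_one₀ zero_le hvc (hq1 d hd0.ne'))
    · rw [h3 n hn, zero_mul, map_zero]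
      exact zero_lt_one
  have hψa_le : ∀ n, v ((ψ a).coeff n) ≤ 1 := by
    intro n
    by_cases hn : n = 0
    · rw [hn, hψ0]
      exact (O.valuation_le_one_iff _).mpr (hO a)
    by_cases hnm : n ≤ m
    · rw [hψa n hn, map_pow, map_div₀]
      refine pow_le_one' ((div_le_one₀ (zero_lt_one.trans hvj)).mpr (hjmax n ?_)) _
      exact Finset.mem_Icc.mpr ⟨Nat.one_le_iff_ne_zero.mpr hn, hnm⟩
    · exact (hψtop a m hm ha n (by omega)).le
  have hψ_le : ∀ (u : P.A) n, v ((ψ u).coeff n) ≤ 1 := fun u =>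
    valuation_coeff_le_one_of_commute (f := ψ a) (by rw [← map_mul, mul_comm, map_mul]) hψa_le
      (by rw [hψ0]; exact (O.valuation_le_one_iff _).mpr (hO u)) fun n => by
        rw [hψ0, ← map_pow, ← map_sub]
        exact hvK _ (P.pow_card_pow_ne hm ha n)
  have hc : ∀ c : F, ReducesBelow v (ψ (algebraMap F P.A c)) 1 := fun c => by
    rw [conj_algebraMap]
    refine reducesBelow_C ?_
    rw [IsScalarTower.algebraMap_apply F K P.KBar]
    exact (O.valuation_le_one_iff _).mpr (hO _)
  have hja : v ((ψ a).coeff j) = 1 := by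
    rw [hψa j (by omega), div_self hxj, one_pow, map_one]
  obtain ⟨d, hjd, hdm, hd⟩ := exists_hasReducedDegree (hψ_le a) hja (hψtop a m hm ha)
  obtain ⟨e, -, -, he⟩ := exists_hasReducedDegree (hψ_le b)
    (by rw [hψ0]; exact hvK _ (P.ne_zero_of_hasDegree hb)) (hψtop b (m + 1) m.succ_pos hb)
  have h1 := P.reducedDegree_mul_le ψ hc ha hb hd he (by omega)
  have he0 : 0 < e := by
    refine Nat.pos_of_ne_zero ?_
    rintro rfl
    rw [zero_mul, Nat.le_zero, mul_eq_zero] at h1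
    omega
  have h2 := P.reducedDegree_mul_le ψ hc hb ha he hd he0
  -- Proportionality gives d (m+1) = e m, hence m ∣ d, contradicting 0 < d < m.
  have h3 : m ∣ d * (m + 1) := ⟨e, by rw [le_antisymm h1 h2, mul_comm]⟩
  have h4 : m ∣ d := by
    rw [mul_add, mul_one] at h3
    exact (Nat.dvd_add_right (Dvd.intro_left d rfl)).mp h3
  exact absurd (Nat.le_of_dvd (by omega) h4) (by omega)

include hK hφ in
/-- The coefficients of the exponential are algebraic over `K`. -/
theorem isIntegral_coeff_expSeries (n : ℕ) : IsIntegral K ((P.expSeries φ).coeff n) := by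
  obtain ⟨m, hm, ⟨a, haA, ha⟩, b, hbA, hb⟩ := P.exists_consecutive_degrees hK
  obtain ⟨h0, hE⟩ := P.isExponential_expSeries hK hφ
  have hint := P.isIntegral_coeff hK hφ (a := ⟨a, haA⟩) (b := ⟨b, hbA⟩) hm ha hb
  induction n using Nat.strong_induction_on with
  | _ n ih =>
    cases n with
    | zero => rw [h0]; exact isIntegral_one
    | succ n =>
      have h1 := congrArg (fun E => E.coeff (n + 1)) (hE ⟨a, haA⟩)
      rw [coeff_mul_C, coeff_mul_succ, P.coeff_zero_of_isSgnNormalized hK hφ] at h1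
      simp only at h1
      have hne := P.pow_card_pow_ne hm ha n
      have h2 : (P.expSeries φ).coeff (n + 1) = algebraMap K P.KBar
            (a ^ Fintype.card F ^ (n + 1) - a)⁻¹ *
          ∑ p ∈ Finset.HasAntidiagonal.antidiagonal n,
            (φ ⟨a, haA⟩ : FrobSeries F P.KBar).coeff (p.1 + 1) *
              (P.expSeries φ).coeff p.2 ^ Fintype.card F ^ (p.1 + 1) := by
        have hne' : algebraMap K P.KBar (a ^ Fintype.card F ^ (n + 1) - a) ≠ 0 := by
          rwa [Ne, map_eq_zero]
        rw [map_inv₀, eq_inv_mul_iff_mul_eq₀ hne', map_sub, map_pow]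
        linear_combination h1
      rw [h2]
      refine isIntegral_algebraMap.mul (IsIntegral.sum _ fun p hp => ?_)
      have := Finset.HasAntidiagonal.mem_antidiagonal.mp hp
      exact (hint _).mul ((ih _ (by omega)).pow _)

end RationalPlace
end FunctionFieldMZV

/-! ### Comparison of ϖ⁻¹ exp_φ ϖ with exp_A. -/

namespace FunctionFieldMZV

theorem sum_zagierTuple (F : Type*) [Fintype F] [Nontrivial F] (k : ℕ) :
    (RationalPlace.zagierTuple F k).sum = Fintype.card F ^ k - 1 := by
  induction k with
  | zero => simp [RationalPlace.zagierTuple]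
  | succ k ih =>
    rw [RationalPlace.zagierTuple, List.range_succ, List.map_append, List.sum_append,
      ← RationalPlace.zagierTuple, ih, List.map_singleton, List.sum_singleton, Nat.mul_sub_one,
      ← pow_succ]
    have h1 := Nat.one_le_pow k (Fintype.card F) Fintype.card_pos
    have h2 : Fintype.card F ^ k ≤ Fintype.card F ^ (k + 1) :=
      Nat.pow_le_pow_right Fintype.card_pos k.le_succ
    omega

namespace RationalPlace

open Polynomial

variable {F K : Type*} [Field F] [Fintype F] [Field K] [Algebra F K] (P : RationalPlace F K)
variable (hK : IsCurveFunctionField F K) {π : P.KInf} (hπ : ‖π‖ = (Fintype.card F : ℝ)⁻¹)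
variable {φ : P.A →ₐ[F] FrobPoly F P.KBar} (hφ : P.IsSgnNormalized π φ) {ϖ : P.CInf}
  (hϖ : P.IsFundamentalPeriod φ ϖ)

include hK in
theorem exists_abs_ge (R : ℝ) : ∃ a ∈ P.A, R ≤ P.abs a := by
  obtain ⟨m, hm, ⟨a, haA, ha⟩, -⟩ := P.exists_consecutive_degrees hK
  have h1 : 1 < P.abs a := by
    rw [P.abs_eq_zpow ha, zpow_natCast]
    exact one_lt_pow₀ one_lt_card_real hm.ne'
  obtain ⟨n, hn⟩ := pow_unbounded_of_one_lt R h1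
  exact ⟨a ^ n, pow_mem haA n, by rw [map_pow]; exact hn.le⟩

variable (φ ϖ) in
/-- The coefficients of `ϖ⁻¹ exp_φ ϖ`. -/
def periodCoeff (k : ℕ) : P.CInf :=
  algebraMap P.KBar P.CInf ((P.expSeries φ).coeff k) * ϖ ^ (Fintype.card F ^ k - 1)

theorem periodCoeff_mul (ϖ : P.CInf) (k : ℕ) (z : P.CInf) :
    ϖ * (P.periodCoeff φ ϖ k * z ^ Fintype.card F ^ k) =
      algebraMap P.KBar P.CInf ((P.expSeries φ).coeff k) * (ϖ * z) ^ Fintype.card F ^ k := by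
  have h : ϖ ^ Fintype.card F ^ k = ϖ ^ (Fintype.card F ^ k - 1) * ϖ := by
    rw [← pow_succ, Nat.sub_add_cancel (Nat.one_le_pow k _ Fintype.card_pos)]
  rw [periodCoeff, mul_pow, h]
  ring

include hK hϖ in
/-- The exponential is entire, as its series converges at arbitrarily large points. -/
theorem isEntire_periodCoeff : IsEntire F (P.periodCoeff φ ϖ) := by
  obtain ⟨h0, hker⟩ := hϖ
  have hpos := norm_pos_iff.mpr h0
  intro R hR
  obtain ⟨a, haA, ha⟩ := P.exists_abs_ge hK R
  have hval : (P.expSeries φ).HasValue (algebraMap K P.CInf a * ϖ) 0 := by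
    change _ ∈ {z : P.CInf | (P.expSeries φ).HasValue z 0}
    rw [hker]
    exact ⟨⟨a, haA⟩, rfl⟩
  -- Being a zero includes convergence of the series at a ϖ, so its terms tend to 0 there; since |a|
  -- ≥ R they dominate the terms at radius R.
  have hlim := (hval.summable.tendsto_atTop_zero.norm).mul_const ‖ϖ‖⁻¹
  rw [norm_zero, zero_mul] at hlim
  refine squeeze_zero (fun k => by positivity) (fun k => ?_) hlim
  rw [le_mul_inv_iff₀ hpos, mul_comm (algebraMap K P.CInf a), ← P.periodCoeff_mul, norm_mul,
    mul_comm, norm_mul, norm_pow, norm_algebraMap_CInf]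
  gcongr

include hK hφ in
theorem periodCoeff_zero : P.periodCoeff φ ϖ 0 = 1 := by
  rw [periodCoeff, (P.isExponential_expSeries hK hφ).1, map_one, pow_zero, Nat.sub_self, pow_zero,
    one_mul]

/-- The truncations of exp_φ have coefficients in the algebraically closed field K̄_∞, and
substituting ϖ X preserves splitting. Algebraic closedness of ℂ_∞ is not needed. -/
theorem splits_linPoly_periodCoeff (hϖ : ϖ ≠ 0) (N : ℕ) :
    (linPoly F (P.periodCoeff φ ϖ) N).Splits := by
  have h1 : ((linPoly F (P.expSeries φ).coeff N).map (algebraMap P.KBar P.CInf)).Splits :=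
    (IsAlgClosed.splits _).map _
  have h2 : linPoly F (P.periodCoeff φ ϖ) N = C ϖ⁻¹ *
      ((linPoly F (P.expSeries φ).coeff N).map (algebraMap P.KBar P.CInf)).comp (C ϖ * X) := by
    simp only [linPoly, Polynomial.map_sum, Polynomial.map_mul, Polynomial.map_pow, map_C, map_X,
      Polynomial.sum_comp, mul_comp, C_comp, pow_comp, X_comp, Finset.mul_sum]
    refine Finset.sum_congr rfl fun k _ => ?_
    rw [mul_pow, ← C_pow, ← mul_assoc, ← mul_assoc, ← C_mul, ← C_mul]
    congr 2
    rw [periodCoeff, ← Nat.sub_add_cancel (Nat.one_le_pow k _ (Fintype.card_pos (α := F))), pow_succ,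
      Nat.add_sub_cancel]
    field_simp
  rw [h2]
  exact (Splits.C _).mul (h1.comp_of_natDegree_le_one ((natDegree_C_mul_le _ _).trans natDegree_X_le))

-- The zeros in the disc of radius q^d are exactly the elements of A_{<d}, so the Weierstrass
-- products over these discs are the polynomials e_d.
include hK hϖ in
theorem mem_latticeImage_iff (d : ℕ) (x : P.CInf) : x ∈ P.latticeImage hK d ↔
    ‖x‖ < (Fintype.card F : ℝ) ^ d ∧ frobSum F (P.periodCoeff φ ϖ) x = 0 := by
  have hent := P.isEntire_periodCoeff hK hϖ
  obtain ⟨h0, hker⟩ := hϖ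
  have hzero : frobSum F (P.periodCoeff φ ϖ) x = 0 ↔ ∃ a : P.A, x = algebraMap K P.CInf a := by
    have hsum := (hent.hasSum x).mul_left ϖ
    simp only [P.periodCoeff_mul] at hsum
    have h1 : frobSum F (P.periodCoeff φ ϖ) x = 0 ↔ (P.expSeries φ).HasValue (ϖ * x) 0 := by
      constructor
      · intro h
        rwa [h, mul_zero] at hsum
      · intro h
        exact (mul_eq_zero.mp (hsum.unique h)).resolve_left h0
    have h2 : (P.expSeries φ).HasValue (ϖ * x) 0 ↔
        ϖ * x ∈ {z : P.CInf | ∃ a : P.A, z = algebraMap K P.CInf a * ϖ} := by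
      rw [← hker]
      rfl
    rw [h1, h2, Set.mem_ofPred_eq]
    refine exists_congr fun a => ?_
    rw [mul_comm, mul_left_inj' h0]
  rw [hzero, latticeImage, Finset.mem_map]
  constructor
  · rintro ⟨a, ha, rfl⟩
    obtain ⟨haA, had⟩ := (P.mem_latticeFinset hK).mp ha
    refine ⟨?_, ⟨a, haA⟩, rfl⟩
    rw [Function.Embedding.coeFn_mk, norm_algebraMap_CInf]
    exact P.abs_lt_pow_iff.mpr had
  · rintro ⟨hx, a, rfl⟩
    rw [norm_algebraMap_CInf] at hx
    exact ⟨a, (P.mem_latticeFinset hK).mpr ⟨a.2, P.abs_lt_pow_iff.mp hx⟩, rfl⟩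

include hK hπ hφ hϖ in
/-- Comparison of `ϖ⁻¹ exp_φ ϖ` with the exponential of the lattice `A`. -/
theorem algebraMap_zetaSeries_coeff (k : ℕ) :
    algebraMap P.KInf P.CInf ((P.zetaSeries π).coeff k) = P.periodCoeff φ ϖ k := by
  classical
  have hent := P.isEntire_periodCoeff hK hϖ
  have hlim := hent.tendsto_rootPoly (P.periodCoeff_zero hK hφ)
    (P.splits_linPoly_periodCoeff hϖ.1)
    (tendsto_pow_atTop_atTop_of_one_lt (one_lt_card_real (F := F)))
    (P.mem_latticeImage_iff hK hϖ)
  have h := eq_zero_of_hasSum_zero (F := F) (f := fun k => algebraMap P.KInf P.CInf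
    ((P.zetaSeries π).coeff k) - P.periodCoeff φ ϖ k) (fun _ => P.exists_norm_lt) fun z => by
      have h1 := ((P.isEntire_zetaSeries hK hπ).hasSum z).sub (hent.hasSum z)
      have h2 := tendsto_nhds_unique (P.tendsto_rootPoly_latticeImage hK hπ z) (hlim z)
      rw [h2, sub_self] at h1
      simpa only [sub_mul] using h1
  exact sub_eq_zero.mp (congrFun h k)

include hK hπ hφ hϖ in
theorem algebraMap_zeta (k : ℕ) : algebraMap P.KInf P.CInf (P.zeta π (zagierTuple F k)) =
    (-1) ^ k * algebraMap P.KBar P.CInf ((P.expSeries φ).coeff k) *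
      ϖ ^ (Fintype.card F ^ k - 1) := by
  have h := P.algebraMap_zetaSeries_coeff hK hπ hφ hϖ k
  rw [periodCoeff, zetaSeries, map_mul, map_pow, map_neg, map_one] at h
  rw [mul_assoc, ← h, ← mul_assoc, ← mul_pow, neg_one_mul, neg_neg, one_pow, one_mul]

-- The weight q^k - 1 is exactly the exponent of ϖ in the value formula, so the quotient is, up to
-- sign, a coefficient of exp_φ.
include hK hπ hφ hϖ in
theorem isEulerian_zagierTuple (k : ℕ) : P.IsEulerian π ϖ (zagierTuple F k) := by
  rw [IsEulerian, P.algebraMap_zeta hK hπ hφ hϖ, sum_zagierTuple F,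
    mul_div_cancel_right₀ _ (pow_ne_zero _ hϖ.1)]
  have h1 : IsIntegral K ((-1) ^ k * (P.expSeries φ).coeff k) :=
    (isIntegral_one.neg.pow k).mul (P.isIntegral_coeff_expSeries hK hφ k)
  have h2 := (h1.map (IsScalarTower.toAlgHom K P.KBar P.CInf)).isAlgebraic
  rwa [IsScalarTower.coe_toAlgHom', map_mul, map_pow, map_neg, map_one] at h2

end RationalPlace

end FunctionFieldMZV

end

open FunctionFieldMZV in
theorem theorem1 {F K : Type*} [Field F] [Fintype F] [Field K] [Algebra F K]
    (hK : IsCurveFunctionField F K) (P : RationalPlace F K)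
    (π : P.KInf) (hπ : ‖π‖ = (Fintype.card F : ℝ)⁻¹)
    (φ : P.A →ₐ[F] FrobPoly F P.KBar) (hφ : P.IsStandard π φ)
    (ϖ : P.CInf) (hϖ : P.IsFundamentalPeriod φ ϖ) :
    -- the multiple zeta values in question are convergent limits
    (∀ k : ℕ, Filter.Tendsto
      (fun d => algebraMap K P.KInf (P.powerSumLT π (RationalPlace.zagierTuple F k) d))
      Filter.atTop (nhds (P.zeta π (RationalPlace.zagierTuple F k)))) ∧
    -- the product for `exp_A` converges, and `exp_A` is given by its series in `K_∞[[τ]]`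
    (∀ z : P.CInf,
      Multipliable (fun a : {a : P.A // a ≠ 0} => 1 - z / algebraMap K P.CInf (a : P.A))) ∧
    (∀ z : P.CInf, P.expASeries.HasValue z (P.expA z)) ∧
    -- the series `exp_φ` has its defining properties
    P.IsExponential φ (P.expSeries φ) ∧
    -- the formula `exp_A = ϖ⁻¹ exp_φ ϖ = ∑ (-1) ^ k ζ_A(q - 1, …, q ^ (k - 1) (q - 1)) τ ^ k`
    P.expASeries.map (algebraMap P.KInf P.CInf) =
      FrobSeries.C ϖ⁻¹ * (P.expSeries φ).map (algebraMap P.KBar P.CInf) * FrobSeries.C ϖ ∧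
    P.expASeries = P.zetaSeries π ∧
    -- the resulting formula for each value
    (∀ k : ℕ, algebraMap P.KInf P.CInf (P.zeta π (RationalPlace.zagierTuple F k)) =
      (-1) ^ k * algebraMap P.KBar P.CInf ((P.expSeries φ).coeff k) *
        ϖ ^ (Fintype.card F ^ k - 1)) ∧
    (∀ k : ℕ, P.IsEulerian π ϖ (RationalPlace.zagierTuple F k)) := by
  have hsgn := hφ.1
  refine ⟨P.tendsto_zeta hK hπ, fun z => (P.multipliable_and_expA_eq hK hπ z).1,
    P.expASeries_hasValue hK hπ, P.isExponential_expSeries hK hsgn, ?_,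
    P.expASeries_eq_zetaSeries hK hπ, P.algebraMap_zeta hK hπ hsgn hϖ,
    P.isEulerian_zagierTuple hK hπ hsgn hϖ⟩
  rw [P.expASeries_eq_zetaSeries hK hπ]
  ext k
  rw [FrobSeries.coeff_mul_C, FrobSeries.coeff_C_mul]
  change algebraMap P.KInf P.CInf ((P.zetaSeries π).coeff k) =
    ϖ⁻¹ * algebraMap P.KBar P.CInf ((P.expSeries φ).coeff k) * ϖ ^ Fintype.card F ^ k
  rw [P.algebraMap_zetaSeries_coeff hK hπ hsgn hϖ, RationalPlace.periodCoeff,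
    ← Nat.sub_add_cancel (Nat.one_le_pow k _ (Fintype.card_pos (α := F))), pow_succ,
    Nat.add_sub_cancel]
  have h0 := hϖ.1
  field_simp
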